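/- Notation. Let $\mathbb T$ be the circle of length $2\pi$, $U_\rho=\{z\in\mathbb C:|\operatorname{Im}z|<\rho\}$, $\Omega_\rho=U_\rho\times(-2,2)$ for $\rho>0$ and $\Omega_0=\mathbb T\times(-2,2)$. The space $B_\rho$ consists of all continuous $\eta:\Omega_0\to\mathbb R$ such that (i) for every $y_2\in(-2,2)$ the $2\pi$-periodic function $\eta(\cdot,y_2)$ extends to a holomorphic function on $U_\rho$ (again denoted by $\eta(\cdot,y_2)$); (ii) $\partial_{y_2}\eta$ exists on $\Omega_\rho$, is uniformly continuous there, and $\partial_{y_2}\eta(\cdot,y_2)$ is holomorphic on $U_\rho$ for every $y_2\in(-2,2)$; (iii) $\|\eta\|_\rho:=\|\eta\|_{L^\infty(\Omega_\rho)}+\|\partial_{y_1}\eta\|_{L^\infty(\Omega_\rho)}+\|\partial_{y_2}\eta\|_{L^\infty(\Omega_\rho)}<\infty$. Let $\alpha\in(0,1)$, let $\gamma_0:\mathbb T\to\mathbb R$ be real analytic, and let $\rho_0>0$ be such that $\gamma_0$ extends holomorphically to $U_{2\rho_0}$ with $4\|\operatorname{Im}\gamma_0'\|_{L^\infty(U_{\rho_0})}<1$.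 Put $$K_2(a_1,a_2)=\frac1{4\pi}\frac{\sin a_1}{\cosh a_2-\cos a_1}\quad(a_1\in\mathbb T,\ a_2\in\mathbb C),$$ $\Delta h(y_1,z_1)=h(y_1)-h(y_1-z_1)$, $\Delta g(y,z)=g(y)-g(y_1-z_1,z_2)$, and, for $y_1\in U_{\rho_0}$, $$s_0(y_1)=-2\int_{\mathbb T}K_2\big(z_1,\Delta\gamma_0(y_1,z_1)\big)\,\Delta\gamma_0'(y_1,z_1)\,dz_1 .$$ For $\rho\in(0,\rho_0)$, $\eta\in B_\rho$, $t\ge0$ and $y\in\Omega_\rho$ let $f_t^\eta(y)=\gamma_0(y_1)+t\,s_0(y_1)+\tfrac12t^{1+\alpha}\eta(y)$, $X^\eta_{t,2}(y)=t\,y_2+f_t^\eta(y)$, and let $F_0(\eta)=0$ and, for $t>0$, $$F_t(\eta)(y)=-\int_{\Omega_0}\Big[K_2\big(z_1,\Delta X^\eta_{t,2}(y,z)\big)\,\Delta\partial_{y_1}f_t^\eta(y,z)-K_2\big(z_1,\Delta\gamma_0(y_1,z_1)\big)\,\Delta\gamma_0'(y_1,z_1)\Big]dz .$$ Proposition. There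 are a constant $C_0>0$ depending only on the $L^\infty(U_{\rho_0})$-norms of the first $N$ derivatives of $\gamma_0$ (with $N$ a universal number), a constant $\bar a=\bar a(C_0)>0$ and a time $T=T(C_0,\alpha)\in(0,1)$ such that there is a unique family $t\mapsto\eta_t$ with the following properties: for every $\rho\in(0,\rho_0)$, with $$I_\rho:=\{t\in[0,T):\ C_0\,t^{1-\alpha}|\log t|<\bar a(\rho_0-\rho)\}$$ (where $t^{1-\alpha}|\log t|:=0$ at $t=0$), the map $I_\rho\ni t\mapsto\eta_t\in B_\rho$ is well defined and continuous, $\|\eta_t\|_\rho<1$ for all $t\in I_\rho$, and for all $y\in\Omega_\rho$ $$\eta_0(y)=0,\qquad \eta_t(y)=\frac1{t^{1+\alpha}}\int_0^tF_s(\eta_s)(y)\,ds\quad(t\in I_\rho,\ t>0),$$ all integrals in this equation being absolutely convergent. -/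

import Mathlib

open Set Filter Topology MeasureTheory
open scoped ENNReal

noncomputable section

namespace IPM

/-- The complex strip `U_ρ = {z ∈ ℂ : |Im z| < ρ}`. -/
def strip (ρ : ℝ) : Set ℂ := {z : ℂ | |z.im| < ρ}

/-- `Ω_ρ = U_ρ × (-2, 2)`. -/
def Omega (ρ : ℝ) : Set (ℂ × ℝ) := strip ρ ×ˢ Ioo (-2 : ℝ) 2

/-- The domain `Ω_0 = 𝕋 × (-2, 2)`, with the circle of length `2π` represented by `[-π, π)`. -/
def Omega0 : Set (ℝ × ℝ) := Ico (-Real.pi) Real.pi ×ˢ Ioo (-2 : ℝ) 2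

/-- Complex derivative in the first variable. -/
def dy1 (u : ℂ → ℝ → ℂ) (y₁ : ℂ) (y₂ : ℝ) : ℂ := deriv (fun w : ℂ => u w y₂) y₁

/-- Real partial derivative in the second variable. -/
def dy2 (u : ℂ → ℝ → ℂ) (y₁ : ℂ) (y₂ : ℝ) : ℂ := deriv (fun s : ℝ => u y₁ s) y₂

/-- Supremum norm on `Ω_ρ`. For the functions occurring below (continuous on the open set `Ω_ρ`)
it coincides with the `L^∞(Ω_ρ)` norm. -/
def supOmega (ρ : ℝ) (u : ℂ → ℝ → ℂ) : ℝ≥0∞ := ⨆ y ∈ Omega ρ, ‖u y.1 y.2‖ₑ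

/-- Supremum norm on the strip `U_ρ`. -/
def supStrip (ρ : ℝ) (h : ℂ → ℂ) : ℝ≥0∞ := ⨆ z ∈ strip ρ, ‖h z‖ₑ

/-- `‖η‖_ρ = ‖η‖_{L^∞(Ω_ρ)} + ‖∂_{y₁}η‖_{L^∞(Ω_ρ)} + ‖∂_{y₂}η‖_{L^∞(Ω_ρ)}`. -/
def normB (ρ : ℝ) (η : ℂ → ℝ → ℂ) : ℝ≥0∞ :=
  supOmega ρ η + supOmega ρ (dy1 η) + supOmega ρ (dy2 η)

/-- The space `B_ρ`. An element, a real continuous function on `𝕋 × (-2, 2)`, is represented by its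
(unique) extension to `Ω_ρ` that is holomorphic in `y₁`; only values on `Ω_ρ` are relevant. -/
structure MemB (ρ : ℝ) (η : ℂ → ℝ → ℂ) : Prop where
  real : ∀ (x : ℝ), ∀ y₂ ∈ Ioo (-2 : ℝ) 2, (η x y₂).im = 0
  periodic : ∀ (x : ℝ), ∀ y₂ ∈ Ioo (-2 : ℝ) 2, η ((x + 2 * Real.pi : ℝ) : ℂ) y₂ = η x y₂
  continuous : ContinuousOn (fun p : ℝ × ℝ => η p.1 p.2) (univ ×ˢ Ioo (-2 : ℝ) 2)
  holomorphic : ∀ y₂ ∈ Ioo (-2 : ℝ) 2, DifferentiableOn ℂ (fun w => η w y₂) (strip ρ)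
  differentiable_y2 : ∀ y ∈ Omega ρ, DifferentiableAt ℝ (fun s : ℝ => η y.1 s) y.2
  uniformContinuous_dy2 : UniformContinuousOn (fun y : ℂ × ℝ => dy2 η y.1 y.2) (Omega ρ)
  holomorphic_dy2 : ∀ y₂ ∈ Ioo (-2 : ℝ) 2, DifferentiableOn ℂ (fun w => dy2 η w y₂) (strip ρ)
  norm_lt_top : normB ρ η < ⊤

/-- `K₂(a) = (1/4π) sin a₁ / (cosh a₂ - cos a₁)`, the second component of the Biot-Savart kernel on
`𝕋 × ℝ`, extended to complex `a₂`. -/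
def K2 (a₁ : ℝ) (a₂ : ℂ) : ℂ :=
  1 / (4 * Real.pi) * (Real.sin a₁ / (Complex.cosh a₂ - Real.cos a₁))

/-- `Δh(y₁, z₁) = h(y₁) - h(y₁ - z₁)`. -/
def diff1 (h : ℂ → ℂ) (y₁ : ℂ) (z₁ : ℝ) : ℂ := h y₁ - h (y₁ - z₁)

/-- `Δu(y, z) = u(y) - u(y₁ - z₁, z₂)`. -/
def diff2 (u : ℂ → ℝ → ℂ) (y₁ : ℂ) (y₂ : ℝ) (z : ℝ × ℝ) : ℂ := u y₁ y₂ - u (y₁ - z.1) z.2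

/-- The complex extension of the initial normal velocity,
`s₀(y₁) = -2 ∫_𝕋 K₂(z₁, Δγ₀(y₁, z₁)) Δγ₀'(y₁, z₁) dz₁`, with `g` the extension of `γ₀`. -/
def s0 (g : ℂ → ℂ) (y₁ : ℂ) : ℂ :=
  -2 * ∫ z₁ in Ico (-Real.pi) Real.pi, K2 z₁ (diff1 g y₁ z₁) * diff1 (deriv g) y₁ z₁

/-- `f_t^η(y) = γ₀(y₁) + t s₀(y₁) + (1/2) t^{1+α} η(y)`. -/
def fFun (g : ℂ → ℂ) (α t : ℝ) (η : ℂ → ℝ → ℂ) (y₁ : ℂ) (y₂ : ℝ) : ℂ :=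
  g y₁ + t * s0 g y₁ + 1 / 2 * (t ^ (1 + α) : ℝ) * η y₁ y₂

/-- The second component of `X_t^η(y) = (y₁, t y₂ + f_t^η(y))`. -/
def X2 (g : ℂ → ℂ) (α t : ℝ) (η : ℂ → ℝ → ℂ) (y₁ : ℂ) (y₂ : ℝ) : ℂ :=
  t * y₂ + fFun g α t η y₁ y₂

/-- `K₂(ΔX_t^η(y,z)) Δ∂_{y₁}f_t^η(y,z) - K₂(ΔX_0(y₁,z₁)) Δγ₀'(y₁,z₁)`. The first component of
`ΔX_t^η(y,z)` is `z₁`. -/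
def integrand (g : ℂ → ℂ) (α t : ℝ) (η : ℂ → ℝ → ℂ) (y₁ : ℂ) (y₂ : ℝ) (z : ℝ × ℝ) : ℂ :=
  K2 z.1 (diff2 (X2 g α t η) y₁ y₂ z) * diff2 (dy1 (fFun g α t η)) y₁ y₂ z
    - K2 z.1 (diff1 g y₁ z.1) * diff1 (deriv g) y₁ z.1

/-- The nonlocal operator `F_t(η)`, with `F_0(η) = 0`. -/
def F (g : ℂ → ℂ) (α t : ℝ) (η : ℂ → ℝ → ℂ) (y₁ : ℂ) (y₂ : ℝ) : ℂ :=
  if 0 < t then -∫ z in Omega0, integrand g α t η y₁ y₂ z else 0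

/-- `I_ρ = {t ∈ [0,T) : C₀ t^{1-α} |log t| < a (ρ₀ - ρ)}`. -/
def timeSet (ρ₀ α C₀ a T ρ : ℝ) : Set ℝ :=
  {t : ℝ | t ∈ Ico 0 T ∧ C₀ * (t ^ (1 - α) * |Real.log t|) < a * (ρ₀ - ρ)}

/-- The family `t ↦ η_t` maps, for every `ρ ∈ (0,ρ₀)`, the set `I_ρ` continuously into the open unit
ball of `B_ρ`, vanishes at `t = 0` and solves `η_t = t^{-(1+α)} ∫₀ᵗ F_s(η_s) ds` on `Ω_ρ`. -/
structure IsSolution (g : ℂ → ℂ) (ρ₀ α C₀ a T : ℝ) (η : ℝ → ℂ → ℝ → ℂ) : Prop where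
  mem : ∀ ρ ∈ Ioo 0 ρ₀, ∀ t ∈ timeSet ρ₀ α C₀ a T ρ, MemB ρ (η t)
  continuous : ∀ ρ ∈ Ioo 0 ρ₀, ∀ t₀ ∈ timeSet ρ₀ α C₀ a T ρ,
    Tendsto (fun t => normB ρ (η t - η t₀)) (𝓝[timeSet ρ₀ α C₀ a T ρ] t₀) (𝓝 0)
  norm_lt_one : ∀ ρ ∈ Ioo 0 ρ₀, ∀ t ∈ timeSet ρ₀ α C₀ a T ρ, normB ρ (η t) < 1
  initial : ∀ ρ ∈ Ioo 0 ρ₀, ∀ y ∈ Omega ρ, η 0 y.1 y.2 = 0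
  equation : ∀ ρ ∈ Ioo 0 ρ₀, ∀ t ∈ timeSet ρ₀ α C₀ a T ρ, 0 < t → ∀ y ∈ Omega ρ,
    η t y.1 y.2 = 1 / ((t ^ (1 + α) : ℝ) : ℂ) * ∫ s in (0 : ℝ)..t, F g α s (η s) y.1 y.2

end IPM

end

open Set Filter Topology MeasureTheory
open scoped ENNReal

noncomputable section

namespace IPM

/-! ### The kernel at complex arguments -/

/-! The equation is a fixed point problem for `Phi`, the map sending `η` to the family `t^{-(1+α)}
∫₀ᵗ F_s(η_s) ds`, and it is solved by an abstract Cauchy-Kovalevskaya scheme in the scale `B_ρ`.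
There are two ingredients: estimates of `F` at a fixed time with loss of one derivative, and a
contraction in a norm whose weight blows up at the boundary of the shrinking domain.

Fixed time. Write `z`, `w` for the increments of the two variables. Since `cosh a - cos z = 2
sin((z+ia)/2) sin((z-ia)/2)`, the slope condition on `Im γ₀'` keeps the denominator of the kernel
comparable to `(|z| + t|w|)²` even for complex arguments (`norm_cosh_sub_cos_ge`). After subtraction
of the value at `t = 0`, the integrand of `F_t` is bounded by a constant times `maj = t / (|z| +
t|w|)`. So is its `y₂`-derivative, at the price of a factor `1/d` when the strip is narrowed by `d`.
The integral of `maj` is of order `t|log t|` (`integral_maj_le`), so Cauchy estimates give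
`‖F_t(η)‖_{ρ-d} ≤ C t|log t| / d` (`reg_F`). The integrand is holomorphic in the increments of `η`,
so the Schwarz lemma turns the size bound into a Lipschitz bound with the extra factor `t^α ‖η -
ζ‖_ρ` (`reg_F_sub`). No second derivative of the kernel has to be estimated.

Time integration. Let `φ(t) = t^{1-α}|log t|` and let `D(t) = ρ₀ - lam φ(t) - ρ` be the width still
available. Distances are measured by the best `M` in `‖η_t - ζ_t‖_ρ ≤ M φ(t) / D(t)` (`Close`). With
`d = D(s)/2` the Lipschitz bound produces `D(s)^{-2}`. Because `φ(t) - φ(s) ≥ k|log t|(t - s)` with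
`k` of order `T^{-α}` (`phi_slope`), the time integral of `D(s)^{-2}` is at most `1/(lam k |log t|
D(t))`. The logarithm and one power of `D` are thereby recovered, and `Phi` contracts by `1/4` once
`T` is small (`close_Phi`).

This weighted bound does not control the norm near the boundary, so the n-th iterate lives on a
slightly larger domain, with speed `lamSeq lam n` increasing to `lam`. Passing to the next domain
converts closeness into a genuine bound, and the resulting series is summable and stays in the unit
ball (`iter_spec`). The limit solves the equation. Two solutions are close with some `M` because
both are values of `Phi`, hence with `M/4`, `M/16` and so on, hence equal (`fixed_unique`). -/

/-- The derivative of `K2` in its second argument. -/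
def K2d (z : ℝ) (a : ℂ) : ℂ :=
  -(1 / (4 * Real.pi) * (Real.sin z * Complex.sinh a / (Complex.cosh a - Real.cos z) ^ 2))

/-- Below `π/2` this is Jordan's inequality; beyond, the same inequality is applied to `π - x`. The
range must exceed `π/2`: the lemma is used at `(z ± Im a)/2`, where `|z|` may equal `π` and `Im a`
adds almost another `π/2`. -/
lemma abs_div_five_le_abs_sin {x : ℝ} (hx : |x| ≤ 3 * Real.pi / 4) : |x| / 5 ≤ |Real.sin x| := by
  have hpi := Real.pi_pos
  have hpi4 := Real.pi_le_four
  have key : ∀ x : ℝ, 0 ≤ x → x ≤ 3 * Real.pi / 4 → x / 5 ≤ Real.sin x := by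
    intro x h0 h1
    rcases le_total x (Real.pi / 2) with h | h
    · have := Real.mul_le_sin h0 h
      have h2 : x / 5 ≤ 2 / Real.pi * x := by
        rw [div_mul_eq_mul_div, div_le_div_iff₀ (by norm_num) hpi]; nlinarith
      linarith
    · have := Real.mul_le_sin (x := Real.pi - x) (by linarith) (by linarith)
      rw [Real.sin_pi_sub] at this
      have h2 : (1 : ℝ) / 2 ≤ 2 / Real.pi * (Real.pi - x) := by
        rw [div_mul_eq_mul_div, div_le_div_iff₀ (by norm_num) hpi]; nlinarith
      have h3 : x ≤ 2.4 := by
        have := Real.pi_lt_d2; linarith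
      linarith
  rcases le_total 0 x with h | h
  · rw [abs_of_nonneg h] at hx ⊢
    exact (key x h hx).trans (le_abs_self _)
  · rw [abs_of_nonpos h] at hx ⊢
    have := key (-x) (by linarith) hx
    rw [Real.sin_neg] at this
    exact this.trans (neg_le_abs _)

lemma normSq_sin (A B : ℝ) :
    ‖Complex.sin (A + B * Complex.I)‖ ^ 2 = Real.sin A ^ 2 + Real.sinh B ^ 2 := by
  rw [Complex.sin_add_mul_I, ← Complex.normSq_eq_norm_sq, ← Complex.ofReal_sin,
    ← Complex.ofReal_cosh, ← Complex.ofReal_cos, ← Complex.ofReal_sinh, ← Complex.ofReal_mul,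
    ← Complex.ofReal_mul, Complex.normSq_add_mul_I]
  have h1 := Real.sin_sq_add_cos_sq A
  have h2 := Real.cosh_sq B
  rw [mul_pow, mul_pow, h2]
  have : Real.cos A ^ 2 = 1 - Real.sin A ^ 2 := by linarith
  rw [this]; ring

lemma abs_sin_le_norm_sin (A B : ℝ) : |Real.sin A| ≤ ‖Complex.sin (A + B * Complex.I)‖ := by
  apply abs_le_of_sq_le_sq' _ (norm_nonneg _) |> abs_le.2
  rw [normSq_sin]; nlinarith [sq_nonneg (Real.sinh B)]

lemma abs_le_norm_sin (A B : ℝ) : |B| ≤ ‖Complex.sin (A + B * Complex.I)‖ := by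
  apply abs_le_of_sq_le_sq' _ (norm_nonneg _) |> abs_le.2
  rw [normSq_sin]
  have : B ^ 2 ≤ Real.sinh B ^ 2 := by
    rw [sq_le_sq, Real.abs_sinh]
    exact Real.self_le_sinh_iff.2 (abs_nonneg _)
  nlinarith [sq_nonneg (Real.sin A)]

/-- The factorisation reduces a lower bound of the kernel's denominator to one for the modulus of a
complex sine, which is explicit. -/
lemma cosh_sub_cos (a z : ℂ) : Complex.cosh a - Complex.cos z =
    2 * (Complex.sin ((z + a * Complex.I) / 2) * Complex.sin ((z - a * Complex.I) / 2)) := by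
  have h := Complex.cos_sub_cos (a * Complex.I) z
  rw [Complex.cos_mul_I] at h
  rw [h, show (a * Complex.I - z) / 2 = -((z - a * Complex.I) / 2) by ring, Complex.sin_neg,
    add_comm z]
  ring

/-- `|sin(A + iB)|` dominates both `|sin A|` and `|B|`, so it is enough that one of the two parts is
large. -/
lemma norm_sin_factor_ge {p u l : ℝ} (hp : |p| ≤ 3 * Real.pi / 2)
    (h : l ≤ |p| ∨ l ≤ |u|) (hl : 0 ≤ l) :
    l / 10 ≤ ‖Complex.sin (((p / 2 : ℝ) : ℂ) + ((u / 2 : ℝ) : ℂ) * Complex.I)‖ := by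
  rcases h with h | h
  · refine le_trans ?_ (abs_sin_le_norm_sin _ _)
    have hp2 : |p / 2| = |p| / 2 := by rw [abs_div]; norm_num
    refine le_trans ?_ (abs_div_five_le_abs_sin (by rw [hp2]; linarith))
    rw [hp2]; linarith
  · refine le_trans ?_ (abs_le_norm_sin _ _)
    have hp2 : |u / 2| = |u| / 2 := by rw [abs_div]; norm_num
    rw [hp2]; linarith

/-- Lower bound of the denominator of the kernel in a cone of complex arguments. -/
lemma norm_cosh_sub_cos_ge {c z x : ℝ} {Γ e : ℂ} (hc : 1 ≤ c) (hz : |z| ≤ Real.pi) (hx : |x| ≤ 1)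
    (hΓ : ‖Γ‖ ≤ c * |z|) (hΓi : |Γ.im| ≤ |z| / 4) (he : ‖e‖ ≤ |z| / 8 + |x| / (16 * c)) :
    (|z| + |x|) ^ 2 / (5000 * c ^ 2) ≤ ‖Complex.cosh (x + Γ + e) - Real.cos z‖ := by
  set a : ℂ := x + Γ + e with ha
  have hcp : 0 < c := by linarith
  have hu : a.re = x + Γ.re + e.re := by simp [ha]
  have hv : a.im = Γ.im + e.im := by simp [ha]
  have hΓr := (Complex.abs_re_le_norm Γ).trans hΓ
  have her := (Complex.abs_re_le_norm e).trans he
  have hei := (Complex.abs_im_le_norm e).trans he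
  have hz0 := abs_nonneg z
  have hx0 := abs_nonneg x
  have hxc : |x| / (16 * c) ≤ |x| / 16 := by
    apply div_le_div_of_nonneg_left hx0 (by norm_num); linarith
  have hvb : |a.im| ≤ 3 / 8 * |z| + |x| / (16 * c) := by
    rw [hv]; refine (abs_add_le _ _).trans ?_; linarith
  have hpi := Real.pi_gt_three
  have key : ∀ p : ℝ, |p| ≤ |z| + |a.im| → |z| - |a.im| ≤ |p| →
      (|z| + |x|) / (100 * c) ≤
        ‖Complex.sin (((p / 2 : ℝ) : ℂ) + ((a.re / 2 : ℝ) : ℂ) * Complex.I)‖ ∧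
      (|z| + |x|) / (100 * c) ≤
        ‖Complex.sin (((p / 2 : ℝ) : ℂ) + ((-a.re / 2 : ℝ) : ℂ) * Complex.I)‖ := by
    intro p hp1 hp2
    have hp3 : |p| ≤ 3 * Real.pi / 2 := by linarith
    have hl : (0 : ℝ) ≤ (|z| + |x|) / (10 * c) := by positivity
    have hor : (|z| + |x|) / (10 * c) ≤ |p| ∨ (|z| + |x|) / (10 * c) ≤ |a.re| := by
      rw [div_le_iff₀ (by positivity), div_le_iff₀ (by positivity)]
      -- If `|x| ≤ 3c|z|`, then `Im a` is at most `9|z|/16` and `p` is comparable to `z`. Otherwise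
      -- `x` dominates `Re Γ` and `Re e`, and `Re a` is comparable to `x`.
      rcases le_total |x| (3 * c * |z|) with h | h
      · left
        have h1 : |x| / (16 * c) ≤ 3 / 16 * |z| := by
          rw [div_le_iff₀ (by positivity)]; linarith
        have h2 : 7 / 16 * |z| ≤ |p| := by linarith
        have h3 : 7 / 16 * |z| * (10 * c) ≤ |p| * (10 * c) :=
          mul_le_mul_of_nonneg_right h2 (by positivity)
        have h4 : |z| ≤ c * |z| := le_mul_of_one_le_left hz0 hc
        linarith
      · right
        have h1 : |x| ≤ |a.re| + |Γ.re| + |e.re| := by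
          have : x = a.re - Γ.re - e.re := by rw [hu]; ring
          calc |x| = |a.re - Γ.re - e.re| := by rw [← this]
            _ ≤ |a.re - Γ.re| + |e.re| := abs_sub _ _
            _ ≤ _ := by gcongr; exact abs_sub _ _
        have h4 : |z| ≤ c * |z| := le_mul_of_one_le_left hz0 hc
        have h5 : |x| / 4 ≤ |a.re| := by linarith
        have h6 : |x| / 4 * (10 * c) ≤ |a.re| * (10 * c) :=
          mul_le_mul_of_nonneg_right h5 (by positivity)
        have h7 : |x| ≤ c * |x| := le_mul_of_one_le_left hx0 hc
        linarith
    have e1 : (|z| + |x|) / (100 * c) = (|z| + |x|) / (10 * c) / 10 := by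
      field_simp; norm_num
    rw [e1]
    refine ⟨norm_sin_factor_ge hp3 hor hl, norm_sin_factor_ge hp3 ?_ hl⟩
    rwa [abs_neg]
  rw [Complex.ofReal_cos, cosh_sub_cos, norm_mul, norm_mul]
  have ea : a = a.re + a.im * Complex.I := (Complex.re_add_im a).symm
  have e1 : ((z : ℂ) + a * Complex.I) / 2 =
      (((z - a.im) / 2 : ℝ) : ℂ) + ((a.re / 2 : ℝ) : ℂ) * Complex.I := by
    apply Complex.ext <;> simp [sub_eq_add_neg]
  have e2 : ((z : ℂ) - a * Complex.I) / 2 =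
      (((z + a.im) / 2 : ℝ) : ℂ) + ((-a.re / 2 : ℝ) : ℂ) * Complex.I := by
    apply Complex.ext <;> simp
  rw [e1, e2]
  have k1 := (key (z - a.im) (abs_sub _ _) (abs_sub_abs_le_abs_sub _ _)).1
  have k2 := (key (z + a.im) (abs_add_le _ _) (by
    have := abs_sub_abs_le_abs_sub z (-a.im); rwa [abs_neg, sub_neg_eq_add] at this)).2
  have k3 := mul_le_mul k1 k2 (by positivity) (norm_nonneg _)
  have e3 : (|z| + |x|) ^ 2 / (5000 * c ^ 2) =
      2 * ((|z| + |x|) / (100 * c) * ((|z| + |x|) / (100 * c))) := by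
    field_simp; ring
  rw [e3, Complex.norm_ofNat]
  linarith

lemma norm_sinh_le (a : ℂ) : ‖Complex.sinh a‖ ≤ ‖a‖ * Real.exp ‖a‖ := by
  have h : ∀ b ∈ Metric.closedBall (0 : ℂ) ‖a‖, ‖Complex.cosh b‖ ≤ Real.exp ‖a‖ := by
    intro b hb
    rw [mem_closedBall_zero_iff] at hb
    rw [Complex.cosh, norm_div, Complex.norm_ofNat]
    have h1 : ‖Complex.exp b‖ ≤ Real.exp ‖a‖ :=
      (Complex.norm_exp_le_exp_norm b).trans (Real.exp_le_exp.2 hb)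
    have h2 : ‖Complex.exp (-b)‖ ≤ Real.exp ‖a‖ :=
      (Complex.norm_exp_le_exp_norm (-b)).trans (Real.exp_le_exp.2 (by rwa [norm_neg]))
    have := norm_add_le (Complex.exp b) (Complex.exp (-b))
    linarith
  have := (convex_closedBall (0 : ℂ) ‖a‖).norm_image_sub_le_of_norm_hasDerivWithin_le
    (f := Complex.sinh) (fun b _ => (Complex.hasDerivAt_sinh b).hasDerivWithinAt) h
    (x := 0) (y := a) (by simp) (by simp)
  simpa [mul_comm] using this

lemma norm_cosh_sub_cosh_le {a b : ℂ} {r : ℝ} (ha : ‖a‖ ≤ r) (hb : ‖b‖ ≤ r) :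
    ‖Complex.cosh a - Complex.cosh b‖ ≤ r * Real.exp r * ‖a - b‖ := by
  have h : ∀ b ∈ Metric.closedBall (0 : ℂ) r, ‖Complex.sinh b‖ ≤ r * Real.exp r := by
    intro b hb
    rw [mem_closedBall_zero_iff] at hb
    refine (norm_sinh_le b).trans ?_
    gcongr
    exact (norm_nonneg _).trans hb
  exact (convex_closedBall (0 : ℂ) r).norm_image_sub_le_of_norm_hasDerivWithin_le
    (f := Complex.cosh) (fun b _ => (Complex.hasDerivAt_cosh b).hasDerivWithinAt) h
    (by simpa using hb) (by simpa using ha)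

lemma K2_zero (a : ℂ) : K2 0 a = 0 := by simp [K2]

lemma K2d_zero (a : ℂ) : K2d 0 a = 0 := by simp [K2d]

lemma hasDerivAt_K2 {z : ℝ} {a : ℂ} (h : z ≠ 0 → Complex.cosh a - Real.cos z ≠ 0) :
    HasDerivAt (K2 z) (K2d z a) a := by
  rcases eq_or_ne z 0 with rfl | hz
  · have : K2 0 = fun _ => 0 := funext K2_zero
    rw [this, K2d_zero]; exact hasDerivAt_const _ _
  · have h1 := (((Complex.hasDerivAt_cosh a).sub_const (Real.cos z : ℂ)).inv (h hz)).const_mul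
      (Real.sin z : ℂ) |>.const_mul (1 / (4 * Real.pi) : ℂ)
    refine (h1.congr_deriv ?_).congr_of_eventuallyEq (Eventually.of_forall fun b => ?_)
    · simp only [K2d]; ring
    · simp only [K2, div_eq_mul_inv]; rfl

lemma norm_const_le : ‖(1 / (4 * Real.pi) : ℂ)‖ ≤ 1 := by
  have hpi := Real.pi_gt_three
  rw [norm_div, norm_mul, Complex.norm_real, Real.norm_of_nonneg (by linarith), norm_one,
    Complex.norm_ofNat, div_le_one (by positivity)]
  linarith

lemma norm_const_mul_le (x : ℂ) : ‖(1 / (4 * Real.pi) : ℂ) * x‖ ≤ ‖x‖ := by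
  rw [norm_mul]; exact mul_le_of_le_one_left (norm_nonneg _) norm_const_le

lemma norm_K2_le {z l : ℝ} {a : ℂ} (hl : 0 < l) (h : l ≤ ‖Complex.cosh a - Real.cos z‖) :
    ‖K2 z a‖ ≤ |z| / l := by
  rw [K2]
  refine (norm_const_mul_le _).trans ?_
  rw [norm_div, Complex.norm_real, Real.norm_eq_abs]
  exact div_le_div₀ (abs_nonneg _) Real.abs_sin_le_abs hl h

lemma norm_K2d_le {z l : ℝ} {a : ℂ} (hl : 0 < l) (h : l ≤ ‖Complex.cosh a - Real.cos z‖) :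
    ‖K2d z a‖ ≤ |z| * ‖Complex.sinh a‖ / l ^ 2 := by
  rw [K2d, norm_neg]
  refine (norm_const_mul_le _).trans ?_
  rw [norm_div, norm_mul, norm_pow, Complex.norm_real, Real.norm_eq_abs]
  exact div_le_div₀ (by positivity)
    (mul_le_mul_of_nonneg_right Real.abs_sin_le_abs (norm_nonneg _)) (by positivity)
    (pow_le_pow_left₀ hl.le h 2)

/-- The two denominators keep separate lower bounds because they differ in size: with the
`t`-dependent argument it is of order `(|z| + t|w|)²`, at `t = 0` only of order `|z|²`. -/
lemma norm_K2_sub_le {z l m : ℝ} {a b : ℂ} (hl : 0 < l) (hm : 0 < m)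
    (h : l ≤ ‖Complex.cosh a - Real.cos z‖) (h' : m ≤ ‖Complex.cosh b - Real.cos z‖) :
    ‖K2 z a - K2 z b‖ ≤ |z| * ‖Complex.cosh a - Complex.cosh b‖ / (l * m) := by
  have h0 : Complex.cosh a - Real.cos z ≠ 0 := norm_pos_iff.1 (hl.trans_le h)
  have h1 : Complex.cosh b - Real.cos z ≠ 0 := norm_pos_iff.1 (hm.trans_le h')
  have e : K2 z a - K2 z b = (1 / (4 * Real.pi) : ℂ) * (Real.sin z *
      (Complex.cosh b - Complex.cosh a) /
        ((Complex.cosh a - Real.cos z) * (Complex.cosh b - Real.cos z))) := by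
    rw [K2, K2, ← mul_sub, div_sub_div _ _ h0 h1]; ring
  rw [e]
  refine (norm_const_mul_le _).trans ?_
  rw [norm_div, norm_mul, norm_mul, Complex.norm_real, Real.norm_eq_abs,
    norm_sub_rev (Complex.cosh b)]
  exact div_le_div₀ (by positivity)
    (mul_le_mul_of_nonneg_right Real.abs_sin_le_abs (norm_nonneg _)) (by positivity)
    (mul_le_mul h h' hm.le (norm_nonneg _))


/-! ### Pointwise bounds of the integrands in terms of increments -/

/-- Admissible increments of the background: `Γ = Δγ₀`, `Γ' = Δγ₀'`, `σ = Δs₀` at a point with first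
increment `z` and second increment `w`. -/
structure Config (c S t z w : ℝ) (Γ Γ' σ : ℂ) : Prop where
  hc : 1 ≤ c
  hS : 1 ≤ S
  t_pos : 0 < t
  t_le : t ≤ 1 / 4
  tS_le : t * S ≤ 1 / 16
  hz : |z| ≤ Real.pi
  hw : |w| ≤ 4
  hΓ : ‖Γ‖ ≤ c * |z|
  hΓi : |Γ.im| ≤ |z| / 4
  hΓ' : ‖Γ'‖ ≤ c * |z|
  hσ : ‖σ‖ ≤ S * |z|

/-- The second component of the increment of the perturbed map, `e` being the increment of
`t ^ α • η`. -/
def arg (t w : ℝ) (Γ σ e : ℂ) : ℂ := ((t * w : ℝ) : ℂ) + Γ + (t * σ + 1 / 2 * t * e)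

/-- The integrand of `F` in terms of increments. -/
def incrF (z t w : ℝ) (Γ Γ' σ σ' e e' : ℂ) : ℂ :=
  K2 z (arg t w Γ σ e) * (Γ' + t * σ' + 1 / 2 * t * e') - K2 z Γ * Γ'

/-- The integrand of `∂_{y₂} F` in terms of increments. -/
def incrF2 (z t w : ℝ) (Γ Γ' σ σ' e e' p q : ℂ) : ℂ :=
  K2d z (arg t w Γ σ e) * (t + 1 / 2 * t * p) * (Γ' + t * σ' + 1 / 2 * t * e') +
    K2 z (arg t w Γ σ e) * (1 / 2 * t * q)

/-- The constant in the bound of `incrF`. -/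
def constF (c S : ℝ) : ℝ :=
  18 * c ^ 2 * Real.exp (10 * c) * S * (5000 * c ^ 2) ^ 2 + 15000 * c ^ 2 * S

/-- The constant in the bound of `incrF2`. -/
def constF2 (c : ℝ) : ℝ := 8 * c ^ 2 * Real.exp (10 * c) * (5000 * c ^ 2) ^ 2 + 5000 * c ^ 2

namespace Config

variable {c S t z w : ℝ} {Γ Γ' σ σ' e e' p q : ℂ}

lemma norm_corr_le (h : Config c S t z w Γ Γ' σ) (he : ‖e‖ ≤ (|z| + |w|) / (8 * c)) :
    ‖(t * σ + 1 / 2 * t * e : ℂ)‖ ≤ |z| / 8 + |t * w| / (16 * c) := by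
  obtain ⟨hc, hS, ht, ht4, htS, hz, hw, h1, h2, h3, h4⟩ := h
  have hcp : 0 < c := by linarith
  have n1 : ‖(t * σ : ℂ)‖ ≤ |z| / 16 := by
    rw [norm_mul, Complex.norm_real, Real.norm_of_nonneg ht.le]
    calc t * ‖σ‖ ≤ t * (S * |z|) := by gcongr
      _ = t * S * |z| := by ring
      _ ≤ 1 / 16 * |z| := by gcongr
      _ = _ := by ring
  have n2 : ‖(1 / 2 * t * e : ℂ)‖ ≤ |z| / 16 + |t * w| / (16 * c) := by
    rw [norm_mul, norm_mul, Complex.norm_real, Real.norm_of_nonneg ht.le, norm_div, norm_one,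
      Complex.norm_ofNat, abs_mul, abs_of_pos ht]
    calc 1 / 2 * t * ‖e‖ ≤ 1 / 2 * t * ((|z| + |w|) / (8 * c)) := by gcongr
      _ = t * |z| / (16 * c) + t * |w| / (16 * c) := by field_simp; ring
      _ ≤ 1 * |z| / (16 * 1) + t * |w| / (16 * c) := by gcongr; linarith
      _ = _ := by ring
  calc _ ≤ _ := norm_add_le _ _
    _ ≤ |z| / 16 + (|z| / 16 + |t * w| / (16 * c)) := add_le_add n1 n2
    _ = _ := by ring

lemma abs_mul_eq (h : Config c S t z w Γ Γ' σ) : |t * w| = t * |w| := by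
  rw [abs_mul, abs_of_pos h.t_pos]

lemma abs_mul_le (h : Config c S t z w Γ Γ' σ) : |t * w| ≤ 1 := by
  rw [h.abs_mul_eq]
  have := mul_le_mul h.t_le h.hw (abs_nonneg _) (by norm_num)
  linarith

lemma den_ge (h : Config c S t z w Γ Γ' σ) (he : ‖e‖ ≤ (|z| + |w|) / (8 * c)) :
    (|z| + t * |w|) ^ 2 / (5000 * c ^ 2) ≤
      ‖Complex.cosh (arg t w Γ σ e) - Real.cos z‖ := by
  rw [← h.abs_mul_eq]
  exact norm_cosh_sub_cos_ge h.hc h.hz h.abs_mul_le h.hΓ h.hΓi (h.norm_corr_le he)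

lemma norm_arg_le (h : Config c S t z w Γ Γ' σ) (he : ‖e‖ ≤ (|z| + |w|) / (8 * c)) :
    ‖arg t w Γ σ e‖ ≤ 2 * c * (|z| + t * |w|) := by
  have hn := h.norm_corr_le he
  have hc := h.hc
  have hcp : 0 < c := by linarith
  have hx := h.abs_mul_eq
  have hx0 := abs_nonneg (t * w)
  have hz0 := abs_nonneg z
  have h4 : |t * w| / (16 * c) ≤ |t * w| / 16 := by
    apply div_le_div_of_nonneg_left hx0 (by norm_num); linarith
  calc ‖arg t w Γ σ e‖ ≤ ‖((t * w : ℝ) : ℂ)‖ + ‖Γ‖ + ‖(t * σ + 1 / 2 * t * e : ℂ)‖ :=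
        norm_add₃_le
    _ ≤ |t * w| + c * |z| + (|z| / 8 + |t * w| / (16 * c)) := by
        gcongr
        · simp
        · exact h.hΓ
    _ ≤ _ := by rw [← hx]; nlinarith

lemma length_le (h : Config c S t z w Γ Γ' σ) : |z| + t * |w| ≤ 5 := by
  have h1 := h.abs_mul_le
  rw [h.abs_mul_eq] at h1
  have := h.hz; have := Real.pi_le_four; linarith

lemma exp_le (h : Config c S t z w Γ Γ' σ) :
    Real.exp (2 * c * (|z| + t * |w|)) ≤ Real.exp (10 * c) := by
  apply Real.exp_le_exp.2
  have := h.length_le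
  have := h.hc
  nlinarith

lemma norm_arg_sub_le (h : Config c S t z w Γ Γ' σ) (he : ‖e‖ ≤ (|z| + |w|) / (8 * c)) :
    ‖arg t w Γ σ e - Γ‖ ≤ 9 * S * t := by
  obtain ⟨hc, hS, ht, ht4, htS, hz, hw, h1, h2, h3, h4⟩ := h
  have e0 : arg t w Γ σ e - Γ = t * (w + σ + 1 / 2 * e) := by
    simp only [arg]; push_cast; ring
  rw [e0, norm_mul, Complex.norm_real, Real.norm_of_nonneg ht.le, mul_comm]
  gcongr
  have hpi := Real.pi_le_four
  have b1 : ‖σ‖ ≤ S * 4 := h4.trans (by gcongr; linarith)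
  have b2 : ‖e‖ ≤ 1 := he.trans (by rw [div_le_one (by positivity)]; linarith)
  calc ‖(w + σ + 1 / 2 * e : ℂ)‖ ≤ ‖(w : ℂ)‖ + ‖σ‖ + ‖(1 / 2 * e : ℂ)‖ := norm_add₃_le
    _ ≤ 4 + S * 4 + 1 / 2 * 1 := by
        gcongr
        · simpa using hw
        · rw [norm_mul]; gcongr; simp
    _ ≤ _ := by linarith

lemma length_pos (h : Config c S t z w Γ Γ' σ) (hz : z ≠ 0) : 0 < |z| + t * |w| := by
  have := h.t_pos; have := abs_pos.2 hz; positivity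

lemma norm_K2_arg_le (h : Config c S t z w Γ Γ' σ) (he : ‖e‖ ≤ (|z| + |w|) / (8 * c)) :
    ‖K2 z (arg t w Γ σ e)‖ ≤ 5000 * c ^ 2 / (|z| + t * |w|) := by
  have hcp : 0 < c := by linarith [h.hc]
  have ht := h.t_pos
  rcases eq_or_ne z 0 with rfl | hz
  · rw [K2_zero, norm_zero]; positivity
  have hL := h.length_pos hz
  set l := |z| + t * |w| with hl
  have hzl : |z| ≤ l := by rw [hl]; have := abs_nonneg w; nlinarith
  refine (norm_K2_le (by positivity) (h.den_ge he)).trans ?_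
  rw [← hl]
  calc |z| / (l ^ 2 / (5000 * c ^ 2)) ≤ l / (l ^ 2 / (5000 * c ^ 2)) := by gcongr
    _ = _ := by field_simp

lemma norm_K2d_arg_le (h : Config c S t z w Γ Γ' σ) (he : ‖e‖ ≤ (|z| + |w|) / (8 * c)) :
    ‖K2d z (arg t w Γ σ e)‖ ≤
      2 * c * Real.exp (10 * c) * (5000 * c ^ 2) ^ 2 / (|z| + t * |w|) ^ 2 := by
  have hcp : 0 < c := by linarith [h.hc]
  have ht := h.t_pos
  rcases eq_or_ne z 0 with rfl | hz
  · rw [K2d_zero, norm_zero]; positivity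
  have hL := h.length_pos hz
  have hex := h.exp_le
  have har := h.norm_arg_le he
  have hd := h.den_ge he
  set l := |z| + t * |w| with hl
  have hzl : |z| ≤ l := by rw [hl]; have := abs_nonneg w; nlinarith
  refine (norm_K2d_le (by positivity) hd).trans ?_
  have hs : ‖Complex.sinh (arg t w Γ σ e)‖ ≤ 2 * c * l * Real.exp (10 * c) := by
    refine (norm_sinh_le _).trans ?_
    gcongr
    exact har.trans (Real.exp_le_exp.1 hex)
  calc _ ≤ l * (2 * c * l * Real.exp (10 * c)) / (l ^ 2 / (5000 * c ^ 2)) ^ 2 := by gcongr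
    _ = _ := by field_simp

lemma norm_incrF_le (h : Config c S t z w Γ Γ' σ) (he : ‖e‖ ≤ (|z| + |w|) / (8 * c))
    (hσ' : ‖σ'‖ ≤ 2 * S) (he' : ‖e'‖ ≤ 2 / (8 * c)) :
    ‖incrF z t w Γ Γ' σ σ' e e'‖ ≤ constF c S * (t / (|z| + t * |w|)) := by
  have hc := h.hc
  have hS := h.hS
  have hcp : 0 < c := by linarith
  have ht := h.t_pos
  have hK : 0 ≤ constF c S := by unfold constF; positivity
  rcases eq_or_ne z 0 with rfl | hz
  · rw [incrF, K2_zero, K2_zero, zero_mul, zero_mul, sub_zero, norm_zero]; positivity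
  have hL := h.length_pos hz
  have hex := h.exp_le
  have har := h.norm_arg_le he
  have hd := h.den_ge he
  have hK2 := h.norm_K2_arg_le he
  have hsub := h.norm_arg_sub_le he
  have hd0 : |z| ^ 2 / (5000 * c ^ 2) ≤ ‖Complex.cosh Γ - Real.cos z‖ := by
    have := norm_cosh_sub_cos_ge (x := 0) (e := 0) hc h.hz (by simp) h.hΓ h.hΓi
      (by simp; positivity)
    simpa using this
  have hzp := abs_pos.2 hz
  set l := |z| + t * |w| with hl
  have hzl : |z| ≤ l := by rw [hl]; have := abs_nonneg w; nlinarith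
  have hΓl : ‖Γ‖ ≤ 2 * c * l := h.hΓ.trans (by nlinarith)
  -- With `l = |z| + t|w|`, the kernel difference is of order `|z| · l t / (l² |z|²)` and `Γ'`
  -- supplies a further `|z|`, leaving `t/l`. The second summand is of order `(1/l) · t`.
  have e0 : incrF z t w Γ Γ' σ σ' e e' =
      (K2 z (arg t w Γ σ e) - K2 z Γ) * Γ' +
        K2 z (arg t w Γ σ e) * (t * σ' + 1 / 2 * t * e') := by
    rw [incrF]; ring
  have b1 : ‖K2 z (arg t w Γ σ e) - K2 z Γ‖ ≤
      |z| * (2 * c * l * Real.exp (10 * c) * (9 * S * t)) /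
        (l ^ 2 / (5000 * c ^ 2) * (|z| ^ 2 / (5000 * c ^ 2))) := by
    refine (norm_K2_sub_le (by positivity) (by positivity) hd hd0).trans ?_
    gcongr
    refine (norm_cosh_sub_cosh_le har hΓl).trans ?_
    gcongr
  have b2 : ‖(t * σ' + 1 / 2 * t * e' : ℂ)‖ ≤ t * (3 * S) := by
    have : (t * σ' + 1 / 2 * t * e' : ℂ) = t * (σ' + 1 / 2 * e') := by ring
    rw [this, norm_mul, Complex.norm_real, Real.norm_of_nonneg ht.le]
    gcongr
    have h8 : (2 : ℝ) / (8 * c) ≤ 1 := by rw [div_le_one (by positivity)]; linarith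
    calc ‖(σ' + 1 / 2 * e' : ℂ)‖ ≤ ‖σ'‖ + ‖(1 / 2 * e' : ℂ)‖ := norm_add_le _ _
      _ ≤ 2 * S + 1 / 2 * 1 := by
          gcongr
          rw [norm_mul]; gcongr
          · simp
          · linarith
      _ ≤ _ := by linarith
  rw [e0]
  calc _ ≤ ‖K2 z (arg t w Γ σ e) - K2 z Γ‖ * ‖Γ'‖ +
        ‖K2 z (arg t w Γ σ e)‖ * ‖(t * σ' + 1 / 2 * t * e' : ℂ)‖ := by
        refine (norm_add_le _ _).trans ?_; rw [norm_mul, norm_mul]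
    _ ≤ |z| * (2 * c * l * Real.exp (10 * c) * (9 * S * t)) /
        (l ^ 2 / (5000 * c ^ 2) * (|z| ^ 2 / (5000 * c ^ 2))) * (c * |z|) +
        5000 * c ^ 2 / l * (t * (3 * S)) := by
        gcongr
        exact h.hΓ'
    _ = _ := by unfold constF; field_simp; ring

/-- `K2d` is of order `l^{-2}` with `l = |z| + t|w|`, one power worse than `K2`, so the factor `Γ' +
tσ' + te'/2` must itself be of order `l`. For the increments of `s₀'` and of `∂₁η` this uses one
more derivative, bounded by a Cauchy estimate, hence the factor `1/d`. -/
lemma norm_incrF2_le {d : ℝ} (h : Config c S t z w Γ Γ' σ) (hd : 0 < d) (hd1 : d ≤ 1)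
    (he : ‖e‖ ≤ (|z| + |w|) / (8 * c))
    (hσ' : ‖σ'‖ ≤ S * |z| / d) (he' : ‖e'‖ ≤ (|z| + |w|) / (8 * c) / d)
    (hp : ‖p‖ ≤ 1 / (8 * c)) (hq : ‖q‖ ≤ 1 / (8 * c) / d) :
    ‖incrF2 z t w Γ Γ' σ σ' e e' p q‖ ≤ constF2 c / d * (t / (|z| + t * |w|)) := by
  have hc := h.hc
  have hS := h.hS
  have hcp : 0 < c := by linarith
  have ht := h.t_pos
  have hK : 0 ≤ constF2 c := by unfold constF2; positivity
  rcases eq_or_ne z 0 with rfl | hz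
  · rw [incrF2, K2_zero, K2d_zero, zero_mul, zero_mul, zero_mul, add_zero, norm_zero]; positivity
  have hL := h.length_pos hz
  have hK2 := h.norm_K2_arg_le he
  have hK2d := h.norm_K2d_arg_le he
  have hΓ' := h.hΓ'
  have htS := h.tS_le
  have ht4 := h.t_le
  have hzp := abs_pos.2 hz
  have hw0 := abs_nonneg w
  set l := |z| + t * |w| with hl
  have h8 : (1 : ℝ) / (8 * c) ≤ 1 := by rw [div_le_one (by positivity)]; linarith
  have b1 : ‖(t + 1 / 2 * t * p : ℂ)‖ ≤ 2 * t := by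
    have : (t + 1 / 2 * t * p : ℂ) = t * (1 + 1 / 2 * p) := by ring
    rw [this, norm_mul, Complex.norm_real, Real.norm_of_nonneg ht.le, mul_comm]
    gcongr
    calc ‖(1 + 1 / 2 * p : ℂ)‖ ≤ ‖(1 : ℂ)‖ + ‖(1 / 2 * p : ℂ)‖ := norm_add_le _ _
      _ ≤ 1 + 1 / 2 * 1 := by
          gcongr
          · simp
          · rw [norm_mul]; gcongr
            · simp
            · linarith
      _ ≤ _ := by norm_num
  have b2 : ‖(Γ' + t * σ' + 1 / 2 * t * e' : ℂ)‖ ≤ 2 * c * l / d := by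
    have n1 : ‖Γ'‖ ≤ c * |z| / d := hΓ'.trans (le_div_self (by positivity) hd hd1)
    have n2 : ‖(t * σ' : ℂ)‖ ≤ |z| / 16 / d := by
      rw [norm_mul, Complex.norm_real, Real.norm_of_nonneg ht.le]
      calc t * ‖σ'‖ ≤ t * (S * |z| / d) := by gcongr
        _ = t * S * |z| / d := by ring
        _ ≤ 1 / 16 * |z| / d := by gcongr
        _ = _ := by ring
    have n3 : ‖(1 / 2 * t * e' : ℂ)‖ ≤ (|z| + t * |w|) / 16 / d := by
      rw [norm_mul, norm_mul, Complex.norm_real, Real.norm_of_nonneg ht.le, norm_div, norm_one,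
        Complex.norm_ofNat]
      calc 1 / 2 * t * ‖e'‖ ≤ 1 / 2 * t * ((|z| + |w|) / (8 * c) / d) := by gcongr
        _ = (t * |z| + t * |w|) / (16 * c) / d := by field_simp; ring
        _ ≤ (1 * |z| + t * |w|) / (16 * 1) / d := by gcongr; linarith
        _ = _ := by ring
    calc _ ≤ ‖Γ'‖ + ‖(t * σ' : ℂ)‖ + ‖(1 / 2 * t * e' : ℂ)‖ := norm_add₃_le
      _ ≤ c * |z| / d + |z| / 16 / d + (|z| + t * |w|) / 16 / d := by gcongr
      _ = (c * |z| + |z| / 16 + (|z| + t * |w|) / 16) / d := by ring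
      _ ≤ _ := by
        gcongr
        rw [hl]
        have : 0 ≤ t * |w| := by positivity
        nlinarith
  have b3 : ‖(1 / 2 * t * q : ℂ)‖ ≤ t / d := by
    rw [norm_mul, norm_mul, Complex.norm_real, Real.norm_of_nonneg ht.le, norm_div, norm_one,
        Complex.norm_ofNat]
    calc 1 / 2 * t * ‖q‖ ≤ 1 / 2 * t * (1 / d) := by
          gcongr
          exact hq.trans (by gcongr)
      _ ≤ _ := by rw [mul_one_div]; gcongr; linarith
  rw [incrF2]
  calc _ ≤ ‖K2d z (arg t w Γ σ e)‖ * ‖(t + 1 / 2 * t * p : ℂ)‖ *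
        ‖(Γ' + t * σ' + 1 / 2 * t * e' : ℂ)‖ +
        ‖K2 z (arg t w Γ σ e)‖ * ‖(1 / 2 * t * q : ℂ)‖ := by
        refine (norm_add_le _ _).trans ?_; rw [norm_mul, norm_mul, norm_mul]
    _ ≤ 2 * c * Real.exp (10 * c) * (5000 * c ^ 2) ^ 2 / l ^ 2 * (2 * t) * (2 * c * l / d) +
        5000 * c ^ 2 / l * (t / d) := by gcongr
    _ = _ := by unfold constF2; field_simp; ring

lemma hasDerivAt_K2_arg (h : Config c S t z w Γ Γ' σ) (he : ‖e‖ ≤ (|z| + |w|) / (8 * c)) :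
    HasDerivAt (K2 z) (K2d z (arg t w Γ σ e)) (arg t w Γ σ e) := by
  have hcp : 0 < c := by linarith [h.hc]
  refine hasDerivAt_K2 fun hz => ?_
  have := h.length_pos hz
  exact norm_pos_iff.1 (lt_of_lt_of_le (by positivity) (h.den_ge he))

lemma den_ne (h : Config c S t z w Γ Γ' σ) (he : ‖e‖ ≤ (|z| + |w|) / (8 * c)) (hz : z ≠ 0) :
    Complex.cosh (arg t w Γ σ e) - Real.cos z ≠ 0 := by
  have hcp : 0 < c := by linarith [h.hc]
  have := h.length_pos hz
  exact norm_pos_iff.1 (lt_of_lt_of_le (by positivity) (h.den_ge he))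

lemma differentiableAt_K2d {z : ℝ} {a : ℂ} (h : z ≠ 0 → Complex.cosh a - Real.cos z ≠ 0) :
    DifferentiableAt ℂ (K2d z) a := by
  rcases eq_or_ne z 0 with rfl | hz
  · have : K2d 0 = fun _ => 0 := funext K2d_zero
    rw [this]; exact differentiableAt_const _
  · unfold K2d
    have h1 : DifferentiableAt ℂ Complex.sinh a := Complex.differentiable_sinh a
    have h2 : DifferentiableAt ℂ Complex.cosh a := Complex.differentiable_cosh a
    exact ((((h1.const_mul _).div ((h2.sub_const _).pow 2) (pow_ne_zero 2 (h hz)))).const_mul _).neg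

end Config

/-! ### Lipschitz bounds of the integrands by the Schwarz lemma -/

/-- A bounded holomorphic function on a disc of radius `r > 1` varies by at most `2B/r` between the
centre and a point at distance one. -/
lemma norm_sub_le_of_bounded_on_ball {h : ℂ → ℂ} {r B : ℝ} (hr : 1 < r)
    (hd : DifferentiableOn ℂ h (Metric.ball 0 r)) (hB : ∀ x ∈ Metric.ball (0 : ℂ) r, ‖h x‖ ≤ B) :
    ‖h 1 - h 0‖ ≤ 2 * B / r := by
  have h0 : (0 : ℂ) ∈ Metric.ball (0 : ℂ) r := Metric.mem_ball_self (by linarith)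
  have := Complex.dist_le_div_mul_dist_of_mapsTo_ball (c := 0) (z := 1) (R₂ := 2 * B) hd
    (fun x hx => by
      rw [mem_closedBall_iff_norm]
      have h1 := norm_sub_le (h x) (h 0)
      have h2 := hB x hx
      have h3 := hB 0 h0
      linarith) (by simpa using hr)
  simpa [dist_eq_norm] using this

/-- The complex line through two admissible increments stays within twice the bound `A` for all
parameters up to `r = A/μ`. With `A = 1/(16c)` this is exactly the bound `1/(8c)` under which the
integrands are controlled. -/
lemma norm_affine_le {a b : ℂ} {r μ A l : ℝ} {x : ℂ} (hx : ‖x‖ ≤ r) (ha : ‖a‖ ≤ A * l)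
    (hb : ‖b - a‖ ≤ μ * l) (hr : r * μ = A) : ‖a + x * (b - a)‖ ≤ 2 * A * l := by
  have hr0 : 0 ≤ r := (norm_nonneg _).trans hx
  calc ‖a + x * (b - a)‖ ≤ ‖a‖ + ‖x‖ * ‖b - a‖ := by
        refine (norm_add_le _ _).trans ?_; rw [norm_mul]
    _ ≤ A * l + r * (μ * l) := by gcongr
    _ = _ := by rw [← hr]; ring

namespace Config

variable {c S t z w : ℝ} {Γ Γ' σ σ' e₀ e₁ e₀' e₁' p₀ p₁ q₀ q₁ : ℂ} {μ : ℝ}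

/-- The increments are joined by a complex line and `incrF` is a bounded holomorphic function of the
parameter in a disc of radius `1/(16cμ)`. The Schwarz lemma bounds the change between parameters `0`
and `1` by twice the bound over the radius, which is the factor `32cμ`. -/
lemma norm_incrF_sub_le (h : Config c S t z w Γ Γ' σ) (hμ : 0 < μ) (hμ' : μ < 1 / (16 * c))
    (hσ' : ‖σ'‖ ≤ 2 * S)
    (he : ‖e₀‖ ≤ 1 / (16 * c) * (|z| + |w|)) (hed : ‖e₁ - e₀‖ ≤ μ * (|z| + |w|))
    (he' : ‖e₀'‖ ≤ 1 / (16 * c) * 2) (hed' : ‖e₁' - e₀'‖ ≤ μ * 2) :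
    ‖incrF z t w Γ Γ' σ σ' e₁ e₁' - incrF z t w Γ Γ' σ σ' e₀ e₀'‖ ≤
      32 * c * μ * constF c S * (t / (|z| + t * |w|)) := by
  have hcp : 0 < c := by linarith [h.hc]
  set r := 1 / (16 * c) / μ with hr
  have hr1 : 1 < r := by rw [hr, lt_div_iff₀ hμ]; linarith
  have hrμ : r * μ = 1 / (16 * c) := by rw [hr]; field_simp
  have ke : ∀ x ∈ Metric.ball (0 : ℂ) r, ‖e₀ + x * (e₁ - e₀)‖ ≤ (|z| + |w|) / (8 * c) := by
    intro x hx
    have := norm_affine_le (mem_ball_zero_iff.1 hx).le he hed hrμ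
    convert this using 1; field_simp; ring
  have ke' : ∀ x ∈ Metric.ball (0 : ℂ) r, ‖e₀' + x * (e₁' - e₀')‖ ≤ 2 / (8 * c) := by
    intro x hx
    have := norm_affine_le (mem_ball_zero_iff.1 hx).le he' hed' hrμ
    convert this using 1; field_simp; ring
  have key := norm_sub_le_of_bounded_on_ball (B := constF c S * (t / (|z| + t * |w|)))
    (h := fun x => incrF z t w Γ Γ' σ σ' (e₀ + x * (e₁ - e₀)) (e₀' + x * (e₁' - e₀'))) hr1
    (fun x hx => by
      have h1 : DifferentiableAt ℂ (K2 z) (arg t w Γ σ (e₀ + x * (e₁ - e₀))) :=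
        (h.hasDerivAt_K2_arg (ke x hx)).differentiableAt
      have h2 : DifferentiableAt ℂ (fun x => arg t w Γ σ (e₀ + x * (e₁ - e₀))) x := by
        unfold arg; fun_prop
      have h3 : DifferentiableAt ℂ (fun x => K2 z (arg t w Γ σ (e₀ + x * (e₁ - e₀)))) x :=
        DifferentiableAt.comp (g := K2 z) (f := fun x => arg t w Γ σ (e₀ + x * (e₁ - e₀))) x h1 h2
      apply DifferentiableAt.differentiableWithinAt
      unfold incrF
      fun_prop)
    (fun x hx => h.norm_incrF_le (ke x hx) hσ' (ke' x hx))
  simp only [one_mul, zero_mul, add_zero, add_sub_cancel] at key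
  refine key.trans (le_of_eq ?_)
  rw [hr]; field_simp; ring

/-- The same Schwarz argument, with all four increments moving simultaneously along a complex line.
-/
lemma norm_incrF2_sub_le {d : ℝ} (h : Config c S t z w Γ Γ' σ) (hd : 0 < d) (hd1 : d ≤ 1)
    (hμ : 0 < μ) (hμ' : μ < 1 / (16 * c)) (hσ' : ‖σ'‖ ≤ S * |z| / d)
    (he : ‖e₀‖ ≤ 1 / (16 * c) * (|z| + |w|)) (hed : ‖e₁ - e₀‖ ≤ μ * (|z| + |w|))
    (he' : ‖e₀'‖ ≤ 1 / (16 * c) * ((|z| + |w|) / d)) (hed' : ‖e₁' - e₀'‖ ≤ μ * ((|z| + |w|) / d))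
    (hp : ‖p₀‖ ≤ 1 / (16 * c) * 1) (hpd : ‖p₁ - p₀‖ ≤ μ * 1)
    (hq : ‖q₀‖ ≤ 1 / (16 * c) * (1 / d)) (hqd : ‖q₁ - q₀‖ ≤ μ * (1 / d)) :
    ‖incrF2 z t w Γ Γ' σ σ' e₁ e₁' p₁ q₁ - incrF2 z t w Γ Γ' σ σ' e₀ e₀' p₀ q₀‖ ≤
      32 * c * μ * (constF2 c / d) * (t / (|z| + t * |w|)) := by
  have hcp : 0 < c := by linarith [h.hc]
  set r := 1 / (16 * c) / μ with hr
  have hr1 : 1 < r := by rw [hr, lt_div_iff₀ hμ]; linarith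
  have hrμ : r * μ = 1 / (16 * c) := by rw [hr]; field_simp
  have ke : ∀ x ∈ Metric.ball (0 : ℂ) r, ‖e₀ + x * (e₁ - e₀)‖ ≤ (|z| + |w|) / (8 * c) := by
    intro x hx
    have := norm_affine_le (mem_ball_zero_iff.1 hx).le he hed hrμ
    convert this using 1; field_simp; ring
  have ke' : ∀ x ∈ Metric.ball (0 : ℂ) r,
      ‖e₀' + x * (e₁' - e₀')‖ ≤ (|z| + |w|) / (8 * c) / d := by
    intro x hx
    have := norm_affine_le (mem_ball_zero_iff.1 hx).le he' hed' hrμ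
    convert this using 1; field_simp; ring
  have kp : ∀ x ∈ Metric.ball (0 : ℂ) r, ‖p₀ + x * (p₁ - p₀)‖ ≤ 1 / (8 * c) := by
    intro x hx
    have := norm_affine_le (mem_ball_zero_iff.1 hx).le hp hpd hrμ
    convert this using 1; field_simp; ring
  have kq : ∀ x ∈ Metric.ball (0 : ℂ) r, ‖q₀ + x * (q₁ - q₀)‖ ≤ 1 / (8 * c) / d := by
    intro x hx
    have := norm_affine_le (mem_ball_zero_iff.1 hx).le hq hqd hrμ
    convert this using 1; field_simp; ring
  have key := norm_sub_le_of_bounded_on_ball (B := constF2 c / d * (t / (|z| + t * |w|)))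
    (h := fun x => incrF2 z t w Γ Γ' σ σ' (e₀ + x * (e₁ - e₀)) (e₀' + x * (e₁' - e₀'))
      (p₀ + x * (p₁ - p₀)) (q₀ + x * (q₁ - q₀))) hr1
    (fun x hx => by
      have h1 : DifferentiableAt ℂ (K2 z) (arg t w Γ σ (e₀ + x * (e₁ - e₀))) :=
        (h.hasDerivAt_K2_arg (ke x hx)).differentiableAt
      have h1' : DifferentiableAt ℂ (K2d z) (arg t w Γ σ (e₀ + x * (e₁ - e₀))) :=
        differentiableAt_K2d (h.den_ne (ke x hx))
      have h2 : DifferentiableAt ℂ (fun x => arg t w Γ σ (e₀ + x * (e₁ - e₀))) x := by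
        unfold arg; fun_prop
      have h3 : DifferentiableAt ℂ (fun x => K2 z (arg t w Γ σ (e₀ + x * (e₁ - e₀)))) x :=
        DifferentiableAt.comp (g := K2 z) (f := fun x => arg t w Γ σ (e₀ + x * (e₁ - e₀))) x h1 h2
      have h3' : DifferentiableAt ℂ (fun x => K2d z (arg t w Γ σ (e₀ + x * (e₁ - e₀)))) x :=
        DifferentiableAt.comp (g := K2d z) (f := fun x => arg t w Γ σ (e₀ + x * (e₁ - e₀))) x h1' h2
      apply DifferentiableAt.differentiableWithinAt
      unfold incrF2
      fun_prop)
    (fun x hx => h.norm_incrF2_le hd hd1 (ke x hx) hσ' (ke' x hx) (kp x hx) (kq x hx))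
  simp only [one_mul, zero_mul, add_zero, add_sub_cancel] at key
  refine key.trans (le_of_eq ?_)
  rw [hr]; field_simp; ring

end Config


/-! ### Strips and Cauchy estimates -/

lemma mem_strip {ρ : ℝ} {z : ℂ} : z ∈ strip ρ ↔ |z.im| < ρ := Iff.rfl

lemma isOpen_strip (ρ : ℝ) : IsOpen (strip ρ) :=
  isOpen_lt (Complex.continuous_im.abs) continuous_const

lemma convex_strip (ρ : ℝ) : Convex ℝ (strip ρ) := by
  have : strip ρ = Complex.imLm ⁻¹' Ioo (-ρ) ρ := by
    ext z; simp [strip, abs_lt]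
  rw [this]
  exact (convex_Ioo _ _).linear_preimage _

lemma sub_ofReal_mem_strip {ρ : ℝ} {y : ℂ} (h : y ∈ strip ρ) (x : ℝ) : y - x ∈ strip ρ := by
  simpa [strip] using h

lemma ofReal_mem_strip {ρ : ℝ} (h : 0 < ρ) (x : ℝ) : (x : ℂ) ∈ strip ρ := by
  simpa [strip] using h

lemma strip_mono {ρ ρ' : ℝ} (h : ρ ≤ ρ') : strip ρ ⊆ strip ρ' := fun _ hz =>
  lt_of_lt_of_le hz h

lemma Omega_mono {ρ ρ' : ℝ} (h : ρ ≤ ρ') : Omega ρ ⊆ Omega ρ' :=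
  prod_mono (strip_mono h) Subset.rfl

lemma isOpen_Omega (ρ : ℝ) : IsOpen (Omega ρ) := (isOpen_strip ρ).prod isOpen_Ioo

lemma add_mem_strip {ρ d : ℝ} {y h : ℂ} (hy : y ∈ strip (ρ - d)) (hh : ‖h‖ ≤ d) :
    y + h ∈ strip ρ := by
  rw [mem_strip] at *
  have h1 := abs_add_le y.im h.im
  have h2 := Complex.abs_im_le_norm h
  rw [Complex.add_im]; linarith

lemma closedBall_subset_strip {ρ d : ℝ} {y : ℂ} (hy : y ∈ strip (ρ - d)) :
    Metric.closedBall y d ⊆ strip ρ := fun x hx => by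
  have := add_mem_strip hy (h := x - y) (by rwa [mem_closedBall_iff_norm] at hx)
  simpa using this

lemma exists_gap {ρ : ℝ} {y : ℂ} (hy : y ∈ strip ρ) : ∃ d, 0 < d ∧ y ∈ strip (ρ - d) := by
  rw [mem_strip] at hy
  exact ⟨(ρ - |y.im|) / 2, by linarith, by rw [mem_strip]; linarith⟩

lemma norm_deriv_le_of_strip {ρ d K : ℝ} {h : ℂ → ℂ} {y : ℂ}
    (hh : DifferentiableOn ℂ h (strip ρ)) (hK : ∀ w ∈ strip ρ, ‖h w‖ ≤ K) (hd : 0 < d)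
    (hy : y ∈ strip (ρ - d)) : ‖deriv h y‖ ≤ K / d := by
  have hs := closedBall_subset_strip hy
  refine Complex.norm_deriv_le_of_forall_mem_sphere_norm_le hd ?_
    fun w hw => hK w (hs (Metric.sphere_subset_closedBall hw))
  exact (hh.mono hs).diffContOnCl_ball Subset.rfl

lemma norm_sub_le_of_strip {ρ K : ℝ} {h : ℂ → ℂ} {y y' : ℂ}
    (hh : DifferentiableOn ℂ h (strip ρ)) (hK : ∀ w ∈ strip ρ, ‖deriv h w‖ ≤ K)
    (hy : y ∈ strip ρ) (hy' : y' ∈ strip ρ) : ‖h y - h y'‖ ≤ K * ‖y - y'‖ :=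
  (convex_strip ρ).norm_image_sub_le_of_norm_deriv_le
    (fun _ hw => hh.differentiableAt ((isOpen_strip ρ).mem_nhds hw)) hK hy' hy

lemma differentiableOn_deriv_strip {ρ : ℝ} {h : ℂ → ℂ} (hh : DifferentiableOn ℂ h (strip ρ)) :
    DifferentiableOn ℂ (deriv h) (strip ρ) :=
  hh.deriv (isOpen_strip ρ)

/-! ### Parametric integrals -/

section Param

variable {S : Type*} [MeasurableSpace S] {μ : Measure S}

/-- The derivative is the a.e. limit of difference quotients along a sequence tending to `x`,
shifted so that all its points lie in `U`. -/
lemma aestronglyMeasurable_of_hasDerivAt {𝕜 : Type*} [RCLike 𝕜] [NormedSpace 𝕜 ℂ]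
    {f : S → 𝕜 → ℂ} {f' : S → ℂ} {x : 𝕜} {U : Set 𝕜} (hU : U ∈ 𝓝 x)
    (hm : ∀ y ∈ U, AEStronglyMeasurable (fun s => f s y) μ)
    (hd : ∀ᵐ s ∂μ, HasDerivAt (f s) (f' s) x) : AEStronglyMeasurable f' μ := by
  obtain ⟨v, hv⟩ := exists_seq_tendsto (𝓝[≠] x)
  have hvx : Tendsto v atTop (𝓝 x) := hv.mono_right nhdsWithin_le_nhds
  obtain ⟨n, hn⟩ := eventually_atTop.1 (hvx hU)
  have hv' : Tendsto (fun k => v (k + n)) atTop (𝓝[≠] x) := hv.comp (tendsto_add_atTop_nat n)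
  refine aestronglyMeasurable_of_tendsto_ae atTop
    (f := fun k s => slope (f s) x (v (k + n))) (fun k => ?_) ?_
  · simp only [slope_def_module]
    exact ((hm _ (hn _ (by simp))).sub (hm _ (mem_of_mem_nhds hU))).const_smul
      ((v (k + n) - x)⁻¹)
  · filter_upwards [hd] with s hs
    exact hs.tendsto_slope.comp hv'

/-- Differentiation under the integral sign for a dominated family of holomorphic functions. -/
lemma hasDerivAt_integral_of_holomorphic {ρ : ℝ} {f : S → ℂ → ℂ} {B : S → ℝ}
    (hB : Integrable B μ) (hm : ∀ w ∈ strip ρ, AEStronglyMeasurable (fun s => f s w) μ)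
    (hf : ∀ᵐ s ∂μ, DifferentiableOn ℂ (f s) (strip ρ))
    (hfB : ∀ᵐ s ∂μ, ∀ w ∈ strip ρ, ‖f s w‖ ≤ B s) {w : ℂ} (hw : w ∈ strip ρ) :
    Integrable (fun s => deriv (f s) w) μ ∧
      HasDerivAt (fun w => ∫ s, f s w ∂μ) (∫ s, deriv (f s) w ∂μ) w := by
  obtain ⟨d, hd, hwd⟩ := exists_gap hw
  have hn : strip (ρ - d) ∈ 𝓝 w := (isOpen_strip _).mem_nhds hwd
  have hsub : strip (ρ - d) ⊆ strip ρ := strip_mono (by linarith)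
  have hda : ∀ᵐ s ∂μ, ∀ x ∈ strip (ρ - d), HasDerivAt (f s) (deriv (f s) x) x := by
    filter_upwards [hf] with s hs x hx
    exact (hs.differentiableAt ((isOpen_strip ρ).mem_nhds (hsub hx))).hasDerivAt
  refine hasDerivAt_integral_of_dominated_loc_of_deriv_le (F := fun w s => f s w)
    (F' := fun w s => deriv (f s) w) (bound := fun s => B s / d) hn ?_ ?_ ?_ ?_
    (hB.div_const d) hda
  · filter_upwards [hn] with x hx using hm x (hsub hx)
  · exact hB.mono' (hm w hw) (hfB.mono fun s hs => hs w hw)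
  · exact aestronglyMeasurable_of_hasDerivAt hn (fun x hx => hm x (hsub hx))
      (hda.mono fun s hs => hs w hwd)
  · filter_upwards [hf, hfB] with s h1 h2 x hx
    exact norm_deriv_le_of_strip h1 h2 hd hx

lemma differentiableOn_integral_of_holomorphic {ρ : ℝ} {f : S → ℂ → ℂ} {B : S → ℝ}
    (hB : Integrable B μ) (hm : ∀ w ∈ strip ρ, AEStronglyMeasurable (fun s => f s w) μ)
    (hf : ∀ᵐ s ∂μ, DifferentiableOn ℂ (f s) (strip ρ))
    (hfB : ∀ᵐ s ∂μ, ∀ w ∈ strip ρ, ‖f s w‖ ≤ B s) :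
    DifferentiableOn ℂ (fun w => ∫ s, f s w ∂μ) (strip ρ) := fun _ hw =>
  (hasDerivAt_integral_of_holomorphic hB hm hf hfB hw).2.differentiableAt.differentiableWithinAt

end Param

/-! ### Regular functions on `Ω_ρ` -/

/-- Functions on `Ω_ρ` that are holomorphic in `y₁` and `C¹` in `y₂` as the elements of `B_ρ`, with
explicit bounds; no reality or periodicity is required. -/
structure Reg (ρ : ℝ) (u : ℂ → ℝ → ℂ) (K : ℝ) : Prop where
  hol : ∀ y₂ ∈ Ioo (-2 : ℝ) 2, DifferentiableOn ℂ (fun w => u w y₂) (strip ρ)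
  diffAt2 : ∀ y₁ ∈ strip ρ, ∀ y₂ ∈ Ioo (-2 : ℝ) 2, DifferentiableAt ℝ (fun s : ℝ => u y₁ s) y₂
  uc : UniformContinuousOn (fun y : ℂ × ℝ => dy2 u y.1 y.2) (Omega ρ)
  hol2 : ∀ y₂ ∈ Ioo (-2 : ℝ) 2, DifferentiableOn ℂ (fun w => dy2 u w y₂) (strip ρ)
  bd : ∀ y₁ ∈ strip ρ, ∀ y₂ ∈ Ioo (-2 : ℝ) 2, ‖u y₁ y₂‖ ≤ K
  bd1 : ∀ y₁ ∈ strip ρ, ∀ y₂ ∈ Ioo (-2 : ℝ) 2, ‖dy1 u y₁ y₂‖ ≤ K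
  bd2 : ∀ y₁ ∈ strip ρ, ∀ y₂ ∈ Ioo (-2 : ℝ) 2, ‖dy2 u y₁ y₂‖ ≤ K

lemma dy1_congr {ρ : ℝ} {u v : ℂ → ℝ → ℂ} {y₁ : ℂ} {y₂ : ℝ}
    (h : ∀ y₁ ∈ strip ρ, u y₁ y₂ = v y₁ y₂) (h1 : y₁ ∈ strip ρ) : dy1 u y₁ y₂ = dy1 v y₁ y₂ :=
  Filter.EventuallyEq.deriv_eq <| by
    filter_upwards [(isOpen_strip ρ).mem_nhds h1] with w hw using h w hw

lemma dy2_congr {u v : ℂ → ℝ → ℂ} {y₁ : ℂ} {y₂ : ℝ}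
    (h : ∀ y₂ ∈ Ioo (-2 : ℝ) 2, u y₁ y₂ = v y₁ y₂) (h2 : y₂ ∈ Ioo (-2 : ℝ) 2) :
    dy2 u y₁ y₂ = dy2 v y₁ y₂ :=
  Filter.EventuallyEq.deriv_eq <| by
    filter_upwards [isOpen_Ioo.mem_nhds h2] with s hs using h s hs

namespace Reg

variable {ρ K K' d : ℝ} {u v : ℂ → ℝ → ℂ} {y₁ y₁' : ℂ} {y₂ y₂' : ℝ}

lemma of_bounds (h : Reg ρ u K) (h0 : ∀ y₁ ∈ strip ρ, ∀ y₂ ∈ Ioo (-2 : ℝ) 2, ‖u y₁ y₂‖ ≤ K')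
    (h1 : ∀ y₁ ∈ strip ρ, ∀ y₂ ∈ Ioo (-2 : ℝ) 2, ‖dy1 u y₁ y₂‖ ≤ K')
    (h2 : ∀ y₁ ∈ strip ρ, ∀ y₂ ∈ Ioo (-2 : ℝ) 2, ‖dy2 u y₁ y₂‖ ≤ K') : Reg ρ u K' :=
  ⟨h.hol, h.diffAt2, h.uc, h.hol2, h0, h1, h2⟩

lemma mono (h : Reg ρ u K) (hK : K ≤ K') : Reg ρ u K' :=
  h.of_bounds (fun a ha b hb => (h.bd a ha b hb).trans hK)
    (fun a ha b hb => (h.bd1 a ha b hb).trans hK) (fun a ha b hb => (h.bd2 a ha b hb).trans hK)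

lemma mono_strip {ρ' : ℝ} (h : Reg ρ u K) (hρ : ρ' ≤ ρ) : Reg ρ' u K where
  hol a ha := (h.hol a ha).mono (strip_mono hρ)
  diffAt2 a ha := h.diffAt2 a (strip_mono hρ ha)
  uc := h.uc.mono (Omega_mono hρ)
  hol2 a ha := (h.hol2 a ha).mono (strip_mono hρ)
  bd a ha := h.bd a (strip_mono hρ ha)
  bd1 a ha := h.bd1 a (strip_mono hρ ha)
  bd2 a ha := h.bd2 a (strip_mono hρ ha)

lemma congr (h : Reg ρ u K) (huv : ∀ y₁ ∈ strip ρ, ∀ y₂ ∈ Ioo (-2 : ℝ) 2, v y₁ y₂ = u y₁ y₂) :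
    Reg ρ v K := by
  have e1 : ∀ y₁ ∈ strip ρ, ∀ y₂ ∈ Ioo (-2 : ℝ) 2, dy1 v y₁ y₂ = dy1 u y₁ y₂ :=
    fun a ha b hb => dy1_congr (fun w hw => huv w hw b hb) ha
  have e2 : ∀ y₁ ∈ strip ρ, ∀ y₂ ∈ Ioo (-2 : ℝ) 2, dy2 v y₁ y₂ = dy2 u y₁ y₂ :=
    fun a ha b hb => dy2_congr (fun w hw => huv a ha w hw) hb
  refine ⟨fun b hb => (h.hol b hb).congr fun w hw => huv w hw b hb, fun a ha b hb => ?_,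
    h.uc.congr fun y hy => (e2 y.1 hy.1 y.2 hy.2).symm,
    fun b hb => (h.hol2 b hb).congr fun w hw => e2 w hw b hb,
    fun a ha b hb => by rw [huv a ha b hb]; exact h.bd a ha b hb,
    fun a ha b hb => by rw [e1 a ha b hb]; exact h.bd1 a ha b hb,
    fun a ha b hb => by rw [e2 a ha b hb]; exact h.bd2 a ha b hb⟩
  refine (h.diffAt2 a ha b hb).congr_of_eventuallyEq ?_
  filter_upwards [isOpen_Ioo.mem_nhds hb] with s hs using huv a ha s hs

lemma differentiableAt (h : Reg ρ u K) (h1 : y₁ ∈ strip ρ) (h2 : y₂ ∈ Ioo (-2 : ℝ) 2) :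
    DifferentiableAt ℂ (fun w => u w y₂) y₁ :=
  (h.hol y₂ h2).differentiableAt ((isOpen_strip ρ).mem_nhds h1)

lemma hasDerivAt1 (h : Reg ρ u K) (h1 : y₁ ∈ strip ρ) (h2 : y₂ ∈ Ioo (-2 : ℝ) 2) :
    HasDerivAt (fun w => u w y₂) (dy1 u y₁ y₂) y₁ := (h.differentiableAt h1 h2).hasDerivAt

lemma hasDerivAt2 (h : Reg ρ u K) (h1 : y₁ ∈ strip ρ) (h2 : y₂ ∈ Ioo (-2 : ℝ) 2) :
    HasDerivAt (fun s : ℝ => u y₁ s) (dy2 u y₁ y₂) y₂ := (h.diffAt2 y₁ h1 y₂ h2).hasDerivAt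

lemma hasDerivAt21 (h : Reg ρ u K) (h1 : y₁ ∈ strip ρ) (h2 : y₂ ∈ Ioo (-2 : ℝ) 2) :
    HasDerivAt (fun w => dy2 u w y₂) (dy1 (dy2 u) y₁ y₂) y₁ :=
  ((h.hol2 y₂ h2).differentiableAt ((isOpen_strip ρ).mem_nhds h1)).hasDerivAt

lemma dy1_sub (h : Reg ρ u K) (h' : Reg ρ v K') (h1 : y₁ ∈ strip ρ) (h2 : y₂ ∈ Ioo (-2 : ℝ) 2) :
    dy1 (u - v) y₁ y₂ = dy1 u y₁ y₂ - dy1 v y₁ y₂ :=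
  ((h.hasDerivAt1 h1 h2).sub (h'.hasDerivAt1 h1 h2)).deriv

lemma dy2_sub (h : Reg ρ u K) (h' : Reg ρ v K') (h1 : y₁ ∈ strip ρ) (h2 : y₂ ∈ Ioo (-2 : ℝ) 2) :
    dy2 (u - v) y₁ y₂ = dy2 u y₁ y₂ - dy2 v y₁ y₂ :=
  ((h.hasDerivAt2 h1 h2).sub (h'.hasDerivAt2 h1 h2)).deriv

lemma sub (h : Reg ρ u K) (h' : Reg ρ v K') : Reg ρ (u - v) (K + K') where
  hol b hb := (h.hol b hb).sub (h'.hol b hb)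
  diffAt2 a ha b hb := (h.diffAt2 a ha b hb).sub (h'.diffAt2 a ha b hb)
  uc := by
    have : UniformContinuousOn (fun y : ℂ × ℝ => dy2 u y.1 y.2 - dy2 v y.1 y.2) (Omega ρ) := by
      rw [uniformContinuousOn_iff_restrict]
      exact (uniformContinuousOn_iff_restrict.1 h.uc).sub (uniformContinuousOn_iff_restrict.1 h'.uc)
    exact this.congr fun y hy => (h.dy2_sub h' hy.1 hy.2).symm
  hol2 b hb := ((h.hol2 b hb).sub (h'.hol2 b hb)).congr fun w hw => h.dy2_sub h' hw hb
  bd a ha b hb := (norm_sub_le _ _).trans (add_le_add (h.bd a ha b hb) (h'.bd a ha b hb))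
  bd1 a ha b hb := by
    rw [h.dy1_sub h' ha hb]
    exact (norm_sub_le _ _).trans (add_le_add (h.bd1 a ha b hb) (h'.bd1 a ha b hb))
  bd2 a ha b hb := by
    rw [h.dy2_sub h' ha hb]
    exact (norm_sub_le _ _).trans (add_le_add (h.bd2 a ha b hb) (h'.bd2 a ha b hb))

lemma const_mul (h : Reg ρ u K) (c : ℂ) : Reg ρ (fun y₁ y₂ => c * u y₁ y₂) (‖c‖ * K) := by
  have e1 : ∀ y₁ ∈ strip ρ, ∀ y₂ ∈ Ioo (-2 : ℝ) 2,
      dy1 (fun y₁ y₂ => c * u y₁ y₂) y₁ y₂ = c * dy1 u y₁ y₂ :=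
    fun a ha b hb => ((h.hasDerivAt1 ha hb).const_mul c).deriv
  have e2 : ∀ y₁ ∈ strip ρ, ∀ y₂ ∈ Ioo (-2 : ℝ) 2,
      dy2 (fun y₁ y₂ => c * u y₁ y₂) y₁ y₂ = c * dy2 u y₁ y₂ :=
    fun a ha b hb => ((h.hasDerivAt2 ha hb).const_mul c).deriv
  refine ⟨fun b hb => (h.hol b hb).const_mul c, fun a ha b hb => (h.diffAt2 a ha b hb).const_mul c,
    UniformContinuousOn.congr (f := fun y : ℂ × ℝ => c * dy2 u y.1 y.2) ?_
      fun y hy => (e2 y.1 hy.1 y.2 hy.2).symm,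
    fun b hb => ((h.hol2 b hb).const_mul c).congr fun w hw => e2 w hw b hb,
    fun a ha b hb => ?_, fun a ha b hb => ?_, fun a ha b hb => ?_⟩
  · exact (uniformContinuous_const_smul c).comp_uniformContinuousOn h.uc
  · rw [norm_mul]; exact mul_le_mul_of_nonneg_left (h.bd a ha b hb) (norm_nonneg _)
  · rw [e1 a ha b hb, norm_mul]; exact mul_le_mul_of_nonneg_left (h.bd1 a ha b hb) (norm_nonneg _)
  · rw [e2 a ha b hb, norm_mul]; exact mul_le_mul_of_nonneg_left (h.bd2 a ha b hb) (norm_nonneg _)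

lemma zero (ρ : ℝ) : Reg ρ (fun _ _ => 0) 0 := by
  have e1 : dy1 (fun _ _ => 0) = fun _ _ => 0 := by ext; simp [dy1]
  have e2 : dy2 (fun _ _ => 0) = fun _ _ => 0 := by ext; simp [dy2]
  refine ⟨fun _ _ => differentiableOn_const _, fun _ _ _ _ => differentiableAt_const _, ?_, ?_,
    ?_, ?_, ?_⟩
  · rw [e2]; exact uniformContinuous_const.uniformContinuousOn
  · rw [e2]; exact fun _ _ => differentiableOn_const _
  · simp
  · rw [e1]; simp
  · rw [e2]; simp

lemma nonneg (h : Reg ρ u K) (hρ : 0 < ρ) : 0 ≤ K :=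
  (norm_nonneg _).trans (h.bd 0 (by simpa using ofReal_mem_strip hρ 0) 0 (by norm_num))

lemma norm_sub_le1 (h : Reg ρ u K) (h1 : y₁ ∈ strip ρ) (h1' : y₁' ∈ strip ρ)
    (h2 : y₂ ∈ Ioo (-2 : ℝ) 2) : ‖u y₁ y₂ - u y₁' y₂‖ ≤ K * ‖y₁ - y₁'‖ :=
  norm_sub_le_of_strip (h := fun w => u w y₂) (h.hol y₂ h2) (fun w hw => h.bd1 w hw y₂ h2) h1 h1'

lemma norm_sub_le2 (h : Reg ρ u K) (h1 : y₁ ∈ strip ρ)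
    (h2 : y₂ ∈ Ioo (-2 : ℝ) 2) (h2' : y₂' ∈ Ioo (-2 : ℝ) 2) :
    ‖u y₁ y₂ - u y₁ y₂'‖ ≤ K * |y₂ - y₂'| :=
  (convex_Ioo (-2 : ℝ) 2).norm_image_sub_le_of_norm_deriv_le (f := fun s => u y₁ s)
    (fun s hs => h.diffAt2 y₁ h1 s hs) (fun s hs => h.bd2 y₁ h1 s hs) h2' h2

lemma norm_sub_le (h : Reg ρ u K) (h1 : y₁ ∈ strip ρ) (h1' : y₁' ∈ strip ρ)
    (h2 : y₂ ∈ Ioo (-2 : ℝ) 2) (h2' : y₂' ∈ Ioo (-2 : ℝ) 2) :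
    ‖u y₁ y₂ - u y₁' y₂'‖ ≤ K * (‖y₁ - y₁'‖ + |y₂ - y₂'|) := by
  have a := h.norm_sub_le1 h1 h1' h2
  have b := h.norm_sub_le2 h1' h2 h2'
  have : u y₁ y₂ - u y₁' y₂' = (u y₁ y₂ - u y₁' y₂) + (u y₁' y₂ - u y₁' y₂') := by ring
  rw [this]
  refine (norm_add_le _ _).trans ?_
  linarith

lemma hol1 (h : Reg ρ u K) (h2 : y₂ ∈ Ioo (-2 : ℝ) 2) :
    DifferentiableOn ℂ (fun w => dy1 u w y₂) (strip ρ) :=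
  differentiableOn_deriv_strip (h.hol y₂ h2)

lemma norm_dy1_dy2_le (h : Reg ρ u K) (hd : 0 < d) (h1 : y₁ ∈ strip (ρ - d))
    (h2 : y₂ ∈ Ioo (-2 : ℝ) 2) : ‖dy1 (dy2 u) y₁ y₂‖ ≤ K / d :=
  norm_deriv_le_of_strip (h.hol2 y₂ h2) (fun w hw => h.bd2 w hw y₂ h2) hd h1

/-- In `y₁` this is a Cauchy estimate for `∂₁∂₁u`. In `y₂` the Cauchy estimate is applied to `w ↦
u(w, y₂) - u(w, y₂')`, which is holomorphic and of size `K|y₂ - y₂'|`; no mixed derivative is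
needed. -/
lemma norm_dy1_sub_le (h : Reg ρ u K) (hd : 0 < d) (h1 : y₁ ∈ strip (ρ - d))
    (h1' : y₁' ∈ strip (ρ - d)) (h2 : y₂ ∈ Ioo (-2 : ℝ) 2) (h2' : y₂' ∈ Ioo (-2 : ℝ) 2) :
    ‖dy1 u y₁ y₂ - dy1 u y₁' y₂'‖ ≤ K / d * (‖y₁ - y₁'‖ + |y₂ - y₂'|) := by
  have hs : strip (ρ - d) ⊆ strip ρ := strip_mono (by linarith)
  have a : ‖dy1 u y₁ y₂ - dy1 u y₁' y₂‖ ≤ K / d * ‖y₁ - y₁'‖ :=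
    norm_sub_le_of_strip (h := fun w => dy1 u w y₂) ((h.hol1 h2).mono hs)
      (fun w hw => norm_deriv_le_of_strip (h.hol1 h2) (fun w hw => h.bd1 w hw y₂ h2) hd hw) h1 h1'
  have b : ‖dy1 u y₁' y₂ - dy1 u y₁' y₂'‖ ≤ K / d * |y₂ - y₂'| := by
    have e : dy1 u y₁' y₂ - dy1 u y₁' y₂' = deriv (fun w => u w y₂ - u w y₂') y₁' :=
      ((h.hasDerivAt1 (hs h1') h2).sub (h.hasDerivAt1 (hs h1') h2')).deriv.symm
    rw [e, div_mul_eq_mul_div]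
    exact norm_deriv_le_of_strip ((h.hol _ h2).sub (h.hol _ h2'))
      (fun w hw => h.norm_sub_le2 hw h2 h2') hd h1'
  have : dy1 u y₁ y₂ - dy1 u y₁' y₂' =
    (dy1 u y₁ y₂ - dy1 u y₁' y₂) + (dy1 u y₁' y₂ - dy1 u y₁' y₂') := by ring
  rw [this]
  refine (norm_add_le _ _).trans ?_
  linarith

/-- The mixed derivative. -/
lemma hasDerivAt12 (h : Reg ρ u K) (h1 : y₁ ∈ strip ρ) (h2 : y₂ ∈ Ioo (-2 : ℝ) 2) :
    HasDerivAt (fun s : ℝ => dy1 u y₁ s) (dy1 (dy2 u) y₁ y₂) y₂ := by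
  obtain ⟨d, hd, hyd⟩ := exists_gap h1
  rw [hasDerivAt_iff_isLittleO, Asymptotics.isLittleO_iff]
  intro ε hε
  obtain ⟨δ, hδ, huc⟩ := Metric.uniformContinuousOn_iff.1 h.uc (ε * d) (by positivity)
  have hn : Ioo (-2 : ℝ) 2 ∩ Metric.ball y₂ δ ∈ 𝓝 y₂ :=
    inter_mem (isOpen_Ioo.mem_nhds h2) (Metric.ball_mem_nhds _ hδ)
  filter_upwards [hn] with s hs
  -- Uniform continuity of `∂₂u` makes the first-order remainder in `y₂` small uniformly in `w`. The
  -- remainder is holomorphic in `w`, so a Cauchy estimate carries the smallness to its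
  -- `w`-derivative, the remainder for `∂₁u`. The factor `d` in the tolerance cancels the Cauchy
  -- loss.
  have key : ∀ w ∈ strip ρ, ‖u w s - u w y₂ - (s - y₂ : ℝ) * dy2 u w y₂‖ ≤ ε * d * |s - y₂| := by
    intro w hw
    have hconv : Convex ℝ (Ioo (-2 : ℝ) 2 ∩ Metric.ball y₂ δ) :=
      (convex_Ioo _ _).inter (convex_ball _ _)
    have := hconv.norm_image_sub_le_of_norm_hasDerivWithin_le
      (f := fun x : ℝ => u w x - (x : ℂ) * dy2 u w y₂) (f' := fun x => dy2 u w x - dy2 u w y₂)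
      (C := ε * d) (x := y₂) (y := s)
      (fun x hx => (((h.hasDerivAt2 hw hx.1).sub
        (by simpa using (Complex.ofRealCLM.hasDerivAt (x := x)).mul_const (dy2 u w y₂)))
          ).hasDerivWithinAt)
      (fun x hx => by
        rw [← dist_eq_norm]
        refine (huc (w, x) ⟨hw, hx.1⟩ (w, y₂) ⟨hw, h2⟩ ?_).le
        rw [Prod.dist_eq]; simpa using hx.2)
      ⟨h2, Metric.mem_ball_self hδ⟩ hs
    rw [Real.norm_eq_abs] at this
    have e0 : u w s - u w y₂ - (s - y₂ : ℝ) * dy2 u w y₂ =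
        u w s - s * dy2 u w y₂ - (u w y₂ - y₂ * dy2 u w y₂) := by push_cast; ring
    rw [e0]; exact this
  have e : deriv (fun w => u w s - u w y₂ - (s - y₂ : ℝ) * dy2 u w y₂) y₁ =
      dy1 u y₁ s - dy1 u y₁ y₂ - (s - y₂) • dy1 (dy2 u) y₁ y₂ := by
    rw [Complex.real_smul]
    exact (((h.hasDerivAt1 h1 hs.1).sub (h.hasDerivAt1 h1 h2)).sub
      ((h.hasDerivAt21 h1 h2).const_mul _)).deriv
  rw [← e]
  have := norm_deriv_le_of_strip
    (((h.hol _ hs.1).sub (h.hol _ h2)).sub ((h.hol2 _ h2).const_mul ((s - y₂ : ℝ) : ℂ))) key hd hyd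
  refine this.trans (le_of_eq ?_)
  rw [Real.norm_eq_abs]; field_simp

lemma continuousOn (h : Reg ρ u K) : ContinuousOn (fun y : ℂ × ℝ => u y.1 y.2) (Omega ρ) := by
  intro y hy
  rw [ContinuousWithinAt, tendsto_iff_norm_sub_tendsto_zero]
  have hc : Tendsto (fun x : ℂ × ℝ => K * (‖x.1 - y.1‖ + |x.2 - y.2|)) (𝓝[Omega ρ] y) (𝓝 0) := by
    have : Continuous (fun x : ℂ × ℝ => K * (‖x.1 - y.1‖ + |x.2 - y.2|)) := by fun_prop
    have h := (this.tendsto y).mono_left (nhdsWithin_le_nhds (s := Omega ρ))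
    simpa using h
  refine squeeze_zero' (Eventually.of_forall fun _ => norm_nonneg _) ?_ hc
  filter_upwards [self_mem_nhdsWithin] with x hx using h.norm_sub_le hx.1 hy.1 hx.2 hy.2

lemma continuousOn1 (h : Reg ρ u K) :
    ContinuousOn (fun y : ℂ × ℝ => dy1 u y.1 y.2) (Omega ρ) := by
  intro y hy
  obtain ⟨d, hd, hyd⟩ := exists_gap hy.1
  have hn : Omega (ρ - d) ∈ 𝓝 y := (isOpen_Omega _).mem_nhds ⟨hyd, hy.2⟩
  apply ContinuousAt.continuousWithinAt
  rw [ContinuousAt, tendsto_iff_norm_sub_tendsto_zero]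
  have hc : Tendsto (fun x : ℂ × ℝ => K / d * (‖x.1 - y.1‖ + |x.2 - y.2|)) (𝓝 y) (𝓝 0) := by
    have : Continuous (fun x : ℂ × ℝ => K / d * (‖x.1 - y.1‖ + |x.2 - y.2|)) := by fun_prop
    simpa using this.tendsto y
  refine squeeze_zero' (Eventually.of_forall fun _ => norm_nonneg _) ?_ hc
  filter_upwards [hn] with x hx using h.norm_dy1_sub_le hd hx.1 hyd hx.2 hy.2

/-- Two nearby points are compared through `w ↦ ∂₂u(w, x₂) - ∂₂u(w + k, y₂)`, where `k` is the
difference of the first coordinates. It is holomorphic and uniformly small on the strip of width `ρ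
- d/2`, and a Cauchy estimate with radius `d/2` gives the claim. -/
lemma uc_dy1_dy2 (h : Reg ρ u K) (hd : 0 < d) :
    UniformContinuousOn (fun y : ℂ × ℝ => dy1 (dy2 u) y.1 y.2) (Omega (ρ - d)) := by
  rw [Metric.uniformContinuousOn_iff]
  intro ε hε
  obtain ⟨δ, hδ, huc⟩ := Metric.uniformContinuousOn_iff.1 h.uc (ε * d / 4) (by positivity)
  refine ⟨min δ (d / 2), by positivity, fun x hx y hy hxy => ?_⟩
  have hx1 : dist x.1 y.1 < min δ (d / 2) := (le_max_left _ _).trans_lt hxy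
  have hx2 : dist x.2 y.2 < min δ (d / 2) := (le_max_right _ _).trans_lt hxy
  set k := y.1 - x.1 with hk
  have hkn : ‖k‖ < min δ (d / 2) := by rw [hk, ← dist_eq_norm, dist_comm]; exact hx1
  have hadd : ∀ w ∈ strip (ρ - d / 2), w + k ∈ strip ρ := fun w hw =>
    add_mem_strip hw (hkn.le.trans (min_le_right _ _))
  have hs : strip (ρ - d / 2) ⊆ strip ρ := strip_mono (by linarith)
  have hs' : strip (ρ - d) ⊆ strip ρ := strip_mono (by linarith)
  have hx' : x.1 ∈ strip (ρ - d / 2 - d / 2) := by convert hx.1 using 2; ring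
  have hky : x.1 + k = y.1 := by rw [hk]; ring
  have e : deriv (fun w => dy2 u w x.2 - dy2 u (w + k) y.2) x.1 =
      dy1 (dy2 u) x.1 x.2 - dy1 (dy2 u) y.1 y.2 := by
    refine ((h.hasDerivAt21 (hs' hx.1) hx.2).sub ?_).deriv
    have := h.hasDerivAt21 (hs' hy.1) hy.2
    rw [← hky] at this ⊢
    exact this.comp_add_const x.1 k
  rw [dist_eq_norm, ← e]
  have := norm_deriv_le_of_strip (ρ := ρ - d / 2) (K := ε * d / 4) (d := d / 2)
    (h := fun w => dy2 u w x.2 - dy2 u (w + k) y.2) (y := x.1)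
    (((h.hol2 _ hx.2).mono hs).sub
      ((h.hol2 _ hy.2).comp (differentiableOn_id.add_const k) fun w hw => hadd w hw))
    (fun w hw => by
      rw [← dist_eq_norm]
      refine (huc (w, x.2) ⟨hs hw, hx.2⟩ (w + k, y.2) ⟨hadd w hw, hy.2⟩ ?_).le
      rw [Prod.dist_eq]
      refine max_lt ?_ (hx2.trans_le (min_le_left _ _))
      simpa [dist_eq_norm] using hkn.trans_le (min_le_left _ _)) (by positivity) hx'
  refine this.trans_lt ?_
  rw [div_lt_iff₀ (by positivity)]; nlinarith

end Reg

/-- Uniform continuity is convergence to zero of the increments along the uniformity restricted to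
`A × A`, so dominated convergence along that filter applies. -/
lemma uniformContinuousOn_integral {S : Type*} [MeasurableSpace S] {μ : Measure S}
    {A : Set (ℂ × ℝ)} {f : ℂ × ℝ → S → ℂ} {B : S → ℝ} (hB : Integrable B μ)
    (hm : ∀ y ∈ A, AEStronglyMeasurable (f y) μ) (hb : ∀ᵐ s ∂μ, ∀ y ∈ A, ‖f y s‖ ≤ B s)
    (hu : ∀ᵐ s ∂μ, UniformContinuousOn (fun y => f y s) A) :
    UniformContinuousOn (fun y => ∫ s, f y s ∂μ) A := by
  have hint : ∀ y ∈ A, Integrable (f y) μ := fun y hy =>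
    hB.mono' (hm y hy) (hb.mono fun s hs => hs y hy)
  rw [UniformContinuousOn, uniformity_eq_comap_nhds_zero ℂ, tendsto_comap_iff]
  have hev : ∀ᶠ p : (ℂ × ℝ) × (ℂ × ℝ) in uniformity (ℂ × ℝ) ⊓ 𝓟 (A ×ˢ A), p.1 ∈ A ∧ p.2 ∈ A :=
    eventually_inf_principal.2 (Eventually.of_forall fun p hp => hp)
  have := tendsto_integral_filter_of_dominated_convergence (μ := μ)
    (l := uniformity (ℂ × ℝ) ⊓ 𝓟 (A ×ˢ A))
    (F := fun p s => f p.2 s - f p.1 s) (f := fun _ => 0) (fun s => B s + B s)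
    (hev.mono fun p hp => (hm _ hp.2).sub (hm _ hp.1))
    (hev.mono fun p hp => hb.mono fun s hs => (norm_sub_le _ _).trans
      (add_le_add (hs _ hp.2) (hs _ hp.1))) (hB.add hB)
    (hu.mono fun s hs => by
      rw [UniformContinuousOn, uniformity_eq_comap_nhds_zero ℂ, tendsto_comap_iff] at hs
      exact hs)
  rw [integral_zero] at this
  refine this.congr' (hev.mono fun p hp => ?_)
  exact integral_sub (hint _ hp.2) (hint _ hp.1)

/-- Integrals of regular families are regular, and can be differentiated under the integral. -/
lemma Reg.integral {S : Type*} [MeasurableSpace S] {μ : Measure S} {ρ : ℝ}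
    {u : S → ℂ → ℝ → ℂ} {B : S → ℝ} (hB : Integrable B μ)
    (hu : ∀ᵐ s ∂μ, Reg ρ (u s) (B s))
    (hm : ∀ y₁ ∈ strip ρ, ∀ y₂ ∈ Ioo (-2 : ℝ) 2, AEStronglyMeasurable (fun s => u s y₁ y₂) μ) :
    Reg ρ (fun y₁ y₂ => ∫ s, u s y₁ y₂ ∂μ) (∫ s, B s ∂μ) := by
  have hm2 : ∀ y₁ ∈ strip ρ, ∀ y₂ ∈ Ioo (-2 : ℝ) 2,
      AEStronglyMeasurable (fun s => dy2 (u s) y₁ y₂) μ := fun a ha b hb =>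
    aestronglyMeasurable_of_hasDerivAt (isOpen_Ioo.mem_nhds hb) (fun s hs => hm a ha s hs)
      (hu.mono fun s hs => hs.hasDerivAt2 ha hb)
  have h1 : ∀ y₁ ∈ strip ρ, ∀ y₂ ∈ Ioo (-2 : ℝ) 2,
      HasDerivAt (fun w => ∫ s, u s w y₂ ∂μ) (∫ s, dy1 (u s) y₁ y₂ ∂μ) y₁ := fun a ha b hb =>
    (hasDerivAt_integral_of_holomorphic hB (fun w hw => hm w hw b hb)
      (hu.mono fun s hs => hs.hol b hb) (hu.mono fun s hs w hw => hs.bd w hw b hb) ha).2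
  have h2 : ∀ y₁ ∈ strip ρ, ∀ y₂ ∈ Ioo (-2 : ℝ) 2,
      HasDerivAt (fun x => ∫ s, u s y₁ x ∂μ) (∫ s, dy2 (u s) y₁ y₂ ∂μ) y₂ := fun a ha b hb =>
    (hasDerivAt_integral_of_dominated_loc_of_deriv_le (F := fun x s => u s a x)
      (F' := fun x s => dy2 (u s) a x) (bound := B) (isOpen_Ioo.mem_nhds hb)
      (by filter_upwards [isOpen_Ioo.mem_nhds hb] with x hx using hm a ha x hx)
      (hB.mono' (hm a ha b hb) (hu.mono fun s hs => hs.bd a ha b hb)) (hm2 a ha b hb)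
      (hu.mono fun s hs x hx => hs.bd2 a ha x hx) hB
      (hu.mono fun s hs x hx => hs.hasDerivAt2 ha hx)).2
  have e2 : ∀ y₁ ∈ strip ρ, ∀ y₂ ∈ Ioo (-2 : ℝ) 2,
      dy2 (fun y₁ y₂ => ∫ s, u s y₁ y₂ ∂μ) y₁ y₂ = ∫ s, dy2 (u s) y₁ y₂ ∂μ :=
    fun a ha b hb => (h2 a ha b hb).deriv
  have e1 : ∀ y₁ ∈ strip ρ, ∀ y₂ ∈ Ioo (-2 : ℝ) 2,
      dy1 (fun y₁ y₂ => ∫ s, u s y₁ y₂ ∂μ) y₁ y₂ = ∫ s, dy1 (u s) y₁ y₂ ∂μ :=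
    fun a ha b hb => (h1 a ha b hb).deriv
  refine ⟨fun b hb a ha => (h1 a ha b hb).differentiableAt.differentiableWithinAt,
    fun a ha b hb => (h2 a ha b hb).differentiableAt,
    UniformContinuousOn.congr (f := fun y : ℂ × ℝ => ∫ s, dy2 (u s) y.1 y.2 ∂μ) ?_
      fun y hy => (e2 y.1 hy.1 y.2 hy.2).symm,
    fun b hb => DifferentiableOn.congr ?_ fun w hw => e2 w hw b hb,
    fun a ha b hb => norm_integral_le_of_norm_le hB (hu.mono fun s hs => hs.bd a ha b hb),
    fun a ha b hb => by
      rw [e1 a ha b hb]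
      exact norm_integral_le_of_norm_le hB (hu.mono fun s hs => hs.bd1 a ha b hb),
    fun a ha b hb => by
      rw [e2 a ha b hb]
      exact norm_integral_le_of_norm_le hB (hu.mono fun s hs => hs.bd2 a ha b hb)⟩
  · exact uniformContinuousOn_integral hB (fun y hy => hm2 y.1 hy.1 y.2 hy.2)
      (hu.mono fun s hs y hy => hs.bd2 y.1 hy.1 y.2 hy.2) (hu.mono fun s hs => hs.uc)
  · exact differentiableOn_integral_of_holomorphic hB (fun w hw => hm2 w hw b hb)
      (hu.mono fun s hs => hs.hol2 b hb) (hu.mono fun s hs w hw => hs.bd2 w hw b hb)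


/-! ### The majorant of the singular integrals -/

lemma intervalIntegrable_abs_rpow {p : ℝ} (hp : -1 < p) (r : ℝ) :
    IntervalIntegrable (fun x : ℝ => |x| ^ p) volume 0 r := by
  rcases le_total 0 r with hr | hr
  · refine (intervalIntegral.intervalIntegrable_rpow' hp).congr fun x hx => ?_
    rw [uIoc_of_le hr] at hx
    rw [abs_of_pos hx.1]
  · have h := (IntervalIntegrable.iff_comp_neg (f := fun x : ℝ => x ^ p)).1
      (intervalIntegral.intervalIntegrable_rpow' hp (a := 0) (b := -r))
    rw [neg_zero, neg_neg] at h
    refine h.congr fun x hx => ?_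
    rw [uIoc_of_ge hr] at hx
    rw [abs_of_nonpos hx.2]

lemma integral_abs_rpow {p r : ℝ} (hp : -1 < p) (hr : 0 ≤ r) :
    ∫ x in (-r)..r, |x| ^ p = 2 * r ^ (p + 1) / (p + 1) := by
  have hp1 : p + 1 ≠ 0 := by linarith
  have h1 : ∫ x in (0 : ℝ)..r, |x| ^ p = r ^ (p + 1) / (p + 1) := by
    have : ∫ x in (0 : ℝ)..r, |x| ^ p = ∫ x in (0 : ℝ)..r, x ^ p := by
      refine intervalIntegral.integral_congr fun x hx => ?_
      rw [uIcc_of_le hr] at hx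
      rw [abs_of_nonneg hx.1]
    rw [this, integral_rpow (Or.inl hp), Real.zero_rpow hp1, sub_zero]
  have h2 : ∫ x in (-r)..0, |x| ^ p = r ^ (p + 1) / (p + 1) := by
    have := intervalIntegral.integral_comp_neg (a := 0) (b := r) (fun x : ℝ => |x| ^ p)
    simp only [abs_neg, neg_zero] at this
    rw [← this, h1]
  rw [← intervalIntegral.integral_add_adjacent_intervals (b := 0)
    (intervalIntegrable_abs_rpow hp _).symm (intervalIntegrable_abs_rpow hp _), h1, h2]
  ring

/-- The truncated power `|x| ^ p` on `[-r, r]`. -/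
def truncPow (p r x : ℝ) : ℝ := (Icc (-r) r).indicator (fun x => |x| ^ p) x

lemma truncPow_nonneg (p r x : ℝ) : 0 ≤ truncPow p r x :=
  indicator_nonneg (fun _ _ => Real.rpow_nonneg (abs_nonneg _) _) _

lemma truncPow_of_abs_le {p r x : ℝ} (h : |x| ≤ r) : truncPow p r x = |x| ^ p :=
  indicator_of_mem (mem_Icc.2 (abs_le.1 h)) _

lemma integrable_truncPow {p r : ℝ} (hp : -1 < p) (hr : 0 ≤ r) :
    Integrable (truncPow p r) := by
  unfold truncPow
  rw [integrable_indicator_iff measurableSet_Icc, integrableOn_Icc_iff_integrableOn_Ioc,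
    ← intervalIntegrable_iff_integrableOn_Ioc_of_le (by linarith)]
  exact (intervalIntegrable_abs_rpow hp _).symm.trans (intervalIntegrable_abs_rpow hp _)

lemma integral_truncPow {p r : ℝ} (hp : -1 < p) (hr : 0 ≤ r) :
    ∫ x, truncPow p r x = 2 * r ^ (p + 1) / (p + 1) := by
  unfold truncPow
  rw [integral_indicator measurableSet_Icc, integral_Icc_eq_integral_Ioc,
    ← intervalIntegral.integral_of_le (by linarith), integral_abs_rpow hp hr]

/-- The majorant of the integrands of `F` and of its `y₂`-derivative. -/
def maj (t y₂ : ℝ) (z : ℝ × ℝ) : ℝ := t / (|z.1| + t * |y₂ - z.2|)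

lemma maj_nonneg {t : ℝ} (ht : 0 ≤ t) (y₂ : ℝ) (z : ℝ × ℝ) : 0 ≤ maj t y₂ z := by
  unfold maj; positivity

lemma measurable_maj (t y₂ : ℝ) : Measurable (maj t y₂) := by unfold maj; fun_prop

/-- Since `x` and `y` are both at most `x + y`, so is the weighted geometric mean `x^{1-β} y^β`. The
right-hand side has separated variables. -/
lemma one_div_add_le {x y β : ℝ} (hx : 0 < x) (hy : 0 < y) (h0 : 0 ≤ β) (h1 : β ≤ 1) :
    1 / (x + y) ≤ x ^ (β - 1) * y ^ (-β) := by
  have h : x ^ (1 - β) * y ^ β ≤ x + y := by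
    calc x ^ (1 - β) * y ^ β ≤ (x + y) ^ (1 - β) * (x + y) ^ β := by
          gcongr <;> linarith
      _ = x + y := by rw [← Real.rpow_add (by positivity)]; simp
  have e : x ^ (β - 1) * y ^ (-β) = 1 / (x ^ (1 - β) * y ^ β) := by
    rw [show β - 1 = -(1 - β) by ring, Real.rpow_neg hx.le, Real.rpow_neg hy.le]
    field_simp
  rw [e]
  exact one_div_le_one_div_of_le (by positivity) h

/-- The majorant is dominated by a product of two integrable powers of `|z₁|` and `|y₂ - z₂|`, and
Fubini gives an explicit bound with a free exponent `β`. Different values of `β` give the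
logarithmic bound and the smallness near `z₁ = 0`. -/
lemma integrable_maj_aux {t y₂ β r : ℝ} (ht : 0 < t) (hy : y₂ ∈ Ioo (-2 : ℝ) 2) (h0 : 0 < β)
    (h1 : β < 1) (hr : 0 ≤ r) {A : Set (ℝ × ℝ)} (hA : MeasurableSet A)
    (hAr : ∀ z ∈ A, |z.1| ≤ r ∧ z.2 ∈ Ioo (-2 : ℝ) 2) :
    IntegrableOn (maj t y₂) A ∧ ∫ z in A, maj t y₂ z ≤
      t * t ^ (-β) * ((2 * r ^ β / β) * (2 * 4 ^ (1 - β) / (1 - β))) := by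
  set M : ℝ × ℝ → ℝ := fun z => t * t ^ (-β) * (truncPow (β - 1) r z.1 * truncPow (-β) 4 (y₂ - z.2))
    with hM
  have i2 : Integrable (fun x => truncPow (-β) 4 (y₂ - x)) :=
    (integrable_truncPow (by linarith) (by norm_num)).comp_sub_left y₂
  have hMi : Integrable M := by
    have := (integrable_truncPow (p := β - 1) (r := r) (by linarith) hr).mul_prod i2
    exact this.const_mul _
  have hMint : ∫ z, M z = t * t ^ (-β) * ((2 * r ^ β / β) * (2 * 4 ^ (1 - β) / (1 - β))) := by
    rw [hM, integral_const_mul, Measure.volume_eq_prod, integral_prod_mul (truncPow (β - 1) r)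
      (fun x => truncPow (-β) 4 (y₂ - x)), integral_sub_left_eq_self (truncPow (-β) 4),
      integral_truncPow (by linarith) hr, integral_truncPow (by linarith) (by norm_num)]
    rw [sub_add_cancel, show -β + 1 = 1 - β by ring]
  have hM0 : ∀ z, 0 ≤ M z := fun z => by
    have := truncPow_nonneg (β - 1) r z.1
    have := truncPow_nonneg (-β) 4 (y₂ - z.2)
    simp only [hM]; positivity
  have hle : ∀ᵐ z : ℝ × ℝ ∂(volume.restrict A), maj t y₂ z ≤ M z := by
    have n1 : ∀ᵐ z : ℝ × ℝ, z.1 ≠ 0 := by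
      have : (volume : Measure (ℝ × ℝ)) (({0} : Set ℝ) ×ˢ univ) = 0 := by
        rw [Measure.volume_eq_prod, Measure.prod_prod]; simp
      refine measure_mono_null (fun z hz => ?_) this
      simpa using hz
    have n2 : ∀ᵐ z : ℝ × ℝ, z.2 ≠ y₂ := by
      have : (volume : Measure (ℝ × ℝ)) ((univ : Set ℝ) ×ˢ ({y₂} : Set ℝ)) = 0 := by
        rw [Measure.volume_eq_prod, Measure.prod_prod]; simp
      refine measure_mono_null (fun z hz => ?_) this
      simpa using hz
    filter_upwards [ae_restrict_of_ae n1, ae_restrict_of_ae n2, ae_restrict_mem hA] with z h1' h2' h3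
    obtain ⟨h4, h5⟩ := hAr z h3
    have hw : |y₂ - z.2| ≤ 4 := by rw [abs_le]; constructor <;> linarith [hy.1, hy.2, h5.1, h5.2]
    have hwp : 0 < |y₂ - z.2| := abs_pos.2 (sub_ne_zero.2 (Ne.symm h2'))
    simp only [hM, maj]
    rw [truncPow_of_abs_le h4, truncPow_of_abs_le hw, div_eq_mul_one_div, mul_assoc]
    gcongr
    refine (one_div_add_le (abs_pos.2 h1') (mul_pos ht hwp) h0.le h1.le).trans (le_of_eq ?_)
    rw [Real.mul_rpow ht.le hwp.le]; ring
  have hint : IntegrableOn (maj t y₂) A :=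
    hMi.integrableOn.mono' (measurable_maj t y₂).aestronglyMeasurable
      (hle.mono fun z hz => by rwa [Real.norm_of_nonneg (maj_nonneg ht.le _ _)])
  refine ⟨hint, ?_⟩
  rw [← hMint]
  exact (integral_mono_ae hint hMi.integrableOn hle).trans
    (setIntegral_le_integral hMi (Eventually.of_forall hM0))

lemma measurableSet_Omega0 : MeasurableSet Omega0 := measurableSet_Ico.prod measurableSet_Ioo

lemma abs_fst_le_of_mem {z : ℝ × ℝ} (hz : z ∈ Omega0) : |z.1| ≤ Real.pi :=
  abs_le.2 ⟨hz.1.1, hz.1.2.le⟩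

lemma integrableOn_maj {t y₂ : ℝ} (ht : 0 < t) (hy : y₂ ∈ Ioo (-2 : ℝ) 2) :
    IntegrableOn (maj t y₂) Omega0 :=
  (integrable_maj_aux (β := 1 / 2) ht hy (by norm_num) (by norm_num) Real.pi_pos.le
    measurableSet_Omega0 fun z hz => ⟨abs_fst_le_of_mem hz, hz.2⟩).1

lemma one_lt_abs_log {t : ℝ} (ht : 0 < t) (ht4 : t ≤ 1 / 4) : 4 / 3 < |Real.log t| := by
  have h1 : Real.log t ≤ Real.log (1 / 4) := Real.log_le_log ht ht4
  have h2 : Real.log (1 / 4) = -(2 * Real.log 2) := by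
    rw [one_div, Real.log_inv, show (4 : ℝ) = 2 ^ 2 by norm_num, Real.log_pow]; norm_num
  have := Real.log_two_gt_d9
  rw [abs_of_neg (by linarith)]; linarith

/-- The optimal exponent is `β = 1/|log t|`: then `t^{-β} = e`, and `1/β` contributes the logarithm.
Since `t ≤ 1/4` gives `|log t| > 4/3`, the exponent stays below `3/4` and `1/(1-β)` is at most `4`.
-/
lemma integral_maj_le {t y₂ : ℝ} (ht : 0 < t) (ht4 : t ≤ 1 / 4) (hy : y₂ ∈ Ioo (-2 : ℝ) 2) :
    ∫ z in Omega0, maj t y₂ z ≤ 1000 * (t * |Real.log t|) := by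
  set l := |Real.log t| with hl
  have hl1 : 4 / 3 < l := one_lt_abs_log ht ht4
  have hlog : Real.log t = -l := by
    rw [hl, abs_of_neg (Real.log_neg ht (by linarith)), neg_neg]
  have hβ0 : 0 < 1 / l := by positivity
  have hβ1 : 1 / l < 3 / 4 := by rw [div_lt_iff₀ (by linarith)]; linarith
  refine (integrable_maj_aux (β := 1 / l) ht hy hβ0 (by linarith) Real.pi_pos.le
    measurableSet_Omega0 fun z hz => ⟨abs_fst_le_of_mem hz, hz.2⟩).2.trans ?_
  have e1 : t ^ (-(1 / l)) = Real.exp 1 := by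
    rw [Real.rpow_def_of_pos ht, hlog]; congr 1; field_simp
  have e2 : Real.pi ^ (1 / l) ≤ 4 := by
    refine le_trans ?_ Real.pi_le_four
    have := Real.rpow_le_rpow_of_exponent_le (x := Real.pi) (by linarith [Real.pi_gt_three])
      (show 1 / l ≤ 1 by linarith)
    simpa using this
  have e3 : (4 : ℝ) ^ (1 - 1 / l) ≤ 4 := by
    have := Real.rpow_le_rpow_of_exponent_le (x := 4) (by norm_num)
      (show 1 - 1 / l ≤ 1 by linarith)
    simpa using this
  have e4 : Real.exp 1 ≤ 3 := by have := Real.exp_one_lt_d9; linarith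
  rw [e1]
  have hb : 1 / 4 ≤ 1 - 1 / l := by linarith
  generalize 1 - 1 / l = b at hb e3 ⊢
  have hb0 : 0 < b := by linarith
  calc _ ≤ t * 3 * ((2 * 4 / (1 / l)) * (2 * 4 / (1 / 4))) := by
        gcongr
    _ = 768 * (t * l) := by field_simp; ring
    _ ≤ _ := by
      have : 0 ≤ t * l := by positivity
      linarith

/-- Exponent `β = 1/2`. The bound does not depend on `y₂`, which is what makes the excision of `z₁ =
0` uniform. -/
lemma integral_maj_excised_le {t y₂ ε : ℝ} (ht : 0 < t) (hy : y₂ ∈ Ioo (-2 : ℝ) 2) (hε : 0 ≤ ε) :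
    ∫ z in Omega0 ∩ {z | |z.1| < ε}, maj t y₂ z ≤ 32 * (√t * √ε) := by
  have hm : MeasurableSet (Omega0 ∩ {z : ℝ × ℝ | |z.1| < ε}) :=
    measurableSet_Omega0.inter (measurableSet_lt (by fun_prop) measurable_const)
  refine (integrable_maj_aux (β := 1 / 2) ht hy (by norm_num) (by norm_num) hε
    hm fun z hz => ⟨hz.2.le, hz.1.2⟩).2.trans (le_of_eq ?_)
  have e1 : t * t ^ (-(1 / 2 : ℝ)) = √t := by
    rw [Real.rpow_neg ht.le, ← Real.sqrt_eq_rpow]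
    field_simp; rw [Real.sq_sqrt ht.le]
  have e2 : (4 : ℝ) ^ (1 - 1 / 2 : ℝ) = 2 := by
    rw [show (1 - 1 / 2 : ℝ) = 1 / 2 by norm_num, ← Real.sqrt_eq_rpow,
      show (4 : ℝ) = 2 ^ 2 by norm_num, Real.sqrt_sq (by norm_num)]
  rw [e1, e2, ← Real.sqrt_eq_rpow]; ring


/-! ### The background: the initial interface and its normal velocity -/

lemma norm_diff1_le {ρ K : ℝ} {h : ℂ → ℂ} {y : ℂ} (hh : DifferentiableOn ℂ h (strip ρ))
    (hK : ∀ w ∈ strip ρ, ‖deriv h w‖ ≤ K) (hy : y ∈ strip ρ) (z : ℝ) :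
    ‖diff1 h y z‖ ≤ K * |z| := by
  have := norm_sub_le_of_strip hh hK hy (sub_ofReal_mem_strip hy z)
  simpa [diff1] using this

lemma hasDerivAt_comp_sub_ofReal {ρ : ℝ} {h : ℂ → ℂ} {y : ℂ}
    (hh : DifferentiableOn ℂ h (strip ρ)) (hy : y ∈ strip ρ) (x : ℝ) :
    HasDerivAt (fun x : ℝ => h (y - x)) (-deriv h (y - x)) x := by
  have h1 : HasDerivAt h (deriv h (y - x)) (y - x) := (hh.differentiableAt
    ((isOpen_strip ρ).mem_nhds (sub_ofReal_mem_strip hy x))).hasDerivAt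
  have h2 := (h1.comp_const_sub y (x : ℂ)).comp_ofReal
  simpa using h2

/-- The increment is taken along a horizontal segment, so the derivative in the real parameter is
`-h'` and its imaginary part involves `Im h'` only. The imaginary part of `Δγ₀` is therefore
governed by `Im γ₀'`, however large `γ₀'` is. -/
lemma abs_im_diff1_le {ρ K : ℝ} {h : ℂ → ℂ} {y : ℂ} (hh : DifferentiableOn ℂ h (strip ρ))
    (hK : ∀ w ∈ strip ρ, |(deriv h w).im| ≤ K) (hy : y ∈ strip ρ) (z : ℝ) :
    |(diff1 h y z).im| ≤ K * |z| := by
  have hd : ∀ x : ℝ, HasDerivAt (fun x : ℝ => (h (y - x)).im) (-(deriv h (y - x)).im) x := by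
    intro x
    have := Complex.imCLM.hasFDerivAt.comp_hasDerivAt x (hasDerivAt_comp_sub_ofReal hh hy x)
    rw [← Complex.neg_im]
    exact this
  have := convex_univ.norm_image_sub_le_of_norm_hasDerivWithin_le (x := z) (y := 0)
    (fun x _ => (hd x).hasDerivWithinAt)
    (fun x _ => by
      rw [norm_neg, Real.norm_eq_abs]; exact hK _ (sub_ofReal_mem_strip hy x))
    (mem_univ _) (mem_univ _)
  simpa [diff1] using this

lemma continuous_comp_sub_ofReal {ρ : ℝ} {h : ℂ → ℂ} {y : ℂ}
    (hh : DifferentiableOn ℂ h (strip ρ)) (hy : y ∈ strip ρ) :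
    Continuous (fun x : ℝ => h (y - x)) :=
  continuous_iff_continuousAt.2 fun x => (hasDerivAt_comp_sub_ofReal hh hy x).continuousAt

lemma hasDerivAt_diff1 {ρ : ℝ} {h : ℂ → ℂ} {y : ℂ} (hh : DifferentiableOn ℂ h (strip ρ))
    (hy : y ∈ strip ρ) (z : ℝ) :
    HasDerivAt (fun y => diff1 h y z) (diff1 (deriv h) y z) y := by
  have h1 : ∀ w ∈ strip ρ, HasDerivAt h (deriv h w) w := fun w hw =>
    (hh.differentiableAt ((isOpen_strip ρ).mem_nhds hw)).hasDerivAt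
  exact (h1 y hy).sub ((h1 _ (sub_ofReal_mem_strip hy z)).comp_sub_const y (z : ℂ))

/-- The holomorphic extension of the initial interface with bounds on its first three
derivatives. -/
structure Interface (c ρ₀ : ℝ) (g : ℂ → ℂ) : Prop where
  one_le : 1 ≤ c
  pos : 0 < ρ₀
  hol : DifferentiableOn ℂ g (strip ρ₀)
  bd1 : ∀ w ∈ strip ρ₀, ‖deriv g w‖ ≤ c
  bd2 : ∀ w ∈ strip ρ₀, ‖deriv (deriv g) w‖ ≤ c
  bd3 : ∀ w ∈ strip ρ₀, ‖deriv (deriv (deriv g)) w‖ ≤ c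
  im_le : ∀ w ∈ strip ρ₀, |(deriv g w).im| ≤ 1 / 4
  real : ∀ x : ℝ, (g x).im = 0
  periodic : ∀ x : ℝ, g ((x + 2 * Real.pi : ℝ) : ℂ) = g x

/-- A bound of the derivative of the initial velocity. -/
def constS (c : ℝ) : ℝ :=
  1 + 14 * (c ^ 3 * Real.exp (4 * c) * (5000 * c ^ 2) ^ 2 + 5000 * c ^ 3)

namespace Interface

variable {c ρ₀ : ℝ} {g : ℂ → ℂ} {y : ℂ} {z : ℝ}

lemma hol' (h : Interface c ρ₀ g) : DifferentiableOn ℂ (deriv g) (strip ρ₀) :=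
  differentiableOn_deriv_strip h.hol

lemma hol'' (h : Interface c ρ₀ g) : DifferentiableOn ℂ (deriv (deriv g)) (strip ρ₀) :=
  differentiableOn_deriv_strip h.hol'

lemma norm_diff1_le (h : Interface c ρ₀ g) (hy : y ∈ strip ρ₀) : ‖diff1 g y z‖ ≤ c * |z| :=
  IPM.norm_diff1_le h.hol h.bd1 hy z

lemma norm_diff1_deriv_le (h : Interface c ρ₀ g) (hy : y ∈ strip ρ₀) :
    ‖diff1 (deriv g) y z‖ ≤ c * |z| :=
  IPM.norm_diff1_le h.hol' h.bd2 hy z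

lemma abs_im_diff1_le (h : Interface c ρ₀ g) (hy : y ∈ strip ρ₀) :
    |(diff1 g y z).im| ≤ |z| / 4 := by
  have := IPM.abs_im_diff1_le h.hol h.im_le hy z
  linarith

lemma den_ge (h : Interface c ρ₀ g) (hy : y ∈ strip ρ₀) (hz : |z| ≤ Real.pi) :
    |z| ^ 2 / (5000 * c ^ 2) ≤ ‖Complex.cosh (diff1 g y z) - Real.cos z‖ := by
  have := norm_cosh_sub_cos_ge (x := 0) (e := 0) h.one_le hz (by simp)
    (h.norm_diff1_le hy) (h.abs_im_diff1_le hy) (by simp; positivity)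
  simpa using this

lemma den_ne (h : Interface c ρ₀ g) (hy : y ∈ strip ρ₀) (hz : |z| ≤ Real.pi) (hz0 : z ≠ 0) :
    Complex.cosh (diff1 g y z) - Real.cos z ≠ 0 := by
  have hc := h.one_le
  have := abs_pos.2 hz0
  exact norm_pos_iff.1 (lt_of_lt_of_le (by positivity) (h.den_ge hy hz))

lemma hasDerivAt_K2_diff1 (h : Interface c ρ₀ g) (hy : y ∈ strip ρ₀) (hz : |z| ≤ Real.pi) :
    HasDerivAt (fun y => K2 z (diff1 g y z))
      (K2d z (diff1 g y z) * diff1 (deriv g) y z) y :=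
  HasDerivAt.comp (h₂ := K2 z) y (hasDerivAt_K2 (h.den_ne hy hz)) (hasDerivAt_diff1 h.hol hy z)

lemma hasDerivAt_s0_integrand (h : Interface c ρ₀ g) (hy : y ∈ strip ρ₀) (hz : |z| ≤ Real.pi) :
    HasDerivAt (fun y => K2 z (diff1 g y z) * diff1 (deriv g) y z)
      (K2d z (diff1 g y z) * diff1 (deriv g) y z * diff1 (deriv g) y z +
        K2 z (diff1 g y z) * diff1 (deriv (deriv g)) y z) y :=
  (h.hasDerivAt_K2_diff1 hy hz).mul (hasDerivAt_diff1 h.hol' hy z)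

lemma norm_K2_le (h : Interface c ρ₀ g) (hy : y ∈ strip ρ₀) (hz : |z| ≤ Real.pi) :
    ‖K2 z (diff1 g y z)‖ * |z| ≤ 5000 * c ^ 2 := by
  have hc := h.one_le
  rcases eq_or_ne z 0 with rfl | hz0
  · simp; positivity
  have hp := abs_pos.2 hz0
  have := IPM.norm_K2_le (by positivity) (h.den_ge hy hz)
  calc _ ≤ |z| / (|z| ^ 2 / (5000 * c ^ 2)) * |z| := by gcongr
    _ = _ := by field_simp

lemma norm_K2d_le (h : Interface c ρ₀ g) (hy : y ∈ strip ρ₀) (hz : |z| ≤ Real.pi) :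
    ‖K2d z (diff1 g y z)‖ * |z| ^ 2 ≤ c * Real.exp (4 * c) * (5000 * c ^ 2) ^ 2 := by
  have hc := h.one_le
  rcases eq_or_ne z 0 with rfl | hz0
  · simp; positivity
  have hp := abs_pos.2 hz0
  have h1 := IPM.norm_K2d_le (by positivity) (h.den_ge hy hz)
  have h2 : ‖Complex.sinh (diff1 g y z)‖ ≤ c * |z| * Real.exp (4 * c) := by
    refine (norm_sinh_le _).trans ?_
    gcongr
    · exact h.norm_diff1_le hy
    · refine (h.norm_diff1_le hy).trans ?_
      have := Real.pi_le_four
      nlinarith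
  calc _ ≤ |z| * (c * |z| * Real.exp (4 * c)) / (|z| ^ 2 / (5000 * c ^ 2)) ^ 2 * |z| ^ 2 := by
        refine mul_le_mul_of_nonneg_right (h1.trans ?_) (by positivity)
        gcongr
    _ = _ := by field_simp

lemma measurable_diff1 {ρ : ℝ} {h : ℂ → ℂ} (hh : DifferentiableOn ℂ h (strip ρ))
    (hy : y ∈ strip ρ) : Measurable (fun z : ℝ => diff1 h y z) :=
  (continuous_const.sub (continuous_comp_sub_ofReal hh hy)).measurable

lemma measurable_K2 {S : Type*} [MeasurableSpace S] {f : S → ℝ} {a : S → ℂ} (hf : Measurable f)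
    (ha : Measurable a) : Measurable (fun s => K2 (f s) (a s)) := by
  unfold K2
  have h1 : Measurable fun s => Complex.cosh (a s) :=
    Complex.continuous_cosh.measurable.comp ha
  have h2 : Measurable fun s => ((Real.sin (f s) : ℝ) : ℂ) := by fun_prop
  have h3 : Measurable fun s => ((Real.cos (f s) : ℝ) : ℂ) := by fun_prop
  fun_prop

lemma measurable_s0_integrand (h : Interface c ρ₀ g) (hy : y ∈ strip ρ₀) :
    Measurable (fun z : ℝ => K2 z (diff1 g y z) * diff1 (deriv g) y z) :=
  (measurable_K2 measurable_id (measurable_diff1 h.hol hy)).mul (measurable_diff1 h.hol' hy)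

lemma norm_s0_integrand_le (h : Interface c ρ₀ g) (hy : y ∈ strip ρ₀) (hz : |z| ≤ Real.pi) :
    ‖K2 z (diff1 g y z) * diff1 (deriv g) y z‖ ≤ 5000 * c ^ 3 := by
  have hc := h.one_le
  rw [norm_mul]
  calc _ ≤ ‖K2 z (diff1 g y z)‖ * (c * |z|) := by gcongr; exact h.norm_diff1_deriv_le hy
    _ = ‖K2 z (diff1 g y z)‖ * |z| * c := by ring
    _ ≤ 5000 * c ^ 2 * c := mul_le_mul_of_nonneg_right (h.norm_K2_le hy hz) (by linarith)
    _ = _ := by ring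

lemma hasDerivAt_s0 (h : Interface c ρ₀ g) (hy : y ∈ strip ρ₀) :
    HasDerivAt (s0 g) (-2 * ∫ z in Ico (-Real.pi) Real.pi,
      deriv (fun y => K2 z (diff1 g y z) * diff1 (deriv g) y z) y) y := by
  have hae : ∀ᵐ z : ℝ ∂(volume.restrict (Ico (-Real.pi) Real.pi)), |z| ≤ Real.pi := by
    filter_upwards [ae_restrict_mem measurableSet_Ico] with z hz
    exact abs_le.2 ⟨hz.1, hz.2.le⟩
  refine HasDerivAt.const_mul (-2 : ℂ) ?_
  refine (hasDerivAt_integral_of_holomorphic (B := fun _ => 5000 * c ^ 3)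
    (f := fun z y => K2 z (diff1 g y z) * diff1 (deriv g) y z) ?_
    (fun w hw => (h.measurable_s0_integrand hw).aestronglyMeasurable)
    (hae.mono fun z hz w hw =>
      (h.hasDerivAt_s0_integrand hw hz).differentiableAt.differentiableWithinAt)
    (hae.mono fun z hz w hw => h.norm_s0_integrand_le hw hz) hy).2
  exact integrable_const _

lemma hol_s0 (h : Interface c ρ₀ g) : DifferentiableOn ℂ (s0 g) (strip ρ₀) := fun _ hy =>
  (h.hasDerivAt_s0 hy).differentiableAt.differentiableWithinAt

/-- The integrand stays bounded after differentiation: `K2d` is of order `|z|^{-2}` and meets two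
increments of order `|z|`, while `K2` is of order `|z|^{-1}` and meets one. This is where the third
derivative of `γ₀` enters. -/
lemma norm_deriv_s0_le (h : Interface c ρ₀ g) (hy : y ∈ strip ρ₀) :
    ‖deriv (s0 g) y‖ ≤ constS c := by
  have hc := h.one_le
  have hpi := Real.pi_lt_d2
  rw [(h.hasDerivAt_s0 hy).deriv, norm_mul, norm_neg, Complex.norm_ofNat]
  have hb : ∀ z ∈ Ico (-Real.pi) Real.pi,
      ‖deriv (fun y => K2 z (diff1 g y z) * diff1 (deriv g) y z) y‖ ≤
        c ^ 3 * Real.exp (4 * c) * (5000 * c ^ 2) ^ 2 + 5000 * c ^ 3 := by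
    intro z hz
    have hz' : |z| ≤ Real.pi := abs_le.2 ⟨hz.1, hz.2.le⟩
    have hg' := h.norm_diff1_deriv_le hy (z := z)
    have hg'' := IPM.norm_diff1_le h.hol'' h.bd3 hy z
    have k1 := h.norm_K2d_le hy hz'
    have k2 := h.norm_K2_le hy hz'
    rw [(h.hasDerivAt_s0_integrand hy hz').deriv]
    refine (norm_add_le _ _).trans ?_
    rw [norm_mul, norm_mul, norm_mul]
    calc _ ≤ ‖K2d z (diff1 g y z)‖ * (c * |z|) * (c * |z|) +
          ‖K2 z (diff1 g y z)‖ * (c * |z|) := by gcongr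
      _ = ‖K2d z (diff1 g y z)‖ * |z| ^ 2 * c ^ 2 + ‖K2 z (diff1 g y z)‖ * |z| * c := by ring
      _ ≤ c * Real.exp (4 * c) * (5000 * c ^ 2) ^ 2 * c ^ 2 + 5000 * c ^ 2 * c := by gcongr
      _ = _ := by ring
  have hn := norm_setIntegral_le_of_norm_le_const (μ := volume)
    (by rw [Real.volume_Ico]; exact ENNReal.ofReal_lt_top) hb
  rw [measureReal_def, Real.volume_Ico, ENNReal.toReal_ofReal (by linarith [Real.pi_pos])] at hn
  set A := c ^ 3 * Real.exp (4 * c) * (5000 * c ^ 2) ^ 2 + 5000 * c ^ 3 with hA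
  have hA0 : 0 ≤ A := by positivity
  have : constS c = 1 + 14 * A := rfl
  rw [this]
  -- The prefactor `2` times the length `2π` of the circle is below `14`.
  nlinarith

lemma one_le_constS (h : Interface c ρ₀ g) : 1 ≤ constS c := by
  have hc := h.one_le
  unfold constS
  have : 0 ≤ 14 * (c ^ 3 * Real.exp (4 * c) * (5000 * c ^ 2) ^ 2 + 5000 * c ^ 3) := by positivity
  linarith

lemma norm_diff1_s0_le (h : Interface c ρ₀ g) (hy : y ∈ strip ρ₀) :
    ‖diff1 (s0 g) y z‖ ≤ constS c * |z| :=
  IPM.norm_diff1_le h.hol_s0 (fun _ hw => h.norm_deriv_s0_le hw) hy z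

lemma norm_diff1_deriv_s0_le (h : Interface c ρ₀ g) (hy : y ∈ strip ρ₀) :
    ‖diff1 (deriv (s0 g)) y z‖ ≤ 2 * constS c := by
  refine (norm_sub_le _ _).trans ?_
  have := h.norm_deriv_s0_le hy
  have := h.norm_deriv_s0_le (sub_ofReal_mem_strip hy z)
  linarith

/-- Unlike the crude bound by twice the supremum, this one vanishes with `z`, as the more singular
kernel `K2d` requires; the Cauchy estimate for `s₀''` costs `1/d`. -/
lemma norm_diff1_deriv_s0_le' {d : ℝ} (h : Interface c ρ₀ g) (hd : 0 < d)
    (hy : y ∈ strip (ρ₀ - d)) : ‖diff1 (deriv (s0 g)) y z‖ ≤ constS c * |z| / d := by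
  have := IPM.norm_diff1_le (ρ := ρ₀ - d) (K := constS c / d)
    ((differentiableOn_deriv_strip h.hol_s0).mono (strip_mono (by linarith)))
    (fun w hw => norm_deriv_le_of_strip (differentiableOn_deriv_strip h.hol_s0)
      (fun w hw => h.norm_deriv_s0_le hw) hd hw) hy z
  refine this.trans (le_of_eq (by ring))

lemma config {t y₂ : ℝ} {z : ℝ × ℝ} (h : Interface c ρ₀ g) (ht : 0 < t) (ht4 : t ≤ 1 / 4)
    (htS : t * constS c ≤ 1 / 16) (hy : y ∈ strip ρ₀) (hy₂ : y₂ ∈ Ioo (-2 : ℝ) 2)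
    (hz : z ∈ Omega0) :
    Config c (constS c) t z.1 (y₂ - z.2) (diff1 g y z.1) (diff1 (deriv g) y z.1)
      (diff1 (s0 g) y z.1) where
  hc := h.one_le
  hS := h.one_le_constS
  t_pos := ht
  t_le := ht4
  tS_le := htS
  hz := abs_fst_le_of_mem hz
  hw := by rw [abs_le]; constructor <;> linarith [hy₂.1, hy₂.2, hz.2.1, hz.2.2]
  hΓ := h.norm_diff1_le hy
  hΓi := h.abs_im_diff1_le hy
  hΓ' := h.norm_diff1_deriv_le hy
  hσ := h.norm_diff1_s0_le hy

end Interface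


/-! ### The integrand of `F` and its `y₂`-derivative -/

/-- The `y₂`-derivative of the integrand of `F`. -/
def integrandD (g : ℂ → ℂ) (α t : ℝ) (η : ℂ → ℝ → ℂ) (y₁ : ℂ) (y₂ : ℝ) (z : ℝ × ℝ) : ℂ :=
  incrF2 z.1 t (y₂ - z.2) (diff1 g y₁ z.1) (diff1 (deriv g) y₁ z.1) (diff1 (s0 g) y₁ z.1)
    (diff1 (deriv (s0 g)) y₁ z.1) ((t ^ α : ℝ) * diff2 η y₁ y₂ z)
    ((t ^ α : ℝ) * diff2 (dy1 η) y₁ y₂ z) ((t ^ α : ℝ) * dy2 η y₁ y₂)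
    ((t ^ α : ℝ) * dy1 (dy2 η) y₁ y₂)

/-- The integrand of `F` as a function of the increments. -/
def integrandI (g : ℂ → ℂ) (α t : ℝ) (η : ℂ → ℝ → ℂ) (y₁ : ℂ) (y₂ : ℝ) (z : ℝ × ℝ) : ℂ :=
  incrF z.1 t (y₂ - z.2) (diff1 g y₁ z.1) (diff1 (deriv g) y₁ z.1) (diff1 (s0 g) y₁ z.1)
    (diff1 (deriv (s0 g)) y₁ z.1) ((t ^ α : ℝ) * diff2 η y₁ y₂ z)
    ((t ^ α : ℝ) * diff2 (dy1 η) y₁ y₂ z)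

/-- The standing smallness assumption on the time. -/
structure SmallTime (c t : ℝ) : Prop where
  pos : 0 < t
  le : t ≤ 1 / 4
  mul_le : t * constS c ≤ 1 / 16

section

variable {c ρ₀ ρ K d α t : ℝ} {g : ℂ → ℂ} {η : ℂ → ℝ → ℂ} {y₁ : ℂ} {y₂ : ℝ} {z : ℝ × ℝ}

lemma dy1_fFun (h : Interface c ρ₀ g) (hη : Reg ρ η K) (hρ : ρ ≤ ρ₀) (ht : 0 < t)
    (h1 : y₁ ∈ strip ρ) (h2 : y₂ ∈ Ioo (-2 : ℝ) 2) :
    dy1 (fFun g α t η) y₁ y₂ =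
      deriv g y₁ + t * deriv (s0 g) y₁ + 1 / 2 * t * ((t ^ α : ℝ) * dy1 η y₁ y₂) := by
  have h1' := strip_mono hρ h1
  have hn := (isOpen_strip ρ₀).mem_nhds h1'
  have a := (h.hol.differentiableAt hn).hasDerivAt
  have b := ((h.hol_s0.differentiableAt hn).hasDerivAt).const_mul (t : ℂ)
  have e := (hη.hasDerivAt1 h1 h2).const_mul (1 / 2 * (t ^ (1 + α) : ℝ) : ℂ)
  refine ((a.add b).add e).deriv.trans ?_
  rw [Real.rpow_add ht, Real.rpow_one]; push_cast; ring

/-- Writing `t^{1+α} = t · t^α` exhibits the perturbation as `t` times the increment of `t^α η`, so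
both corrections to `γ₀` carry a factor `t` and the small quantity is `t^α ‖η‖`. -/
lemma integrand_eq (h : Interface c ρ₀ g) (hη : Reg ρ η K) (hρ : ρ ≤ ρ₀) (ht : 0 < t)
    (h1 : y₁ ∈ strip ρ) (h2 : y₂ ∈ Ioo (-2 : ℝ) 2) (hz : z ∈ Omega0) :
    integrand g α t η y₁ y₂ z = integrandI g α t η y₁ y₂ z := by
  have e1 : diff2 (X2 g α t η) y₁ y₂ z =
      arg t (y₂ - z.2) (diff1 g y₁ z.1) (diff1 (s0 g) y₁ z.1)
        ((t ^ α : ℝ) * diff2 η y₁ y₂ z) := by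
    simp only [diff2, X2, fFun, arg, diff1]
    rw [Real.rpow_add ht, Real.rpow_one]; push_cast; ring
  have e2 : diff2 (dy1 (fFun g α t η)) y₁ y₂ z = diff1 (deriv g) y₁ z.1 +
      t * diff1 (deriv (s0 g)) y₁ z.1 + 1 / 2 * t * ((t ^ α : ℝ) * diff2 (dy1 η) y₁ y₂ z) := by
    simp only [diff2, diff1]
    rw [dy1_fFun h hη hρ ht h1 h2, dy1_fFun h hη hρ ht (sub_ofReal_mem_strip h1 _) hz.2]
    ring
  rw [integrand, integrandI, incrF, e1, e2]

lemma Reg.norm_diff2_le (hη : Reg ρ η K) (h1 : y₁ ∈ strip ρ) (h2 : y₂ ∈ Ioo (-2 : ℝ) 2)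
    (hz : z ∈ Omega0) : ‖diff2 η y₁ y₂ z‖ ≤ K * (|z.1| + |y₂ - z.2|) := by
  have := hη.norm_sub_le h1 (sub_ofReal_mem_strip h1 z.1) h2 hz.2
  simpa [diff2] using this

lemma Reg.norm_diff2_dy1_le (hη : Reg ρ η K) (h1 : y₁ ∈ strip ρ) (h2 : y₂ ∈ Ioo (-2 : ℝ) 2)
    (hz : z ∈ Omega0) : ‖diff2 (dy1 η) y₁ y₂ z‖ ≤ K * 2 := by
  refine (_root_.norm_sub_le _ _).trans ?_
  have := hη.bd1 _ h1 _ h2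
  have := hη.bd1 _ (sub_ofReal_mem_strip h1 z.1) _ hz.2
  linarith

lemma Reg.norm_diff2_dy1_le' (hη : Reg ρ η K) (hd : 0 < d) (h1 : y₁ ∈ strip (ρ - d))
    (h2 : y₂ ∈ Ioo (-2 : ℝ) 2) (hz : z ∈ Omega0) :
    ‖diff2 (dy1 η) y₁ y₂ z‖ ≤ K * ((|z.1| + |y₂ - z.2|) / d) := by
  have := hη.norm_dy1_sub_le hd h1 (sub_ofReal_mem_strip h1 z.1) h2 hz.2
  rw [div_mul_eq_mul_div, ← mul_div_assoc'] at this
  simpa [diff2] using this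

lemma norm_rpow_mul_le {A B : ℝ} {x : ℂ} (ht : 0 < t) (hx : ‖x‖ ≤ K * B) (hK : t ^ α * K ≤ A)
    (hB : 0 ≤ B) : ‖((t ^ α : ℝ) : ℂ) * x‖ ≤ A * B := by
  have := Real.rpow_pos_of_pos ht α
  rw [norm_mul, Complex.norm_real, Real.norm_of_nonneg this.le]
  calc t ^ α * ‖x‖ ≤ t ^ α * (K * B) := by gcongr
    _ = t ^ α * K * B := by ring
    _ ≤ A * B := by gcongr

lemma norm_e_le (hη : Reg ρ η K) (ht : 0 < t) (hK : t ^ α * K ≤ 1 / (8 * c))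
    (h1 : y₁ ∈ strip ρ) (h2 : y₂ ∈ Ioo (-2 : ℝ) 2) (hz : z ∈ Omega0) :
    ‖((t ^ α : ℝ) : ℂ) * diff2 η y₁ y₂ z‖ ≤ (|z.1| + |y₂ - z.2|) / (8 * c) := by
  have := norm_rpow_mul_le ht (hη.norm_diff2_le h1 h2 hz) hK (by positivity)
  rwa [one_div_mul_eq_div] at this

lemma norm_integrandI_le (h : Interface c ρ₀ g) (hη : Reg ρ η K) (hρ : ρ ≤ ρ₀)
    (ht : SmallTime c t) (hK : t ^ α * K ≤ 1 / (8 * c))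
    (h1 : y₁ ∈ strip ρ) (h2 : y₂ ∈ Ioo (-2 : ℝ) 2) (hz : z ∈ Omega0) :
    ‖integrandI g α t η y₁ y₂ z‖ ≤ constF c (constS c) * maj t y₂ z := by
  have h1' := strip_mono hρ h1
  refine (h.config ht.pos ht.le ht.mul_le h1' h2 hz).norm_incrF_le
    (norm_e_le hη ht.pos hK h1 h2 hz) (h.norm_diff1_deriv_s0_le h1') ?_
  have := norm_rpow_mul_le ht.pos (hη.norm_diff2_dy1_le h1 h2 hz) hK (by positivity)
  rwa [one_div_mul_eq_div] at this

lemma norm_integrandD_le (h : Interface c ρ₀ g) (hη : Reg ρ η K) (hρ : ρ ≤ ρ₀)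
    (ht : SmallTime c t) (hK : t ^ α * K ≤ 1 / (8 * c)) (hd : 0 < d) (hd1 : d ≤ 1)
    (h1 : y₁ ∈ strip (ρ - d)) (h2 : y₂ ∈ Ioo (-2 : ℝ) 2) (hz : z ∈ Omega0) :
    ‖integrandD g α t η y₁ y₂ z‖ ≤ constF2 c / d * maj t y₂ z := by
  have h0 : y₁ ∈ strip ρ := strip_mono (by linarith) h1
  have h1' := strip_mono hρ h0
  refine (h.config ht.pos ht.le ht.mul_le h1' h2 hz).norm_incrF2_le hd hd1
    (norm_e_le hη ht.pos hK h0 h2 hz)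
    (h.norm_diff1_deriv_s0_le' hd (strip_mono (by linarith) h1)) ?_ ?_ ?_
  · have := norm_rpow_mul_le ht.pos (hη.norm_diff2_dy1_le' hd h1 h2 hz) hK (by positivity)
    rw [one_div_mul_eq_div] at this
    exact this.trans (le_of_eq (by ring))
  · have := norm_rpow_mul_le (B := 1) ht.pos (by simpa using hη.bd2 _ h0 _ h2) hK (by positivity)
    simpa using this
  · have := norm_rpow_mul_le (B := 1 / d) ht.pos
      (by simpa [div_eq_mul_inv] using hη.norm_dy1_dy2_le hd h1 h2) hK (by positivity)
    exact this.trans (le_of_eq (by ring))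

lemma differentiableOn_diff1 {ρ : ℝ} {u : ℂ → ℂ} (hu : DifferentiableOn ℂ u (strip ρ)) (z : ℝ) :
    DifferentiableOn ℂ (fun y => diff1 u y z) (strip ρ) := fun _ hy =>
  (hasDerivAt_diff1 hu hy z).differentiableAt.differentiableWithinAt

lemma differentiableOn_diff2 {ρ : ℝ} {u : ℂ → ℝ → ℂ}
    (hu : ∀ y₂ ∈ Ioo (-2 : ℝ) 2, DifferentiableOn ℂ (fun w => u w y₂) (strip ρ))
    (h2 : y₂ ∈ Ioo (-2 : ℝ) 2) (hz : z ∈ Omega0) :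
    DifferentiableOn ℂ (fun y => diff2 u y y₂ z) (strip ρ) :=
  (hu y₂ h2).sub ((hu z.2 hz.2).comp (differentiableOn_id.sub_const (z.1 : ℂ))
    fun _ hw => sub_ofReal_mem_strip hw z.1)

lemma differentiableOn_arg (h : Interface c ρ₀ g) (hη : Reg ρ η K) (hρ : ρ ≤ ρ₀)
    (h2 : y₂ ∈ Ioo (-2 : ℝ) 2) (hz : z ∈ Omega0) :
    DifferentiableOn ℂ (fun y => arg t (y₂ - z.2) (diff1 g y z.1) (diff1 (s0 g) y z.1)
        ((t ^ α : ℝ) * diff2 η y y₂ z)) (strip ρ) := by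
  have a := (differentiableOn_diff1 h.hol z.1).mono (strip_mono hρ)
  have b := (differentiableOn_diff1 h.hol_s0 z.1).mono (strip_mono hρ)
  have e := differentiableOn_diff2 hη.hol h2 hz
  unfold arg
  fun_prop

lemma differentiableOn_K2_arg (h : Interface c ρ₀ g) (hη : Reg ρ η K) (hρ : ρ ≤ ρ₀)
    (ht : SmallTime c t) (hK : t ^ α * K ≤ 1 / (8 * c))
    (h2 : y₂ ∈ Ioo (-2 : ℝ) 2) (hz : z ∈ Omega0) :
    DifferentiableOn ℂ (fun y => K2 z.1 (arg t (y₂ - z.2) (diff1 g y z.1) (diff1 (s0 g) y z.1)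
        ((t ^ α : ℝ) * diff2 η y y₂ z))) (strip ρ) := fun y hy =>
  (DifferentiableAt.comp (g := K2 z.1) y ((h.config ht.pos ht.le ht.mul_le (strip_mono hρ hy) h2
    hz).hasDerivAt_K2_arg (norm_e_le hη ht.pos hK hy h2 hz)).differentiableAt
      ((differentiableOn_arg h hη hρ h2 hz).differentiableAt
        ((isOpen_strip ρ).mem_nhds hy))).differentiableWithinAt

lemma differentiableOn_K2d_arg (h : Interface c ρ₀ g) (hη : Reg ρ η K) (hρ : ρ ≤ ρ₀)
    (ht : SmallTime c t) (hK : t ^ α * K ≤ 1 / (8 * c))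
    (h2 : y₂ ∈ Ioo (-2 : ℝ) 2) (hz : z ∈ Omega0) :
    DifferentiableOn ℂ (fun y => K2d z.1 (arg t (y₂ - z.2) (diff1 g y z.1) (diff1 (s0 g) y z.1)
        ((t ^ α : ℝ) * diff2 η y y₂ z))) (strip ρ) := fun y hy =>
  (DifferentiableAt.comp (g := K2d z.1) y (Config.differentiableAt_K2d
    ((h.config ht.pos ht.le ht.mul_le (strip_mono hρ hy) h2 hz).den_ne
      (e := (t ^ α : ℝ) * diff2 η y y₂ z) (norm_e_le hη ht.pos hK hy h2 hz)))
      ((differentiableOn_arg h hη hρ h2 hz).differentiableAt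
        ((isOpen_strip ρ).mem_nhds hy))).differentiableWithinAt

lemma differentiableOn_integrandI (h : Interface c ρ₀ g) (hη : Reg ρ η K) (hρ : ρ ≤ ρ₀)
    (ht : SmallTime c t) (hK : t ^ α * K ≤ 1 / (8 * c))
    (h2 : y₂ ∈ Ioo (-2 : ℝ) 2) (hz : z ∈ Omega0) :
    DifferentiableOn ℂ (fun y => integrandI g α t η y y₂ z) (strip ρ) := by
  have a := (differentiableOn_diff1 h.hol' z.1).mono (strip_mono hρ)
  have b := (differentiableOn_diff1 (differentiableOn_deriv_strip h.hol_s0) z.1).mono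
    (strip_mono hρ)
  have e := differentiableOn_diff2 (u := dy1 η) (fun y₂ h2 => hη.hol1 h2) h2 hz
  have k := differentiableOn_K2_arg h hη hρ ht hK h2 hz
  have k0 : DifferentiableOn ℂ (fun y => K2 z.1 (diff1 g y z.1)) (strip ρ) := fun y hy =>
    (h.hasDerivAt_K2_diff1 (strip_mono hρ hy)
      (abs_fst_le_of_mem hz)).differentiableAt.differentiableWithinAt
  unfold integrandI incrF
  fun_prop

lemma differentiableOn_integrandD (h : Interface c ρ₀ g) (hη : Reg ρ η K) (hρ : ρ ≤ ρ₀)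
    (ht : SmallTime c t) (hK : t ^ α * K ≤ 1 / (8 * c))
    (h2 : y₂ ∈ Ioo (-2 : ℝ) 2) (hz : z ∈ Omega0) :
    DifferentiableOn ℂ (fun y => integrandD g α t η y y₂ z) (strip ρ) := by
  have a := (differentiableOn_diff1 h.hol' z.1).mono (strip_mono hρ)
  have b := (differentiableOn_diff1 (differentiableOn_deriv_strip h.hol_s0) z.1).mono
    (strip_mono hρ)
  have e := differentiableOn_diff2 (u := dy1 η) (fun y₂ h2 => hη.hol1 h2) h2 hz
  have k := differentiableOn_K2_arg h hη hρ ht hK h2 hz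
  have kd := differentiableOn_K2d_arg h hη hρ ht hK h2 hz
  have p := hη.hol2 y₂ h2
  have q : DifferentiableOn ℂ (fun w => dy1 (dy2 η) w y₂) (strip ρ) :=
    differentiableOn_deriv_strip p
  unfold integrandD incrF2
  fun_prop

/-- With `z` fixed, only `t(y₂ - z₂)`, `η(y)` and `∂₁η(y)` depend on `y₂`; the last one contributes
the mixed derivative. -/
lemma hasDerivAt_integrandI (h : Interface c ρ₀ g) (hη : Reg ρ η K) (hρ : ρ ≤ ρ₀)
    (ht : SmallTime c t) (hK : t ^ α * K ≤ 1 / (8 * c))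
    (h1 : y₁ ∈ strip ρ) (h2 : y₂ ∈ Ioo (-2 : ℝ) 2) (hz : z ∈ Omega0) :
    HasDerivAt (fun s : ℝ => integrandI g α t η y₁ s z) (integrandD g α t η y₁ y₂ z) y₂ := by
  have c1 : HasDerivAt (fun s : ℝ => ((t * (s - z.2) : ℝ) : ℂ)) (t : ℂ) y₂ := by
    have : HasDerivAt (fun s : ℝ => t * (s - z.2)) t y₂ := by
      simpa using ((hasDerivAt_id y₂).sub_const z.2).const_mul t
    exact this.ofReal_comp
  have c2 : HasDerivAt (fun s : ℝ => ((t ^ α : ℝ) : ℂ) * diff2 η y₁ s z)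
      ((t ^ α : ℝ) * dy2 η y₁ y₂) y₂ :=
    ((hη.hasDerivAt2 h1 h2).sub_const _).const_mul _
  have c3 : HasDerivAt (fun s : ℝ => ((t ^ α : ℝ) : ℂ) * diff2 (dy1 η) y₁ s z)
      ((t ^ α : ℝ) * dy1 (dy2 η) y₁ y₂) y₂ :=
    ((hη.hasDerivAt12 h1 h2).sub_const _).const_mul _
  have ca : HasDerivAt (fun s : ℝ => arg t (s - z.2) (diff1 g y₁ z.1) (diff1 (s0 g) y₁ z.1)
      ((t ^ α : ℝ) * diff2 η y₁ s z)) (t + 1 / 2 * t * ((t ^ α : ℝ) * dy2 η y₁ y₂)) y₂ := by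
    have := (c1.add_const (diff1 g y₁ z.1)).add
      ((c2.const_mul (1 / 2 * t : ℂ)).const_add (t * diff1 (s0 g) y₁ z.1))
    exact this
  have ck := HasDerivAt.comp (h₂ := K2 z.1) y₂ ((h.config ht.pos ht.le ht.mul_le
    (strip_mono hρ h1) h2 hz).hasDerivAt_K2_arg (norm_e_le hη ht.pos hK h1 h2 hz)) ca
  have := (ck.mul ((c3.const_mul (1 / 2 * t : ℂ)).const_add
    (diff1 (deriv g) y₁ z.1 + t * diff1 (deriv (s0 g)) y₁ z.1))).sub_const
      (K2 z.1 (diff1 g y₁ z.1) * diff1 (deriv g) y₁ z.1)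
  exact this

/-! ### Measurability -/

lemma aemeasurable_diff2 {u : ℂ → ℝ → ℂ}
    (hu : ContinuousOn (fun y : ℂ × ℝ => u y.1 y.2) (Omega ρ)) (h1 : y₁ ∈ strip ρ) :
    AEMeasurable (fun z => diff2 u y₁ y₂ z) (volume.restrict Omega0) := by
  have hc : ContinuousOn (fun z : ℝ × ℝ => u (y₁ - z.1) z.2) Omega0 :=
    hu.comp (f := fun z : ℝ × ℝ => ((y₁ - z.1 : ℂ), z.2)) (by fun_prop)
      fun z hz => ⟨sub_ofReal_mem_strip h1 z.1, hz.2⟩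
  exact aemeasurable_const.sub (hc.aemeasurable measurableSet_Omega0)

lemma measurable_K2d {S : Type*} [MeasurableSpace S] {f : S → ℝ} {a : S → ℂ} (hf : Measurable f)
    (ha : Measurable a) : Measurable (fun s => K2d (f s) (a s)) := by
  unfold K2d
  have h1 : Measurable fun s => Complex.cosh (a s) :=
    Complex.continuous_cosh.measurable.comp ha
  have h1' : Measurable fun s => Complex.sinh (a s) :=
    Complex.continuous_sinh.measurable.comp ha
  have h2 : Measurable fun s => ((Real.sin (f s) : ℝ) : ℂ) := by fun_prop
  have h3 : Measurable fun s => ((Real.cos (f s) : ℝ) : ℂ) := by fun_prop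
  fun_prop

lemma aemeasurable_K2 {S : Type*} [MeasurableSpace S] {μ : Measure S} {f : S → ℝ} {a : S → ℂ}
    (hf : AEMeasurable f μ) (ha : AEMeasurable a μ) : AEMeasurable (fun s => K2 (f s) (a s)) μ := by
  refine ⟨fun s => K2 (hf.mk f s) (ha.mk a s), Interface.measurable_K2 hf.measurable_mk ha.measurable_mk, ?_⟩
  filter_upwards [hf.ae_eq_mk, ha.ae_eq_mk] with s h1 h2
  rw [h1, h2]

lemma aemeasurable_K2d {S : Type*} [MeasurableSpace S] {μ : Measure S} {f : S → ℝ} {a : S → ℂ}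
    (hf : AEMeasurable f μ) (ha : AEMeasurable a μ) : AEMeasurable (fun s => K2d (f s) (a s)) μ := by
  refine ⟨fun s => K2d (hf.mk f s) (ha.mk a s), measurable_K2d hf.measurable_mk ha.measurable_mk, ?_⟩
  filter_upwards [hf.ae_eq_mk, ha.ae_eq_mk] with s h1 h2
  rw [h1, h2]

lemma aemeasurable_diff1 {u : ℂ → ℂ} (hu : DifferentiableOn ℂ u (strip ρ)) (h1 : y₁ ∈ strip ρ) :
    AEMeasurable (fun z : ℝ × ℝ => diff1 u y₁ z.1) (volume.restrict Omega0) :=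
  ((Interface.measurable_diff1 hu h1).comp measurable_fst).aemeasurable

lemma aemeasurable_arg (h : Interface c ρ₀ g) (hη : Reg ρ η K) (hρ : ρ ≤ ρ₀) (h1 : y₁ ∈ strip ρ) :
    AEMeasurable (fun z : ℝ × ℝ => arg t (y₂ - z.2) (diff1 g y₁ z.1) (diff1 (s0 g) y₁ z.1)
      ((t ^ α : ℝ) * diff2 η y₁ y₂ z)) (volume.restrict Omega0) := by
  have h1' := strip_mono hρ h1
  have w : Measurable fun z : ℝ × ℝ => ((t * (y₂ - z.2) : ℝ) : ℂ) := by fun_prop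
  exact (w.aemeasurable.add (aemeasurable_diff1 h.hol h1')).add
    (((aemeasurable_diff1 h.hol_s0 h1').const_mul (t : ℂ)).add
      (((aemeasurable_diff2 hη.continuousOn h1).const_mul ((t ^ α : ℝ) : ℂ)).const_mul
        (1 / 2 * t : ℂ)))

lemma aestronglyMeasurable_integrandI (h : Interface c ρ₀ g) (hη : Reg ρ η K) (hρ : ρ ≤ ρ₀)
    (h1 : y₁ ∈ strip ρ) :
    AEStronglyMeasurable (fun z => integrandI g α t η y₁ y₂ z) (volume.restrict Omega0) := by
  have h1' := strip_mono hρ h1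
  have k := aemeasurable_K2 measurable_fst.aemeasurable
    (aemeasurable_arg (α := α) (t := t) (y₂ := y₂) h hη hρ h1)
  have b := aemeasurable_diff1 h.hol' h1'
  refine AEMeasurable.aestronglyMeasurable (AEMeasurable.sub (k.mul ((b.add
    ((aemeasurable_diff1 (differentiableOn_deriv_strip h.hol_s0) h1').const_mul (t : ℂ))).add ?_))
    ((aemeasurable_K2 measurable_fst.aemeasurable (aemeasurable_diff1 h.hol h1')).mul b))
  exact ((aemeasurable_diff2 hη.continuousOn1 h1).const_mul ((t ^ α : ℝ) : ℂ)).const_mul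
        (1 / 2 * t : ℂ)

lemma aestronglyMeasurable_integrandD (h : Interface c ρ₀ g) (hη : Reg ρ η K) (hρ : ρ ≤ ρ₀)
    (h1 : y₁ ∈ strip ρ) :
    AEStronglyMeasurable (fun z => integrandD g α t η y₁ y₂ z) (volume.restrict Omega0) := by
  have h1' := strip_mono hρ h1
  have a := aemeasurable_arg (α := α) (t := t) (y₂ := y₂) h hη hρ h1
  have k := aemeasurable_K2 measurable_fst.aemeasurable a
  have kd := aemeasurable_K2d measurable_fst.aemeasurable a
  have b := aemeasurable_diff1 h.hol' h1'
  refine AEMeasurable.aestronglyMeasurable (AEMeasurable.add ((kd.mul_const _).mul ((b.add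
    ((aemeasurable_diff1 (differentiableOn_deriv_strip h.hol_s0) h1').const_mul (t : ℂ))).add ?_))
    (k.mul_const _))
  exact ((aemeasurable_diff2 hη.continuousOn1 h1).const_mul ((t ^ α : ℝ) : ℂ)).const_mul
        (1 / 2 * t : ℂ)

end


/-! ### Uniform continuity on sets -/

lemma uco_of_lipschitz {s : Set (ℂ × ℝ)} {f : ℂ × ℝ → ℂ} {C : ℝ}
    (h : ∀ x ∈ s, ∀ y ∈ s, ‖f x - f y‖ ≤ C * (‖x.1 - y.1‖ + |x.2 - y.2|)) :
    UniformContinuousOn f s := by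
  refine (LipschitzOnWith.of_dist_le_mul (K := Real.toNNReal (2 * |C|))
    fun x hx y hy => ?_).uniformContinuousOn
  rw [Real.coe_toNNReal _ (by positivity), dist_eq_norm]
  have h1 : ‖x.1 - y.1‖ ≤ dist x y := by rw [← dist_eq_norm]; exact le_max_left _ _
  have h2 : |x.2 - y.2| ≤ dist x y := by rw [← Real.dist_eq]; exact le_max_right _ _
  calc _ ≤ C * (‖x.1 - y.1‖ + |x.2 - y.2|) := h x hx y hy
    _ ≤ |C| * (dist x y + dist x y) := by gcongr; exact le_abs_self C
    _ = _ := by ring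

lemma uco_add {s : Set (ℂ × ℝ)} {f g : ℂ × ℝ → ℂ} (hf : UniformContinuousOn f s)
    (hg : UniformContinuousOn g s) : UniformContinuousOn (fun x => f x + g x) s := by
  rw [uniformContinuousOn_iff_restrict] at *
  exact hf.add hg

lemma uco_const_mul {s : Set (ℂ × ℝ)} {f : ℂ × ℝ → ℂ} (hf : UniformContinuousOn f s) (c : ℂ) :
    UniformContinuousOn (fun x => c * f x) s :=
  (uniformContinuous_const_smul c).comp_uniformContinuousOn hf

lemma uco_const {s : Set (ℂ × ℝ)} (c : ℂ) : UniformContinuousOn (fun _ : ℂ × ℝ => c) s :=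
  uniformContinuous_const.uniformContinuousOn

/-- Multiplication is uniformly continuous only on bounded sets, hence the two bounds. -/
lemma uco_mul {s : Set (ℂ × ℝ)} {f g : ℂ × ℝ → ℂ} {A B : ℝ} (hf : UniformContinuousOn f s)
    (hg : UniformContinuousOn g s) (hA : ∀ x ∈ s, ‖f x‖ ≤ A) (hB : ∀ x ∈ s, ‖g x‖ ≤ B) :
    UniformContinuousOn (fun x => f x * g x) s := by
  have hc : IsCompact (Metric.closedBall (0 : ℂ) A ×ˢ Metric.closedBall (0 : ℂ) B) :=
    (isCompact_closedBall _ _).prod (isCompact_closedBall _ _)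
  have hm : UniformContinuousOn (fun p : ℂ × ℂ => p.1 * p.2) _ :=
    hc.uniformContinuousOn_of_continuous (by fun_prop)
  have hp : UniformContinuousOn (fun x => (f x, g x)) s := by
    rw [uniformContinuousOn_iff_restrict] at *
    exact hf.prodMk hg
  exact hm.comp hp fun x hx =>
    ⟨mem_closedBall_zero_iff.2 (hA x hx), mem_closedBall_zero_iff.2 (hB x hx)⟩

lemma uco_comp {s : Set (ℂ × ℝ)} {f : ℂ × ℝ → ℂ} {Ψ : ℂ → ℂ} {k : Set ℂ}
    (hf : UniformContinuousOn f s) (hk : IsCompact k) (hΨ : ContinuousOn Ψ k)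
    (hfk : ∀ x ∈ s, f x ∈ k) : UniformContinuousOn (fun x => Ψ (f x)) s :=
  (hk.uniformContinuousOn_of_continuous hΨ).comp hf hfk

lemma uco_diff1 {ρ K : ℝ} {h : ℂ → ℂ} (hh : DifferentiableOn ℂ h (strip ρ))
    (hK : ∀ w ∈ strip ρ, ‖deriv h w‖ ≤ K) (z : ℝ) :
    UniformContinuousOn (fun y : ℂ × ℝ => diff1 h y.1 z) (Omega ρ) := by
  refine uco_of_lipschitz (C := K + K) fun x hx y hy => ?_
  have h1 := norm_sub_le_of_strip hh hK hx.1 hy.1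
  have h2 := norm_sub_le_of_strip hh hK (sub_ofReal_mem_strip hx.1 z) (sub_ofReal_mem_strip hy.1 z)
  rw [sub_sub_sub_cancel_right] at h2
  have hK0 : 0 ≤ K := (norm_nonneg _).trans (hK x.1 hx.1)
  have e : diff1 h x.1 z - diff1 h y.1 z =
      (h x.1 - h y.1) - (h (x.1 - z) - h (y.1 - z)) := by simp only [diff1]; ring
  rw [e]
  refine (norm_sub_le _ _).trans ?_
  have := mul_nonneg hK0 (abs_nonneg (x.2 - y.2))
  linarith

lemma uco_diff2 {ρ K : ℝ} {u : ℂ → ℝ → ℂ} {z : ℝ × ℝ} (hz : z ∈ Omega0)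
    (hu : ∀ x ∈ Omega ρ, ∀ y ∈ Omega ρ,
      ‖u x.1 x.2 - u y.1 y.2‖ ≤ K * (‖x.1 - y.1‖ + |x.2 - y.2|)) :
    UniformContinuousOn (fun y : ℂ × ℝ => diff2 u y.1 y.2 z) (Omega ρ) := by
  have a : UniformContinuousOn (fun y : ℂ × ℝ => u y.1 y.2) (Omega ρ) := uco_of_lipschitz hu
  have b : UniformContinuousOn (fun y : ℂ × ℝ => u (y.1 - z.1) z.2) (Omega ρ) := by
    refine uco_of_lipschitz (C := |K|) fun x hx y hy => ?_
    have := hu (x.1 - z.1, z.2) ⟨sub_ofReal_mem_strip hx.1 _, hz.2⟩ (y.1 - z.1, z.2)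
      ⟨sub_ofReal_mem_strip hy.1 _, hz.2⟩
    simp only [sub_sub_sub_cancel_right, sub_self, abs_zero, add_zero] at this
    refine this.trans ?_
    gcongr
    · exact le_abs_self K
    · have := abs_nonneg (x.2 - y.2); linarith
  have := uco_add a (uco_const_mul b (-1))
  refine this.congr fun y _ => ?_
  simp only [diff2]; ring

/-! ### Excision of the singularity -/

/-- The domain of integration without a neighbourhood of `z₁ = 0`. -/
def excised (n : ℕ) : Set (ℝ × ℝ) := Omega0 \ {z | |z.1| < 1 / ((n : ℝ) + 1)}

lemma measurableSet_near (n : ℕ) : MeasurableSet {z : ℝ × ℝ | |z.1| < 1 / ((n : ℝ) + 1)} :=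
  measurableSet_lt (by fun_prop) measurable_const

lemma measurableSet_excised (n : ℕ) : MeasurableSet (excised n) :=
  measurableSet_Omega0.diff (measurableSet_near n)

lemma volume_Omega0_lt_top : volume Omega0 < ⊤ := by
  rw [Omega0, Measure.volume_eq_prod, Measure.prod_prod, Real.volume_Ico, Real.volume_Ioo]
  exact ENNReal.mul_lt_top ENNReal.ofReal_lt_top ENNReal.ofReal_lt_top

lemma maj_le_of_mem_excised {t y₂ : ℝ} {n : ℕ} {z : ℝ × ℝ} (ht : 0 < t) (hz : z ∈ excised n) :
    maj t y₂ z ≤ t * (n + 1) := by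
  have h : 1 / ((n : ℝ) + 1) ≤ |z.1| := not_lt.1 hz.2
  have hn : (0 : ℝ) < 1 / ((n : ℝ) + 1) := by positivity
  unfold maj
  calc t / (|z.1| + t * |y₂ - z.2|) ≤ t / (1 / ((n : ℝ) + 1)) := by
        gcongr
        have : 0 ≤ t * |y₂ - z.2| := by positivity
        linarith
    _ = _ := by field_simp

/-- The contribution of `|z₁| < ε` is at most `32C √t √ε`, uniformly in the parameter, although the
point where the majorant is singular moves with `y p`. -/
lemma tendstoUniformlyOn_integral_excised {P : Type*} {A : Set P} {f : P → ℝ × ℝ → ℂ} {y : P → ℝ}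
    {C t : ℝ} (ht : 0 < t) (hC : 0 ≤ C) (hy : ∀ p ∈ A, y p ∈ Ioo (-2 : ℝ) 2)
    (hm : ∀ p ∈ A, AEStronglyMeasurable (f p) (volume.restrict Omega0))
    (hb : ∀ p ∈ A, ∀ z ∈ Omega0, ‖f p z‖ ≤ C * maj t (y p) z) :
    TendstoUniformlyOn (fun n p => ∫ z in excised n, f p z) (fun p => ∫ z in Omega0, f p z)
      atTop A := by
  rw [Metric.tendstoUniformlyOn_iff]
  intro ε hε
  have hlim : Tendsto (fun n : ℕ => C * (32 * (√t * √(1 / ((n : ℝ) + 1))))) atTop (𝓝 0) := by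
    have h1 := (tendsto_one_div_add_atTop_nhds_zero_nat (𝕜 := ℝ))
    have h2 := (Real.continuous_sqrt.tendsto 0).comp h1
    rw [Real.sqrt_zero] at h2
    simpa using ((h2.const_mul (√t)).const_mul 32).const_mul C
  filter_upwards [hlim.eventually_lt_const hε] with n hn p hp
  have hmaj := (integrableOn_maj ht (hy p hp)).const_mul C
  have hint : IntegrableOn (f p) Omega0 :=
    Integrable.mono' hmaj (hm p hp) ((ae_restrict_mem measurableSet_Omega0).mono (hb p hp))
  have e := integral_inter_add_sdiff (μ := volume) (f := f p) (measurableSet_near n) hint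
  rw [dist_eq_norm, ← e]
  simp only [excised, add_sub_cancel_right]
  refine lt_of_le_of_lt ?_ hn
  have hN : MeasurableSet (Omega0 ∩ {z : ℝ × ℝ | |z.1| < 1 / ((n : ℝ) + 1)}) :=
    measurableSet_Omega0.inter (measurableSet_near n)
  calc _ ≤ ∫ z in Omega0 ∩ {z : ℝ × ℝ | |z.1| < 1 / ((n : ℝ) + 1)}, C * maj t (y p) z :=
        norm_integral_le_of_norm_le (IntegrableOn.mono_set hmaj inter_subset_left)
          ((ae_restrict_mem hN).mono fun z hz => hb p hp z hz.1)
    _ = C * ∫ z in Omega0 ∩ {z : ℝ × ℝ | |z.1| < 1 / ((n : ℝ) + 1)}, maj t (y p) z :=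
        integral_const_mul _ _
    _ ≤ _ := by
        gcongr
        exact integral_maj_excised_le ht (hy p hp) (by positivity)

/-! ### The operator `F` at a fixed time -/

/-- The constant in the bounds of `F`. -/
def constCF (c : ℝ) : ℝ := 1000 * (constF c (constS c) + constF2 c)

section

variable {c ρ₀ ρ K d α t : ℝ} {g : ℂ → ℂ} {η ζ : ℂ → ℝ → ℂ} {y₁ : ℂ} {y₂ : ℝ} {z : ℝ × ℝ}

lemma Interface.constF_nonneg (h : Interface c ρ₀ g) : 0 ≤ constF c (constS c) := by
  have := h.one_le; have := h.one_le_constS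
  unfold constF; positivity

lemma Interface.constF2_nonneg (h : Interface c ρ₀ g) : 0 ≤ constF2 c := by
  have := h.one_le
  unfold constF2; positivity

lemma F_eq (h : Interface c ρ₀ g) (hη : Reg ρ η K) (hρ : ρ ≤ ρ₀) (ht : 0 < t)
    (h1 : y₁ ∈ strip ρ) (h2 : y₂ ∈ Ioo (-2 : ℝ) 2) :
    F g α t η y₁ y₂ = -∫ z in Omega0, integrandI g α t η y₁ y₂ z := by
  rw [F, if_pos ht]
  congr 1
  exact setIntegral_congr_fun measurableSet_Omega0 fun z hz => integrand_eq h hη hρ ht h1 h2 hz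

lemma integrableOn_integrandI (h : Interface c ρ₀ g) (hη : Reg ρ η K) (hρ : ρ ≤ ρ₀)
    (ht : SmallTime c t) (hK : t ^ α * K ≤ 1 / (8 * c))
    (h1 : y₁ ∈ strip ρ) (h2 : y₂ ∈ Ioo (-2 : ℝ) 2) :
    IntegrableOn (integrandI g α t η y₁ y₂) Omega0 :=
  Integrable.mono' ((integrableOn_maj ht.pos h2).const_mul (constF c (constS c)))
    (aestronglyMeasurable_integrandI h hη hρ h1) ((ae_restrict_mem measurableSet_Omega0).mono
      fun _ hz => norm_integrandI_le h hη hρ ht hK h1 h2 hz)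

lemma integrableOn_integrandD (h : Interface c ρ₀ g) (hη : Reg ρ η K) (hρ : ρ ≤ ρ₀)
    (ht : SmallTime c t) (hK : t ^ α * K ≤ 1 / (8 * c)) (hd : 0 < d) (hd1 : d ≤ 1)
    (h1 : y₁ ∈ strip (ρ - d)) (h2 : y₂ ∈ Ioo (-2 : ℝ) 2) :
    IntegrableOn (integrandD g α t η y₁ y₂) Omega0 :=
  Integrable.mono' ((integrableOn_maj ht.pos h2).const_mul (constF2 c / d))
    (aestronglyMeasurable_integrandD h hη hρ (strip_mono (by linarith) h1))
      ((ae_restrict_mem measurableSet_Omega0).mono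
        fun _ hz => norm_integrandD_le h hη hρ ht hK hd hd1 h1 h2 hz)

/-- A pointwise bound by the majorant gives a bound of the integral. -/
lemma norm_integral_le_of_maj {f : ℝ × ℝ → ℂ} {C : ℝ} (ht : 0 < t) (ht4 : t ≤ 1 / 4)
    (h2 : y₂ ∈ Ioo (-2 : ℝ) 2) (hC : 0 ≤ C) (hf : ∀ z ∈ Omega0, ‖f z‖ ≤ C * maj t y₂ z) :
    ‖∫ z in Omega0, f z‖ ≤ 1000 * C * (t * |Real.log t|) := by
  calc _ ≤ ∫ z in Omega0, C * maj t y₂ z :=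
        norm_integral_le_of_norm_le ((integrableOn_maj ht h2).const_mul C)
          ((ae_restrict_mem measurableSet_Omega0).mono hf)
    _ = C * ∫ z in Omega0, maj t y₂ z := integral_const_mul _ _
    _ ≤ C * (1000 * (t * |Real.log t|)) := by gcongr; exact integral_maj_le ht ht4 h2
    _ = _ := by ring

lemma norm_F_le (h : Interface c ρ₀ g) (hη : Reg ρ η K) (hρ : ρ ≤ ρ₀)
    (ht : SmallTime c t) (hK : t ^ α * K ≤ 1 / (8 * c))
    (h1 : y₁ ∈ strip ρ) (h2 : y₂ ∈ Ioo (-2 : ℝ) 2) :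
    ‖F g α t η y₁ y₂‖ ≤ constCF c * (t * |Real.log t|) := by
  rw [F_eq h hη hρ ht.pos h1 h2, norm_neg]
  refine (norm_integral_le_of_maj ht.pos ht.le h2 h.constF_nonneg
    fun z hz => norm_integrandI_le h hη hρ ht hK h1 h2 hz).trans ?_
  have := h.constF2_nonneg
  have := ht.pos
  unfold constCF
  gcongr
  linarith

lemma differentiableOn_F (h : Interface c ρ₀ g) (hη : Reg ρ η K) (hρ : ρ ≤ ρ₀)
    (ht : SmallTime c t) (hK : t ^ α * K ≤ 1 / (8 * c)) (h2 : y₂ ∈ Ioo (-2 : ℝ) 2) :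
    DifferentiableOn ℂ (fun w => F g α t η w y₂) (strip ρ) := by
  have hae := ae_restrict_mem (μ := volume) measurableSet_Omega0
  have := (differentiableOn_integral_of_holomorphic
    (f := fun z w => integrandI g α t η w y₂ z) ((integrableOn_maj ht.pos h2).const_mul
      (constF c (constS c)))
    (fun w hw => aestronglyMeasurable_integrandI h hη hρ hw)
    (hae.mono fun z hz => differentiableOn_integrandI h hη hρ ht hK h2 hz)
    (hae.mono fun z hz w hw => norm_integrandI_le h hη hρ ht hK hw h2 hz)).neg
  exact this.congr fun w hw => F_eq h hη hρ ht.pos hw h2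

/-- Domination over a neighbourhood of `y₂` fails: the supremum of `maj` over nearby `y₂` behaves
like `t/|z₁|`, which is not integrable. On each excised domain the derivative is bounded and
differentiation under the integral is legitimate. The derivatives converge uniformly as the excision
shrinks, so the limit may be differentiated. In `y₁` there is no such difficulty, since `maj` does
not depend on it. -/
lemma hasDerivAt_F (h : Interface c ρ₀ g) (hη : Reg ρ η K) (hρ : ρ ≤ ρ₀)
    (ht : SmallTime c t) (hK : t ^ α * K ≤ 1 / (8 * c)) (hd : 0 < d) (hd1 : d ≤ 1)
    (h1 : y₁ ∈ strip (ρ - d)) (h2 : y₂ ∈ Ioo (-2 : ℝ) 2) :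
    HasDerivAt (fun s : ℝ => F g α t η y₁ s) (-∫ z in Omega0, integrandD g α t η y₁ y₂ z) y₂ := by
  have h0 : y₁ ∈ strip ρ := strip_mono (by linarith) h1
  have hC := h.constF2_nonneg
  have htp := ht.pos
  have hsub : ∀ n, excised n ⊆ Omega0 := fun n => sdiff_subset
  have hmeasI : ∀ (n : ℕ) (s : ℝ), AEStronglyMeasurable (fun z => integrandI g α t η y₁ s z)
      (volume.restrict (excised n)) := fun n s =>
    (aestronglyMeasurable_integrandI h hη hρ h0).mono_measure (Measure.restrict_mono (hsub n) le_rfl)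
  have key := hasDerivAt_of_tendstoUniformlyOn (l := atTop) (s := Ioo (-2 : ℝ) 2) isOpen_Ioo
    (f := fun n s => ∫ z in excised n, integrandI g α t η y₁ s z)
    (f' := fun n s => ∫ z in excised n, integrandD g α t η y₁ s z)
    (g := fun s => ∫ z in Omega0, integrandI g α t η y₁ s z)
    (g' := fun s => ∫ z in Omega0, integrandD g α t η y₁ s z)
    (tendstoUniformlyOn_integral_excised (y := fun s => s) ht.pos (C := constF2 c / d)
      (by positivity) (fun s hs => hs)
      (fun s hs => aestronglyMeasurable_integrandD h hη hρ h0)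
      (fun s hs z hz => norm_integrandD_le h hη hρ ht hK hd hd1 h1 hs hz))
    (Eventually.of_forall fun n s hs => by
      have hE := ae_restrict_mem (μ := volume) (measurableSet_excised n)
      refine (hasDerivAt_integral_of_dominated_loc_of_deriv_le (F := fun s z =>
        integrandI g α t η y₁ s z) (F' := fun s z => integrandD g α t η y₁ s z)
        (bound := fun _ => constF2 c / d * (t * (n + 1))) (isOpen_Ioo.mem_nhds hs)
        (Eventually.of_forall fun s => hmeasI n s)
        ((integrableOn_integrandI h hη hρ ht hK h0 hs).mono_set (hsub n))
        ((aestronglyMeasurable_integrandD h hη hρ h0).mono_measure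
          (Measure.restrict_mono (hsub n) le_rfl))
        (hE.mono fun z hz x hx => ?_) ?_
        (hE.mono fun z hz x hx => hasDerivAt_integrandI h hη hρ ht hK h0 hx (hsub n hz))).2
      · refine (norm_integrandD_le h hη hρ ht hK hd hd1 h1 hx (hsub n hz)).trans ?_
        gcongr
        exact maj_le_of_mem_excised ht.pos hz
      · exact integrableOn_const ((measure_mono (hsub n)).trans_lt volume_Omega0_lt_top).ne)
    (fun s hs => by
      have := tendstoUniformlyOn_integral_excised (A := Ioo (-2 : ℝ) 2) (y := fun s => s)
        (f := fun s z => integrandI g α t η y₁ s z) ht.pos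
        h.constF_nonneg (fun s hs => hs)
        (fun s hs => aestronglyMeasurable_integrandI h hη hρ h0)
        (fun s hs z hz => norm_integrandI_le h hη hρ ht hK h0 hs hz)
      exact this.tendsto_at hs) h2
  refine key.neg.congr_of_eventuallyEq ?_
  filter_upwards [isOpen_Ioo.mem_nhds h2] with s hs using F_eq h hη hρ ht.pos h0 hs

lemma dy2_F (h : Interface c ρ₀ g) (hη : Reg ρ η K) (hρ : ρ ≤ ρ₀)
    (ht : SmallTime c t) (hK : t ^ α * K ≤ 1 / (8 * c)) (hd : 0 < d) (hd1 : d ≤ 1)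
    (h1 : y₁ ∈ strip (ρ - d)) (h2 : y₂ ∈ Ioo (-2 : ℝ) 2) :
    dy2 (F g α t η) y₁ y₂ = -∫ z in Omega0, integrandD g α t η y₁ y₂ z :=
  (hasDerivAt_F h hη hρ ht hK hd hd1 h1 h2).deriv

/-- For fixed `z` off the line `z₁ = 0`, the integrand is a combination of bounded uniformly
continuous increments and of kernels whose arguments stay in a compact set away from the poles. -/
lemma uco_integrandD (h : Interface c ρ₀ g) (hη : Reg ρ η K) (hρ : ρ ≤ ρ₀)
    (ht : SmallTime c t) (hK : t ^ α * K ≤ 1 / (8 * c)) (hd : 0 < d)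
    (hz : z ∈ Omega0) (hz0 : z.1 ≠ 0) :
    UniformContinuousOn (fun y : ℂ × ℝ => integrandD g α t η y.1 y.2 z) (Omega (ρ - d)) := by
  have htp := ht.pos
  have hc := h.one_le
  have hzp := abs_pos.2 hz0
  have hs1 : Omega (ρ - d) ⊆ Omega ρ := Omega_mono (by linarith)
  have hs2 : Omega (ρ - d) ⊆ Omega ρ₀ := Omega_mono (by linarith)
  have hs3 : Omega (ρ - d) ⊆ Omega (ρ₀ - d) := Omega_mono (by linarith)
  have hcfg : ∀ y ∈ Omega (ρ - d), _ := fun y hy =>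
    h.config htp ht.le ht.mul_le (hs2 hy).1 hy.2 hz
  have hen : ∀ y ∈ Omega (ρ - d), ‖((t ^ α : ℝ) : ℂ) * diff2 η y.1 y.2 z‖ ≤
      (|z.1| + |y.2 - z.2|) / (8 * c) := fun y hy =>
    norm_e_le hη htp hK (hs1 hy).1 hy.2 hz
  have hlen : ∀ y : ℂ × ℝ, |z.1| ≤ |z.1| + t * |y.2 - z.2| := fun y => by
    have : 0 ≤ t * |y.2 - z.2| := by positivity
    linarith
  have uΓ := (uco_diff1 h.hol h.bd1 z.1).mono hs2
  have uΓ' := (uco_diff1 h.hol' h.bd2 z.1).mono hs2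
  have uσ := (uco_diff1 h.hol_s0 (fun w hw => h.norm_deriv_s0_le hw) z.1).mono hs2
  have uσ' := (uco_diff1 (ρ := ρ₀ - d) (K := constS c / d)
    ((differentiableOn_deriv_strip h.hol_s0).mono (strip_mono (by linarith)))
    (fun w hw => norm_deriv_le_of_strip (differentiableOn_deriv_strip h.hol_s0)
      (fun w hw => h.norm_deriv_s0_le hw) hd hw) z.1).mono hs3
  have ue := (uco_diff2 (ρ := ρ) (u := η) hz
    fun x hx y hy => hη.norm_sub_le hx.1 hy.1 hx.2 hy.2).mono hs1
  have ue' := uco_diff2 (ρ := ρ - d) (u := dy1 η) hz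
    fun x hx y hy => hη.norm_dy1_sub_le hd hx.1 hy.1 hx.2 hy.2
  have up := hη.uc.mono hs1
  have uq := hη.uc_dy1_dy2 hd
  have uw : UniformContinuousOn (fun y : ℂ × ℝ => ((t * (y.2 - z.2) : ℝ) : ℂ)) (Omega (ρ - d)) := by
    refine uco_of_lipschitz (C := t) fun x _ y _ => ?_
    rw [← Complex.ofReal_sub, Complex.norm_real, Real.norm_eq_abs, ← mul_sub,
      sub_sub_sub_cancel_right, abs_mul, abs_of_pos htp]
    gcongr
    have := norm_nonneg (x.1 - y.1)
    linarith
  have ua : UniformContinuousOn (fun y : ℂ × ℝ => arg t (y.2 - z.2) (diff1 g y.1 z.1)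
      (diff1 (s0 g) y.1 z.1) ((t ^ α : ℝ) * diff2 η y.1 y.2 z)) (Omega (ρ - d)) :=
    uco_add (uco_add uw uΓ) (uco_add (uco_const_mul uσ t)
      (uco_const_mul (uco_const_mul ue _) _))
  -- All arguments of the kernels lie in this compact set, because `|z₁| + t|y₂ - z₂|` is between
  -- `|z₁|` and `5`. Continuity of `K2` and `K2d` on it is therefore uniform and bounded.
  set k : Set ℂ := Metric.closedBall 0 (10 * c) ∩
    {a | |z.1| ^ 2 / (5000 * c ^ 2) ≤ ‖Complex.cosh a - Real.cos z.1‖} with hk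
  have hkc : IsCompact k := (isCompact_closedBall _ _).inter_right
    (isClosed_le continuous_const (by fun_prop))
  have hkne : ∀ a ∈ k, Complex.cosh a - Real.cos z.1 ≠ 0 := fun a ha =>
    norm_pos_iff.1 (lt_of_lt_of_le (by positivity) ha.2)
  have hak : ∀ y ∈ Omega (ρ - d), arg t (y.2 - z.2) (diff1 g y.1 z.1)
      (diff1 (s0 g) y.1 z.1) ((t ^ α : ℝ) * diff2 η y.1 y.2 z) ∈ k := fun y hy => by
    refine ⟨mem_closedBall_zero_iff.2 (((hcfg y hy).norm_arg_le (hen y hy)).trans ?_),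
      le_trans ?_ ((hcfg y hy).den_ge (hen y hy))⟩
    · have := (hcfg y hy).length_le
      nlinarith
    · gcongr; exact hlen y
  have uK : UniformContinuousOn (fun y : ℂ × ℝ => K2 z.1 (arg t (y.2 - z.2) (diff1 g y.1 z.1)
      (diff1 (s0 g) y.1 z.1) ((t ^ α : ℝ) * diff2 η y.1 y.2 z))) (Omega (ρ - d)) :=
    uco_comp ua hkc (fun a ha =>
      (hasDerivAt_K2 fun _ => hkne a ha).continuousAt.continuousWithinAt) hak
  have uKd : UniformContinuousOn (fun y : ℂ × ℝ => K2d z.1 (arg t (y.2 - z.2) (diff1 g y.1 z.1)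
      (diff1 (s0 g) y.1 z.1) ((t ^ α : ℝ) * diff2 η y.1 y.2 z))) (Omega (ρ - d)) :=
    uco_comp ua hkc (fun a ha =>
      (Config.differentiableAt_K2d fun _ => hkne a ha).continuousAt.continuousWithinAt) hak
  obtain ⟨A, hA⟩ := hkc.exists_bound_of_continuousOn (f := K2 z.1) fun a ha =>
      (hasDerivAt_K2 fun _ => hkne a ha).continuousAt.continuousWithinAt
  obtain ⟨A', hA'⟩ := hkc.exists_bound_of_continuousOn (f := K2d z.1) fun a ha =>
      (Config.differentiableAt_K2d fun _ => hkne a ha).continuousAt.continuousWithinAt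
  have u1 : UniformContinuousOn (fun y : ℂ × ℝ =>
      (t + 1 / 2 * t * ((t ^ α : ℝ) * dy2 η y.1 y.2) : ℂ)) (Omega (ρ - d)) :=
    uco_add (uco_const _) (uco_const_mul (uco_const_mul up _) _)
  have u2 : UniformContinuousOn (fun y : ℂ × ℝ => (diff1 (deriv g) y.1 z.1 +
      t * diff1 (deriv (s0 g)) y.1 z.1 + 1 / 2 * t * ((t ^ α : ℝ) * diff2 (dy1 η) y.1 y.2 z) : ℂ))
      (Omega (ρ - d)) :=
    uco_add (uco_add uΓ' (uco_const_mul uσ' _)) (uco_const_mul (uco_const_mul ue' _) _)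
  have u3 : UniformContinuousOn (fun y : ℂ × ℝ =>
      (1 / 2 * t * ((t ^ α : ℝ) * dy1 (dy2 η) y.1 y.2) : ℂ)) (Omega (ρ - d)) :=
    uco_const_mul (uco_const_mul uq _) _
  have b1 : ∀ y ∈ Omega (ρ - d), ‖(t + 1 / 2 * t * ((t ^ α : ℝ) * dy2 η y.1 y.2) : ℂ)‖ ≤
      ‖(t : ℂ)‖ + ‖(1 / 2 * t : ℂ)‖ * (‖((t ^ α : ℝ) : ℂ)‖ * K) := fun y hy => by
    refine (norm_add_le _ _).trans ?_
    rw [norm_mul (1 / 2 * (t : ℂ)), norm_mul ((t ^ α : ℝ) : ℂ)]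
    gcongr
    exact hη.bd2 _ (hs1 hy).1 _ hy.2
  have b2 : ∀ y ∈ Omega (ρ - d), ‖(diff1 (deriv g) y.1 z.1 +
      t * diff1 (deriv (s0 g)) y.1 z.1 + 1 / 2 * t * ((t ^ α : ℝ) * diff2 (dy1 η) y.1 y.2 z) : ℂ)‖ ≤
      c * |z.1| + ‖(t : ℂ)‖ * (2 * constS c) + ‖(1 / 2 * t : ℂ)‖ * (‖((t ^ α : ℝ) : ℂ)‖ * (K * 2)) :=
    fun y hy => by
    refine norm_add₃_le.trans ?_
    rw [norm_mul (t : ℂ), norm_mul (1 / 2 * (t : ℂ)), norm_mul ((t ^ α : ℝ) : ℂ)]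
    gcongr
    · exact h.norm_diff1_deriv_le (hs2 hy).1
    · exact h.norm_diff1_deriv_s0_le (hs2 hy).1
    · exact hη.norm_diff2_dy1_le (hs1 hy).1 hy.2 hz
  have b3 : ∀ y ∈ Omega (ρ - d), ‖(1 / 2 * t * ((t ^ α : ℝ) * dy1 (dy2 η) y.1 y.2) : ℂ)‖ ≤
      ‖(1 / 2 * t : ℂ)‖ * (‖((t ^ α : ℝ) : ℂ)‖ * (K / d)) := fun y hy => by
    rw [norm_mul (1 / 2 * (t : ℂ)), norm_mul ((t ^ α : ℝ) : ℂ)]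
    gcongr
    exact hη.norm_dy1_dy2_le hd hy.1 hy.2
  have m1 := uco_mul uKd u1 (fun y hy => hA' _ (hak y hy)) b1
  have m2 := uco_mul m1 u2 (A := A' * (‖(t : ℂ)‖ + ‖(1 / 2 * t : ℂ)‖ * (‖((t ^ α : ℝ) : ℂ)‖ * K)))
    (fun y hy => by
      rw [norm_mul]
      exact mul_le_mul (hA' _ (hak y hy)) (b1 y hy) (norm_nonneg _)
        ((norm_nonneg _).trans (hA' _ (hak y hy)))) b2
  have m3 := uco_mul uK u3 (fun y hy => hA _ (hak y hy)) b3
  exact uco_add m2 m3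

/-- A uniform limit of uniformly continuous functions, namely the integrals over the excised
domains. -/
lemma uco_dy2_F (h : Interface c ρ₀ g) (hη : Reg ρ η K) (hρ : ρ ≤ ρ₀)
    (ht : SmallTime c t) (hK : t ^ α * K ≤ 1 / (8 * c)) (hd : 0 < d) (hd1 : d ≤ 1) :
    UniformContinuousOn (fun y : ℂ × ℝ => dy2 (F g α t η) y.1 y.2) (Omega (ρ - d)) := by
  have hC := h.constF2_nonneg
  have htp := ht.pos
  have hsub : ∀ n, excised n ⊆ Omega0 := fun n => sdiff_subset
  have hs1 : strip (ρ - d) ⊆ strip ρ := strip_mono (by linarith)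
  have hlim := tendstoUniformlyOn_integral_excised (A := Omega (ρ - d)) (y := fun y => y.2)
    (f := fun y z => integrandD g α t η y.1 y.2 z) ht.pos (C := constF2 c / d) (by positivity)
    (fun y hy => hy.2) (fun y hy => aestronglyMeasurable_integrandD h hη hρ (hs1 hy.1))
    (fun y hy z hz => norm_integrandD_le h hη hρ ht hK hd hd1 hy.1 hy.2 hz)
  have hn : ∀ n, UniformContinuousOn
      (fun y : ℂ × ℝ => ∫ z in excised n, integrandD g α t η y.1 y.2 z) (Omega (ρ - d)) := by
    intro n
    have hE := ae_restrict_mem (μ := volume) (measurableSet_excised n)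
    refine uniformContinuousOn_integral (B := fun _ => constF2 c / d * (t * (n + 1)))
      (integrableOn_const ((measure_mono (hsub n)).trans_lt volume_Omega0_lt_top).ne)
      (fun y hy => (aestronglyMeasurable_integrandD h hη hρ (hs1 hy.1)).mono_measure
          (Measure.restrict_mono (hsub n) le_rfl))
      (hE.mono fun z hz y hy => ?_) (hE.mono fun z hz => ?_)
    · refine (norm_integrandD_le h hη hρ ht hK hd hd1 hy.1 hy.2 (hsub n hz)).trans ?_
      gcongr
      exact maj_le_of_mem_excised ht.pos hz
    · refine uco_integrandD h hη hρ ht hK hd (hsub n hz) fun h0 => hz.2 ?_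
      rw [mem_ofPred_eq, h0, abs_zero]; positivity
  have := hlim.uniformContinuousOn (Frequently.of_forall hn)
  have hneg := uniformContinuous_neg.comp_uniformContinuousOn this
  exact hneg.congr fun y hy => (dy2_F h hη hρ ht hK hd hd1 hy.1 hy.2).symm

/-- `F` maps `B_ρ` to `B_{ρ - d}` with the bound `C t |log t| / d`. -/
lemma reg_F (h : Interface c ρ₀ g) (hη : Reg ρ η K) (hρ : ρ ≤ ρ₀)
    (ht : SmallTime c t) (hK : t ^ α * K ≤ 1 / (8 * c)) (hd : 0 < d) (hd1 : d ≤ 1) :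
    Reg (ρ - d) (F g α t η) (constCF c * (t * |Real.log t|) / d) := by
  have htp := ht.pos
  have hC := h.constF_nonneg
  have hC2 := h.constF2_nonneg
  have hCF : 0 ≤ constCF c := by unfold constCF; positivity
  have hs1 : strip (ρ - d) ⊆ strip ρ := strip_mono (by linarith)
  refine ⟨fun b hb => (differentiableOn_F h hη hρ ht hK hb).mono hs1,
    fun a ha b hb => (hasDerivAt_F h hη hρ ht hK hd hd1 ha hb).differentiableAt,
    uco_dy2_F h hη hρ ht hK hd hd1, fun b hb => ?_, fun a ha b hb => ?_, fun a ha b hb => ?_,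
    fun a ha b hb => ?_⟩
  · have hae := ae_restrict_mem (μ := volume) measurableSet_Omega0
    have := (differentiableOn_integral_of_holomorphic (ρ := ρ - d)
      (f := fun z w => integrandD g α t η w b z) ((integrableOn_maj ht.pos hb).const_mul
        (constF2 c / d))
      (fun w hw => aestronglyMeasurable_integrandD h hη hρ (hs1 hw))
      (hae.mono fun z hz => (differentiableOn_integrandD h hη hρ ht hK hb hz).mono hs1)
      (hae.mono fun z hz w hw => norm_integrandD_le h hη hρ ht hK hd hd1 hw hb hz)).neg
    exact this.congr fun w hw => dy2_F h hη hρ ht hK hd hd1 hw hb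
  · exact (norm_F_le h hη hρ ht hK (hs1 ha) hb).trans (le_div_self (by positivity) hd hd1)
  -- The supremum of `F` is bounded without loss of width, so its `y₁`-derivative costs one Cauchy
  -- estimate.
  · exact norm_deriv_le_of_strip (differentiableOn_F h hη hρ ht hK hb)
      (fun w hw => norm_F_le h hη hρ ht hK hw hb) hd ha
  · rw [dy2_F h hη hρ ht hK hd hd1 ha hb, norm_neg]
    refine (norm_integral_le_of_maj ht.pos ht.le hb (by positivity)
      fun z hz => norm_integrandD_le h hη hρ ht hK hd hd1 ha hb hz).trans ?_
    have : 1000 * (constF2 c / d) * (t * |Real.log t|) =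
      1000 * constF2 c * (t * |Real.log t|) / d := by ring
    rw [this]
    unfold constCF
    gcongr
    linarith

/-- `F` is Lipschitz from `B_ρ` to `B_{ρ - d}`. -/
lemma reg_F_sub {m : ℝ} (h : Interface c ρ₀ g) (hη : Reg ρ η 1) (hζ : Reg ρ ζ 1)
    (hm : Reg ρ (η - ζ) m) (hm0 : 0 < m) (hm2 : m ≤ 2) (hρ : ρ ≤ ρ₀) (ht : SmallTime c t)
    (hK : t ^ α * 2 < 1 / (16 * c)) (hd : 0 < d) (hd1 : d ≤ 1) :
    Reg (ρ - d) (F g α t η - F g α t ζ)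
      (32 * c * (t ^ α * m) * constCF c * (t * |Real.log t|) / d) := by
  have htp := ht.pos
  have hC := h.constF_nonneg
  have hC2 := h.constF2_nonneg
  have hc := h.one_le
  have hCF : 0 ≤ constCF c := by unfold constCF; positivity
  have hta : 0 < t ^ α := Real.rpow_pos_of_pos htp α
  have hs1 : strip (ρ - d) ⊆ strip ρ := strip_mono (by linarith)
  have hK1 : t ^ α * 1 ≤ 1 / (8 * c) := by
    have : 1 / (16 * c) ≤ 1 / (8 * c) := by gcongr; norm_num
    linarith
  have hK2 : t ^ α * 1 ≤ 1 / (16 * c) := by linarith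
  set μ := t ^ α * m with hμ
  have hμ0 : 0 < μ := by positivity
  -- The Schwarz argument needs a disc of radius larger than one; this is where `m ≤ 2` is needed.
  have hμ1 : μ < 1 / (16 * c) := by
    refine lt_of_le_of_lt ?_ hK; rw [hμ]; gcongr
  have hdiff : ∀ (a : ℂ) (b : ℝ) (z : ℝ × ℝ),
      ((t ^ α : ℝ) : ℂ) * diff2 η a b z - (t ^ α : ℝ) * diff2 ζ a b z =
        (t ^ α : ℝ) * diff2 (η - ζ) a b z := fun a b z => by
    simp only [diff2, Pi.sub_apply]; ring
  have hdiff1 : ∀ a ∈ strip ρ, ∀ b ∈ Ioo (-2 : ℝ) 2, ∀ z ∈ Omega0,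
      ((t ^ α : ℝ) : ℂ) * diff2 (dy1 η) a b z - (t ^ α : ℝ) * diff2 (dy1 ζ) a b z =
        (t ^ α : ℝ) * diff2 (dy1 (η - ζ)) a b z := fun a ha b hb z hz => by
    simp only [diff2]
    rw [hη.dy1_sub hζ ha hb, hη.dy1_sub hζ (sub_ofReal_mem_strip ha _) hz.2]; ring
  have hdiff2 : ∀ a ∈ strip ρ, ∀ b ∈ Ioo (-2 : ℝ) 2,
      ((t ^ α : ℝ) : ℂ) * dy2 η a b - (t ^ α : ℝ) * dy2 ζ a b =
        (t ^ α : ℝ) * dy2 (η - ζ) a b := fun a ha b hb => by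
    rw [hη.dy2_sub hζ ha hb]; ring
  have hdiff12 : ∀ a ∈ strip ρ, ∀ b ∈ Ioo (-2 : ℝ) 2,
      ((t ^ α : ℝ) : ℂ) * dy1 (dy2 η) a b - (t ^ α : ℝ) * dy1 (dy2 ζ) a b =
        (t ^ α : ℝ) * dy1 (dy2 (η - ζ)) a b := fun a ha b hb => by
    have : dy1 (dy2 (η - ζ)) a b = dy1 (dy2 η) a b - dy1 (dy2 ζ) a b := by
      rw [dy1_congr (v := dy2 η - dy2 ζ) (fun w hw => hη.dy2_sub hζ hw hb) ha]
      exact ((hη.hasDerivAt21 ha hb).sub (hζ.hasDerivAt21 ha hb)).deriv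
    rw [this]; ring
  have p1 : ∀ a ∈ strip ρ, ∀ b ∈ Ioo (-2 : ℝ) 2, ∀ z ∈ Omega0,
      ‖integrandI g α t η a b z - integrandI g α t ζ a b z‖ ≤
        32 * c * μ * constF c (constS c) * maj t b z := fun a ha b hb z hz => by
    have ha' := strip_mono hρ ha
    refine (h.config htp ht.le ht.mul_le ha' hb hz).norm_incrF_sub_le hμ0 hμ1
      (h.norm_diff1_deriv_s0_le ha')
      (norm_rpow_mul_le htp (hζ.norm_diff2_le ha hb hz) hK2 (by positivity)) ?_
      (norm_rpow_mul_le htp (hζ.norm_diff2_dy1_le ha hb hz) hK2 (by positivity)) ?_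
    · rw [hdiff]
      exact norm_rpow_mul_le htp (hm.norm_diff2_le ha hb hz) le_rfl (by positivity)
    · rw [hdiff1 a ha b hb z hz]
      exact norm_rpow_mul_le htp (hm.norm_diff2_dy1_le ha hb hz) le_rfl (by positivity)
  have p2 : ∀ a ∈ strip (ρ - d), ∀ b ∈ Ioo (-2 : ℝ) 2, ∀ z ∈ Omega0,
      ‖integrandD g α t η a b z - integrandD g α t ζ a b z‖ ≤
        32 * c * μ * (constF2 c / d) * maj t b z := fun a had b hb z hz => by
    have ha := hs1 had
    have ha' := strip_mono hρ ha
    refine (h.config htp ht.le ht.mul_le ha' hb hz).norm_incrF2_sub_le hd hd1 hμ0 hμ1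
      (h.norm_diff1_deriv_s0_le' hd (strip_mono (by linarith) had))
      (norm_rpow_mul_le htp (hζ.norm_diff2_le ha hb hz) hK2 (by positivity)) ?_
      (norm_rpow_mul_le htp (hζ.norm_diff2_dy1_le' hd had hb hz) hK2 (by positivity)) ?_
      (norm_rpow_mul_le htp (by simpa using hζ.bd2 a ha b hb) hK2 (by positivity)) ?_
      (norm_rpow_mul_le htp (by simpa [div_eq_mul_inv] using hζ.norm_dy1_dy2_le hd had hb) hK2
        (by positivity)) ?_
    · rw [hdiff]
      exact norm_rpow_mul_le htp (hm.norm_diff2_le ha hb hz) le_rfl (by positivity)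
    · rw [hdiff1 a ha b hb z hz]
      exact norm_rpow_mul_le htp (hm.norm_diff2_dy1_le' hd had hb hz) le_rfl (by positivity)
    · rw [hdiff2 a ha b hb]
      exact norm_rpow_mul_le htp (by simpa using hm.bd2 a ha b hb) le_rfl (by positivity)
    · rw [hdiff12 a ha b hb]
      exact norm_rpow_mul_le htp (by simpa [div_eq_mul_inv] using hm.norm_dy1_dy2_le hd had hb)
        le_rfl (by positivity)
  have q1 : ∀ a ∈ strip ρ, ∀ b ∈ Ioo (-2 : ℝ) 2, ‖(F g α t η - F g α t ζ) a b‖ ≤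
      32 * c * μ * constCF c * (t * |Real.log t|) := fun a ha b hb => by
    have e : (F g α t η - F g α t ζ) a b =
        -∫ z in Omega0, (integrandI g α t η a b z - integrandI g α t ζ a b z) := by
      rw [integral_sub (integrableOn_integrandI h hη hρ ht hK1 ha hb)
        (integrableOn_integrandI h hζ hρ ht hK1 ha hb)]
      simp only [Pi.sub_apply]
      rw [F_eq h hη hρ htp ha hb, F_eq h hζ hρ htp ha hb]; ring
    rw [e, norm_neg]
    refine (norm_integral_le_of_maj htp ht.le hb (by positivity) (p1 a ha b hb)).trans ?_
    have : 1000 * (32 * c * μ * constF c (constS c)) * (t * |Real.log t|) =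
      32 * c * μ * (1000 * constF c (constS c)) * (t * |Real.log t|) := by ring
    rw [this]
    unfold constCF
    gcongr
    linarith
  have r1 := reg_F h hη hρ ht hK1 hd hd1
  have r2 := reg_F h hζ hρ ht hK1 hd hd1
  refine (r1.sub r2).of_bounds (fun a ha b hb => ?_) (fun a ha b hb => ?_) (fun a ha b hb => ?_)
  · exact (q1 a (hs1 ha) b hb).trans (le_div_self (by positivity) hd hd1)
  · exact norm_deriv_le_of_strip ((differentiableOn_F h hη hρ ht hK1 hb).sub
      (differentiableOn_F h hζ hρ ht hK1 hb)) (fun w hw => q1 w hw b hb) hd ha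
  · have e : dy2 (F g α t η - F g α t ζ) a b =
        -∫ z in Omega0, (integrandD g α t η a b z - integrandD g α t ζ a b z) := by
      rw [integral_sub (integrableOn_integrandD h hη hρ ht hK1 hd hd1 ha hb)
        (integrableOn_integrandD h hζ hρ ht hK1 hd hd1 ha hb), r1.dy2_sub r2 ha hb,
        dy2_F h hη hρ ht hK1 hd hd1 ha hb, dy2_F h hζ hρ ht hK1 hd hd1 ha hb]
      ring
    rw [e, norm_neg]
    refine (norm_integral_le_of_maj htp ht.le hb (by positivity) (p2 a ha b hb)).trans ?_
    have : 1000 * (32 * c * μ * (constF2 c / d)) * (t * |Real.log t|) =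
      32 * c * μ * (1000 * constF2 c) * (t * |Real.log t|) / d := by ring
    rw [this]
    unfold constCF
    gcongr
    linarith

end


/-! ### Reality and periodicity -/

lemma im_deriv_eq_zero {h : ℂ → ℂ} (hh : ∀ x : ℝ, (h x).im = 0) (x : ℝ) : (deriv h x).im = 0 := by
  by_cases hd : DifferentiableAt ℂ h x
  · have h1 := Complex.imCLM.hasFDerivAt.comp_hasDerivAt x hd.hasDerivAt.comp_ofReal
    have h2 : HasDerivAt (fun x : ℝ => (h x).im) (deriv h x).im x := h1
    simp only [hh] at h2
    exact h2.unique (hasDerivAt_const x (0 : ℝ))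
  · simp [deriv_zero_of_not_differentiableAt hd]

lemma deriv_add_eq_of_real {h : ℂ → ℂ} {p : ℝ} (hh : ∀ x : ℝ, h ((x + p : ℝ) : ℂ) = h x)
    (hd : ∀ x : ℝ, DifferentiableAt ℂ h x) (x : ℝ) :
    deriv h ((x + p : ℝ) : ℂ) = deriv h x := by
  have h1 : HasDerivAt (fun x : ℝ => h ((x + p : ℝ) : ℂ)) (deriv h ((x + p : ℝ) : ℂ)) x :=
    HasDerivAt.comp_add_const x p (hd (x + p)).hasDerivAt.comp_ofReal
  simp only [hh] at h1
  exact h1.unique (hd x).hasDerivAt.comp_ofReal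

lemma im_K2_eq_zero (z : ℝ) {a : ℂ} (ha : a.im = 0) : (K2 z a).im = 0 := by
  obtain ⟨r, rfl⟩ : ∃ r : ℝ, a = r := ⟨a.re, Complex.ext rfl (by simpa using ha)⟩
  have : K2 z r = ((1 / (4 * Real.pi) * (Real.sin z / (Real.cosh r - Real.cos z)) : ℝ) : ℂ) := by
    simp [K2]
  rw [this, Complex.ofReal_im]

lemma im_mul_eq_zero {a b : ℂ} (ha : a.im = 0) (hb : b.im = 0) : (a * b).im = 0 := by
  simp [Complex.mul_im, ha, hb]

lemma im_setIntegral_eq_zero {S : Type*} [MeasurableSpace S] {μ : Measure S} {s : Set S}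
    {f : S → ℂ} (hs : MeasurableSet s) (hf : ∀ z ∈ s, (f z).im = 0) :
    (∫ z in s, f z ∂μ).im = 0 := by
  have : ∫ z in s, f z ∂μ = ∫ z in s, (((f z).re : ℝ) : ℂ) ∂μ :=
    setIntegral_congr_fun hs fun z hz => Complex.ext rfl (by simpa using hf z hz)
  rw [this, integral_complex_ofReal, Complex.ofReal_im]

/-- Functions which are real and `2π`-periodic on the real axis. -/
structure RealPer (u : ℂ → ℝ → ℂ) : Prop where
  real : ∀ (x : ℝ), ∀ y₂ ∈ Ioo (-2 : ℝ) 2, (u x y₂).im = 0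
  periodic : ∀ (x : ℝ), ∀ y₂ ∈ Ioo (-2 : ℝ) 2, u ((x + 2 * Real.pi : ℝ) : ℂ) y₂ = u x y₂

section

variable {c ρ₀ ρ K d α t : ℝ} {g : ℂ → ℂ} {η ζ : ℂ → ℝ → ℂ} {y₁ : ℂ} {y₂ : ℝ} {z : ℝ × ℝ}

lemma im_diff1_eq_zero {h : ℂ → ℂ} (hh : ∀ x : ℝ, (h x).im = 0) (x z : ℝ) :
    (diff1 h x z).im = 0 := by
  rw [diff1, ← Complex.ofReal_sub, Complex.sub_im, hh, hh, sub_zero]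

lemma diff1_add_period {h : ℂ → ℂ} {p : ℝ} (hh : ∀ x : ℝ, h ((x + p : ℝ) : ℂ) = h x) (x z : ℝ) :
    diff1 h ((x + p : ℝ) : ℂ) z = diff1 h x z := by
  rw [diff1, diff1, ← Complex.ofReal_sub, ← Complex.ofReal_sub, hh,
    show x + p - z = x - z + p by ring, hh]

lemma im_diff2_eq_zero {u : ℂ → ℝ → ℂ} (hu : ∀ (x : ℝ), ∀ y₂ ∈ Ioo (-2 : ℝ) 2, (u x y₂).im = 0)
    (x : ℝ) (h2 : y₂ ∈ Ioo (-2 : ℝ) 2) (hz : z ∈ Omega0) : (diff2 u x y₂ z).im = 0 := by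
  rw [diff2, ← Complex.ofReal_sub, Complex.sub_im, hu _ _ h2, hu _ _ hz.2, sub_zero]

lemma diff2_add_period {u : ℂ → ℝ → ℂ} {p : ℝ}
    (hu : ∀ (x : ℝ), ∀ y₂ ∈ Ioo (-2 : ℝ) 2, u ((x + p : ℝ) : ℂ) y₂ = u x y₂)
    (x : ℝ) (h2 : y₂ ∈ Ioo (-2 : ℝ) 2) (hz : z ∈ Omega0) :
    diff2 u ((x + p : ℝ) : ℂ) y₂ z = diff2 u x y₂ z := by
  rw [diff2, diff2, ← Complex.ofReal_sub, ← Complex.ofReal_sub, hu _ _ h2,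
    show x + p - z.1 = x - z.1 + p by ring, hu _ _ hz.2]

lemma Interface.differentiableAt_real (h : Interface c ρ₀ g) (x : ℝ) : DifferentiableAt ℂ g x :=
  h.hol.differentiableAt ((isOpen_strip ρ₀).mem_nhds (ofReal_mem_strip h.pos x))

lemma Interface.real_s0 (h : Interface c ρ₀ g) (x : ℝ) : (s0 g x).im = 0 := by
  refine im_mul_eq_zero (by simp) (im_setIntegral_eq_zero measurableSet_Ico fun z _ =>
    im_mul_eq_zero (im_K2_eq_zero _ (im_diff1_eq_zero h.real _ _))
      (im_diff1_eq_zero (im_deriv_eq_zero h.real) _ _))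

lemma Interface.periodic_s0 (h : Interface c ρ₀ g) (x : ℝ) :
    s0 g ((x + 2 * Real.pi : ℝ) : ℂ) = s0 g x := by
  simp only [s0, diff1_add_period h.periodic,
    diff1_add_period (deriv_add_eq_of_real h.periodic h.differentiableAt_real)]

lemma Interface.realPer_fFun (h : Interface c ρ₀ g) (hη : RealPer η) :
    RealPer (fFun g α t η) where
  real x b hb := by
    have e : ∀ r : ℝ, (1 / 2 * (r : ℂ)).im = 0 := fun r => im_mul_eq_zero (by simp) (by simp)
    rw [fFun, Complex.add_im, Complex.add_im, h.real, im_mul_eq_zero (Complex.ofReal_im t)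
      (h.real_s0 x), im_mul_eq_zero (e _) (hη.real x b hb)]
    simp
  periodic x b hb := by rw [fFun, fFun, h.periodic, h.periodic_s0, hη.periodic x b hb]

lemma realPer_F (h : Interface c ρ₀ g) (hη : Reg ρ η K) (hη' : RealPer η)
    (hρ0 : 0 < ρ) : RealPer (F g α t η) := by
  have hf := h.realPer_fFun (α := α) (t := t) hη'
  have hX : RealPer (X2 g α t η) := ⟨fun x b hb => by
    rw [X2, Complex.add_im, hf.real x b hb, im_mul_eq_zero (by simp) (by simp), add_zero],
    fun x b hb => by rw [X2, X2, hf.periodic x b hb]⟩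
  have hdf : ∀ b ∈ Ioo (-2 : ℝ) 2, ∀ x : ℝ, DifferentiableAt ℂ (fun w => fFun g α t η w b) x := by
    intro b hb x
    have a1 := h.differentiableAt_real x
    have a2 := h.hol_s0.differentiableAt ((isOpen_strip ρ₀).mem_nhds (ofReal_mem_strip h.pos x))
    have a3 := (hη.hasDerivAt1 (ofReal_mem_strip hρ0 x) hb).differentiableAt
    unfold fFun
    fun_prop
  refine ⟨fun x b hb => ?_, fun x b hb => ?_⟩
  · unfold F
    split_ifs
    · rw [Complex.neg_im, neg_eq_zero]
      refine im_setIntegral_eq_zero measurableSet_Omega0 fun z hz => ?_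
      rw [integrand, Complex.sub_im, im_mul_eq_zero (im_K2_eq_zero _ (im_diff2_eq_zero hX.real x hb hz))
        (im_diff2_eq_zero (fun x b hb => im_deriv_eq_zero (fun x => hf.real x b hb) x) x hb hz),
        im_mul_eq_zero (im_K2_eq_zero _ (im_diff1_eq_zero h.real _ _))
        (im_diff1_eq_zero (im_deriv_eq_zero h.real) _ _), sub_zero]
    · rfl
  · unfold F
    split_ifs
    · congr 1
      refine setIntegral_congr_fun measurableSet_Omega0 fun z hz => ?_
      simp only [integrand]
      rw [diff2_add_period hX.periodic x hb hz, diff2_add_period (u := dy1 (fFun g α t η))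
        (fun x b hb => deriv_add_eq_of_real (h := fun w => fFun g α t η w b)
          (fun x => hf.periodic x b hb) (hdf b hb) x) x hb hz,
        diff1_add_period h.periodic,
        diff1_add_period (deriv_add_eq_of_real h.periodic h.differentiableAt_real)]
    · rfl

/-! ### Continuity in time -/

/-- `s ↦ F_s(η_s)(y)` is continuous at positive times. -/
lemma continuousWithinAt_F {J : Set ℝ} {η : ℝ → ℂ → ℝ → ℂ} (h : Interface c ρ₀ g) (hρ : ρ ≤ ρ₀)
    (hreg : ∀ s ∈ J, Reg ρ (η s) 1)
    (hJ : ∀ s ∈ J, 0 < s → SmallTime c s ∧ s ^ α * 1 ≤ 1 / (8 * c))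
    (hc0 : ∀ a ∈ strip ρ, ∀ b ∈ Ioo (-2 : ℝ) 2, ContinuousWithinAt (fun s => η s a b) J t)
    (hc1 : ∀ a ∈ strip ρ, ∀ b ∈ Ioo (-2 : ℝ) 2, ContinuousWithinAt (fun s => dy1 (η s) a b) J t)
    (htJ : t ∈ J) (ht : 0 < t) (h1 : y₁ ∈ strip ρ) (h2 : y₂ ∈ Ioo (-2 : ℝ) 2) :
    ContinuousWithinAt (fun s => F g α s (η s) y₁ y₂) J t := by
  have hev : ∀ᶠ s in 𝓝[J] t, s ∈ J ∧ t / 2 < s ∧ s < 2 * t := by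
    filter_upwards [self_mem_nhdsWithin, mem_nhdsWithin_of_mem_nhds
      (Ioo_mem_nhds (show t / 2 < t by linarith) (show t < 2 * t by linarith))] with s hs hs'
    exact ⟨hs, hs'⟩
  have hC := h.constF_nonneg
  have key : Tendsto (fun s => ∫ z in Omega0, integrandI g α s (η s) y₁ y₂ z) (𝓝[J] t)
      (𝓝 (∫ z in Omega0, integrandI g α t (η t) y₁ y₂ z)) := by
    refine tendsto_integral_filter_of_dominated_convergence
      -- For `t/2 < s < 2t` the numerator of `maj` is at most `2t = 4 · (t/2)` and the denominator
      -- is at least the one at time `t/2`.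
      (fun z => constF c (constS c) * (4 * maj (t / 2) y₂ z))
      (hev.mono fun s hs => aestronglyMeasurable_integrandI h (hreg s hs.1) hρ h1)
      (hev.mono fun s hs => (ae_restrict_mem measurableSet_Omega0).mono fun z hz => ?_)
      (((integrableOn_maj (by linarith) h2).const_mul 4).const_mul _)
      ((ae_restrict_mem measurableSet_Omega0).mono fun z hz => ?_)
    · have hs0 : 0 < s := by linarith [hs.2.1]
      refine (norm_integrandI_le h (hreg s hs.1) hρ (hJ s hs.1 hs0).1 (hJ s hs.1 hs0).2 h1 h2
        hz).trans ?_
      gcongr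
      unfold maj
      -- On `z₁ = 0` the time cancels from `maj`; if moreover `z₂ = y₂`, both sides are zero by the
      -- convention on division.
      rcases (abs_nonneg z.1).eq_or_lt' with h0 | h0
      · rcases (abs_nonneg (y₂ - z.2)).eq_or_lt' with h0' | h0'
        · simp [h0, h0']
        · rw [h0, zero_add, zero_add, div_mul_cancel_left₀ hs0.ne',
            div_mul_cancel_left₀ (by positivity)]
          have : 0 < |y₂ - z.2|⁻¹ := by positivity
          linarith
      · rw [← mul_div_assoc]
        gcongr <;> linarith [hs.2.1, hs.2.2]
    · have hcfg := h.config ht (hJ t htJ ht).1.le (hJ t htJ ht).1.mul_le (strip_mono hρ h1) h2 hz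
      have he := norm_e_le (c := c) (hreg t htJ) ht (hJ t htJ ht).2 h1 h2 hz
      have hK := (hcfg.hasDerivAt_K2_arg he).continuousAt
      have cs : ContinuousWithinAt (fun s : ℝ => (s : ℂ)) J t :=
        Complex.continuous_ofReal.continuousWithinAt
      have cp : ContinuousWithinAt (fun s : ℝ => ((s ^ α : ℝ) : ℂ)) J t :=
        (Complex.continuous_ofReal.continuousAt.comp
          (Real.continuousAt_rpow_const t α (Or.inl ht.ne'))).continuousWithinAt
      have ce : ContinuousWithinAt (fun s : ℝ => ((s ^ α : ℝ) : ℂ) * diff2 (η s) y₁ y₂ z) J t :=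
        cp.mul ((hc0 _ h1 _ h2).sub (hc0 _ (sub_ofReal_mem_strip h1 _) _ hz.2))
      have ce' : ContinuousWithinAt
          (fun s : ℝ => ((s ^ α : ℝ) : ℂ) * diff2 (dy1 (η s)) y₁ y₂ z) J t :=
        cp.mul ((hc1 _ h1 _ h2).sub (hc1 _ (sub_ofReal_mem_strip h1 _) _ hz.2))
      have ca : ContinuousWithinAt (fun s : ℝ => arg s (y₂ - z.2) (diff1 g y₁ z.1)
          (diff1 (s0 g) y₁ z.1) (((s ^ α : ℝ) : ℂ) * diff2 (η s) y₁ y₂ z)) J t := by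
        simp only [arg, Complex.ofReal_mul]
        exact ((cs.mul continuousWithinAt_const).add continuousWithinAt_const).add
          ((cs.mul continuousWithinAt_const).add ((continuousWithinAt_const.mul cs).mul ce))
      have cK := ContinuousAt.comp_continuousWithinAt (g := K2 z.1)
        (f := fun s : ℝ => arg s (y₂ - z.2) (diff1 g y₁ z.1)
          (diff1 (s0 g) y₁ z.1) (((s ^ α : ℝ) : ℂ) * diff2 (η s) y₁ y₂ z)) hK ca
      exact (cK.mul ((continuousWithinAt_const.add (cs.mul continuousWithinAt_const)).add
        ((continuousWithinAt_const.mul cs).mul ce'))).sub continuousWithinAt_const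
  have := key.neg
  rw [ContinuousWithinAt, F_eq h (hreg t htJ) hρ ht h1 h2]
  refine this.congr' (hev.mono fun s hs => ?_)
  exact (F_eq h (hreg s hs.1) hρ (by linarith [hs.2.1]) h1 h2).symm

end


/-! ### The weight `t^(1-α) |log t|` -/

/-- The weight `t^(1-α) |log t|` which measures the loss of analyticity. -/
def phi (α t : ℝ) : ℝ := t ^ (1 - α) * |Real.log t|

lemma phi_zero (α : ℝ) : phi α 0 = 0 := by simp [phi]

lemma phi_nonneg (α : ℝ) {t : ℝ} (ht : 0 ≤ t) : 0 ≤ phi α t := by unfold phi; positivity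

lemma phi_pos (α : ℝ) {t : ℝ} (ht : 0 < t) (ht4 : t ≤ 1 / 4) : 0 < phi α t := by
  have := one_lt_abs_log ht ht4
  have : 0 < |Real.log t| := by linarith
  unfold phi; positivity

lemma continuousWithinAt_phi {α : ℝ} (hα : α < 1) {t : ℝ} (ht : 0 ≤ t) :
    ContinuousWithinAt (phi α) (Ici 0) t := by
  rcases ht.eq_or_lt with rfl | ht
  · rw [← continuousWithinAt_Ioi_iff_Ici, ContinuousWithinAt, phi_zero]
    have := (tendsto_log_mul_rpow_nhdsGT_zero (sub_pos.2 hα)).abs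
    rw [abs_zero] at this
    refine this.congr' ?_
    filter_upwards [self_mem_nhdsWithin] with x hx
    rw [phi, abs_mul, abs_of_nonneg (Real.rpow_nonneg (le_of_lt hx) _), mul_comm]
  · exact ((Real.continuousAt_rpow_const _ _ (Or.inl ht.ne')).mul
      (Real.continuousAt_log ht.ne').abs).continuousWithinAt

lemma hasDerivAt_phi {α x : ℝ} (hx : 0 < x) (hx1 : x < 1) :
    HasDerivAt (phi α) (x ^ (-α) * ((1 - α) * |Real.log x| - 1)) x := by
  have hl : ∀ y ∈ Ioo (0 : ℝ) 1, |Real.log y| = -Real.log y := fun y hy =>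
    abs_of_neg (Real.log_neg hy.1 hy.2)
  have h1 := (Real.hasDerivAt_rpow_const (x := x) (p := 1 - α) (Or.inl hx.ne')).mul
    (Real.hasDerivAt_log hx.ne').neg
  have h2 : HasDerivAt (phi α) _ x := h1.congr_of_eventuallyEq (by
    filter_upwards [isOpen_Ioo.mem_nhds ⟨hx, hx1⟩] with y hy
    simp [phi, hl y hy])
  convert h2 using 1
  rw [hl x ⟨hx, hx1⟩, show 1 - α - 1 = -α by ring, show (1 : ℝ) - α = -α + 1 by ring,
    Real.rpow_add_one hx.ne', Pi.neg_apply]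
  field_simp
  ring

lemma abs_log_anti {s t : ℝ} (hs : 0 < s) (hst : s ≤ t) (ht : t ≤ 1) :
    |Real.log t| ≤ |Real.log s| := by
  rw [abs_of_nonpos (Real.log_nonpos hs.le (hst.trans ht)),
    abs_of_nonpos (Real.log_nonpos (hs.le.trans hst) ht)]
  exact neg_le_neg (Real.log_le_log hs hst)

/-- Lower bound of the slope of the weight. -/
lemma phi_slope {α T s t : ℝ} (h0 : 0 < α) (h1 : α < 1) (hT : T < 1)
    (hlog : 2 / (1 - α) ≤ |Real.log T|) (hs : 0 ≤ s) (hst : s ≤ t) (htT : t ≤ T) :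
    (1 - α) / 2 * T ^ (-α) * |Real.log t| * (t - s) ≤ phi α t - phi α s := by
  rcases hst.eq_or_lt with rfl | hlt
  · simp
  have ht : 0 < t := hs.trans_lt hlt
  have hd : ∀ x ∈ Ioo s t, HasDerivAt (phi α) (x ^ (-α) * ((1 - α) * |Real.log x| - 1)) x :=
    fun x hx => hasDerivAt_phi (hs.trans_lt hx.1) (hx.2.trans_le (htT.trans hT.le))
  refine Convex.mul_sub_le_image_sub_of_le_deriv (convex_Icc s t)
    (fun x hx => (continuousWithinAt_phi h1 (hs.trans hx.1)).mono fun y hy => hs.trans hy.1)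
    (fun x hx => ?_) (fun x hx => ?_) s (left_mem_Icc.2 hst) t (right_mem_Icc.2 hst) hst
  · rw [interior_Icc] at hx
    exact (hd x hx).differentiableAt.differentiableWithinAt
  · rw [interior_Icc] at hx
    have hx0 : 0 < x := hs.trans_lt hx.1
    have hxT : x ≤ T := hx.2.le.trans htT
    rw [(hd x hx).deriv]
    have l1 := abs_log_anti hx0 hx.2.le (htT.trans hT.le)
    have l2 := abs_log_anti hx0 hxT hT.le
    -- The smallness of `T` absorbs the `-1` in the derivative of `phi` into half of its logarithmic
    -- term.
    have l3 : 1 ≤ (1 - α) / 2 * |Real.log x| := by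
      rw [div_le_iff₀ (by linarith)] at hlog
      nlinarith
    have l4 : (1 - α) / 2 * |Real.log t| ≤ (1 - α) * |Real.log x| - 1 := by
      have := mul_le_mul_of_nonneg_left l1 (show 0 ≤ (1 - α) / 2 by linarith)
      linarith
    have l5 : T ^ (-α) ≤ x ^ (-α) := Real.rpow_le_rpow_of_nonpos hx0 hxT (by linarith)
    have l6 : 0 ≤ (1 - α) / 2 * |Real.log t| :=
      mul_nonneg (by linarith) (abs_nonneg _)
    calc _ = T ^ (-α) * ((1 - α) / 2 * |Real.log t|) := by ring
      _ ≤ _ := mul_le_mul l5 l4 l6 (by positivity)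

lemma integrableOn_inv_sq {k D t : ℝ} (hk : 0 < k) (hD : 0 < D) :
    IntegrableOn (fun s => 1 / (k * (t - s) + D) ^ 2) (Ioc 0 t) := by
  refine (ContinuousOn.integrableOn_Icc fun s hs => ?_).mono_set Ioc_subset_Icc_self
  have : 0 ≤ k * (t - s) := mul_nonneg hk.le (by linarith [hs.2])
  have h0 : (k * (t - s) + D) ^ 2 ≠ 0 := by positivity
  have hc : Continuous fun s => (k * (t - s) + D) ^ 2 := by fun_prop
  exact (continuousAt_const.div hc.continuousAt h0).continuousWithinAt

/-- One power of the singular weight is regained by integration in time, together with `1/k`: this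
is the gain that balances the loss of a derivative. -/
lemma integral_inv_sq_le {k D t : ℝ} (hk : 0 < k) (hD : 0 < D) (ht : 0 ≤ t) :
    ∫ s in Ioc 0 t, 1 / (k * (t - s) + D) ^ 2 ≤ 1 / (k * D) := by
  have hpos : ∀ s ∈ Icc 0 t, 0 < k * (t - s) + D := fun s hs => by
    have : 0 ≤ k * (t - s) := mul_nonneg hk.le (by linarith [hs.2])
    linarith
  have hd : ∀ s ∈ uIcc 0 t, HasDerivAt (fun s => 1 / k * (k * (t - s) + D)⁻¹)
      (1 / (k * (t - s) + D) ^ 2) s := fun s hs => by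
    rw [uIcc_of_le ht] at hs
    have h1 : HasDerivAt (fun s => k * (t - s) + D) (k * (-1)) s :=
      (((hasDerivAt_id s).const_sub t).const_mul k).add_const D
    refine ((h1.inv (hpos s hs).ne').const_mul (1 / k)).congr_deriv ?_
    have h3 := hk.ne'
    field_simp
  have hi := (intervalIntegrable_iff_integrableOn_Ioc_of_le ht).2
    (integrableOn_inv_sq (t := t) hk hD)
  rw [← intervalIntegral.integral_of_le ht, intervalIntegral.integral_eq_sub_of_hasDerivAt hd hi]
  have := hpos 0 (left_mem_Icc.2 ht)
  rw [sub_self, mul_zero, zero_add]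
  have e : 1 / k * D⁻¹ = 1 / (k * D) := by field_simp
  rw [e]
  have : 0 ≤ 1 / k * (k * (t - 0) + D)⁻¹ := by positivity
  linarith

/-! ### Admissible families -/

/-- The times for which a solution is sought in `B_ρ`. -/
def times (ρ₀ α T lam ρ : ℝ) : Set ℝ := {t | t ∈ Ico 0 T ∧ lam * phi α t < ρ₀ - ρ}

/-- The standing assumptions on the data and the final time. -/
structure Setup (c ρ₀ α T : ℝ) (g : ℂ → ℂ) : Prop where
  iface : Interface c ρ₀ g
  α_pos : 0 < α
  α_lt : α < 1
  T_pos : 0 < T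
  T_le : T ≤ 1 / 4
  T_mul_le : T * constS c ≤ 1 / 16
  T_rpow : T ^ α * 2 < 1 / (16 * c)
  T_log : 2 / (1 - α) ≤ |Real.log T|

/-- The widths of the strips in the iteration. -/
def widths (ρ₀ : ℝ) : Set ℝ := Ioo (max 0 (ρ₀ - 1)) ρ₀

/-- Families of functions in the unit ball, continuous in time. -/
structure Adm (ρ₀ α T lam : ℝ) (η : ℝ → ℂ → ℝ → ℂ) : Prop where
  realPer : ∀ ρ ∈ widths ρ₀, ∀ t ∈ times ρ₀ α T lam ρ, RealPer (η t)
  reg : ∀ ρ ∈ widths ρ₀, ∀ t ∈ times ρ₀ α T lam ρ, Reg ρ (η t) 1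
  cont : ∀ ρ ∈ widths ρ₀, ∀ t ∈ times ρ₀ α T lam ρ, ∀ ε > 0,
    ∀ᶠ s in 𝓝[times ρ₀ α T lam ρ] t, Reg ρ (η s - η t) ε

/-- Two families are close with a weight which is singular at the boundary of the domain. -/
def Close (ρ₀ α T lam M : ℝ) (η ζ : ℝ → ℂ → ℝ → ℂ) : Prop :=
  ∀ ρ ∈ widths ρ₀, ∀ t ∈ times ρ₀ α T lam ρ, 0 < t →
    Reg ρ (η t - ζ t) (M * phi α t / (ρ₀ - lam * phi α t - ρ))

/-- The map `η ↦ (t ↦ t^{-(1+α)} ∫₀ᵗ F_s(η_s) ds)`. -/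
def Phi (g : ℂ → ℂ) (α : ℝ) (η : ℝ → ℂ → ℝ → ℂ) (t : ℝ) (y₁ : ℂ) (y₂ : ℝ) : ℂ :=
  1 / ((t ^ (1 + α) : ℝ) : ℂ) * ∫ s in (0 : ℝ)..t, F g α s (η s) y₁ y₂

section

variable {c ρ₀ α T lam ρ s t : ℝ} {g : ℂ → ℂ} {η ζ : ℝ → ℂ → ℝ → ℂ}

namespace Setup

lemma smallTime (h : Setup c ρ₀ α T g) (hs : 0 < s) (hsT : s ≤ T) : SmallTime c s := by
  have := h.iface.one_le_constS
  exact ⟨hs, hsT.trans h.T_le, le_trans (by gcongr) h.T_mul_le⟩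

lemma rpow_lt (h : Setup c ρ₀ α T g) (hs : 0 < s) (hsT : s ≤ T) : s ^ α * 2 < 1 / (16 * c) := by
  refine lt_of_le_of_lt ?_ h.T_rpow
  have := h.α_pos
  gcongr

lemma rpow_le (h : Setup c ρ₀ α T g) (hs : 0 < s) (hsT : s ≤ T) : s ^ α * 1 ≤ 1 / (8 * c) := by
  have h1 := h.rpow_lt hs hsT
  have hc := h.iface.one_le
  have : 1 / (16 * c) ≤ 1 / (8 * c) := by gcongr; norm_num
  have := Real.rpow_pos_of_pos hs α
  linarith

lemma slope (h : Setup c ρ₀ α T g) (hs : 0 ≤ s) (hst : s ≤ t) (htT : t ≤ T) :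
    (1 - α) / 2 * T ^ (-α) * |Real.log t| * (t - s) ≤ phi α t - phi α s :=
  phi_slope h.α_pos h.α_lt (by linarith [h.T_le]) h.T_log hs hst htT

lemma phi_mono (h : Setup c ρ₀ α T g) (hs : 0 ≤ s) (hst : s ≤ t) (htT : t ≤ T) :
    phi α s ≤ phi α t := by
  have := h.slope hs hst htT
  have h1 := h.α_lt
  have h2 := h.T_pos
  have : 0 ≤ (1 - α) / 2 * T ^ (-α) * |Real.log t| * (t - s) :=
    mul_nonneg (mul_nonneg (mul_nonneg (by linarith) (by positivity)) (abs_nonneg _)) (by linarith)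
  linarith

lemma mul_log_eq (α : ℝ) (hs : 0 < s) : s * |Real.log s| = s ^ α * phi α s := by
  rw [phi, ← mul_assoc, ← Real.rpow_add hs]
  simp

lemma mul_log_mono (h : Setup c ρ₀ α T g) (hs : 0 < s) (hst : s ≤ t) (htT : t ≤ T) :
    s * |Real.log s| ≤ t * |Real.log t| := by
  rw [mul_log_eq α hs, mul_log_eq α (hs.trans_le hst)]
  have := h.α_pos
  have h1 := h.phi_mono hs.le hst htT
  have := phi_nonneg α hs.le
  have := hs.trans_le hst
  gcongr

lemma mem_times_of_le (h : Setup c ρ₀ α T g) (hl : 0 ≤ lam) (ht : t ∈ times ρ₀ α T lam ρ)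
    (hs : 0 ≤ s) (hst : s ≤ t) : s ∈ times ρ₀ α T lam ρ := by
  refine ⟨⟨hs, hst.trans_lt ht.1.2⟩, lt_of_le_of_lt ?_ ht.2⟩
  have := h.phi_mono hs hst ht.1.2.le
  gcongr

end Setup

/-- The width lost at time `s` is chosen as half of what is available, so that the larger width `ρ +
d` is still admissible and has `d` to spare. Restricting to widths within one of `ρ₀` ensures `d ≤
1`. -/
lemma widths_half {d : ℝ} (hl : 0 ≤ lam) (hρ : ρ ∈ widths ρ₀) (hs : s ∈ times ρ₀ α T lam ρ)
    (hd : d = (ρ₀ - lam * phi α s - ρ) / 2) :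
    0 < d ∧ d ≤ 1 ∧ ρ + d ∈ widths ρ₀ ∧ s ∈ times ρ₀ α T lam (ρ + d) := by
  have h1 := hs.2
  have h2 := mul_nonneg hl (phi_nonneg α hs.1.1)
  have h3 : ρ₀ - 1 < ρ := (le_max_right _ _).trans_lt hρ.1
  have hd0 : 0 < d := by linarith
  exact ⟨hd0, by linarith, ⟨hρ.1.trans (by linarith), by linarith⟩, hs.1, by linarith⟩

lemma widths_pos (hρ : ρ ∈ widths ρ₀) : 0 < ρ := (le_max_left _ _).trans_lt hρ.1

lemma Adm.continuousWithinAt (hη : Adm ρ₀ α T lam η) (hρ : ρ ∈ widths ρ₀)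
    (ht : t ∈ times ρ₀ α T lam ρ) {a : ℂ} (ha : a ∈ strip ρ) {b : ℝ} (hb : b ∈ Ioo (-2 : ℝ) 2) :
    ContinuousWithinAt (fun s => η s a b) (times ρ₀ α T lam ρ) t := by
  rw [Metric.continuousWithinAt_iff']
  intro ε hε
  filter_upwards [hη.cont ρ hρ t ht (ε / 2) (by positivity)] with s hs
  rw [dist_eq_norm]
  exact (hs.bd a ha b hb).trans_lt (by linarith)

lemma Adm.continuousWithinAt_dy1 (hη : Adm ρ₀ α T lam η) (hρ : ρ ∈ widths ρ₀)
    (ht : t ∈ times ρ₀ α T lam ρ) {a : ℂ} (ha : a ∈ strip ρ) {b : ℝ} (hb : b ∈ Ioo (-2 : ℝ) 2) :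
    ContinuousWithinAt (fun s => dy1 (η s) a b) (times ρ₀ α T lam ρ) t := by
  rw [Metric.continuousWithinAt_iff']
  intro ε hε
  filter_upwards [hη.cont ρ hρ t ht (ε / 2) (by positivity), self_mem_nhdsWithin] with s hs hs'
  rw [dist_eq_norm, ← (hη.reg ρ hρ s hs').dy1_sub (hη.reg ρ hρ t ht) ha hb]
  exact (hs.bd1 a ha b hb).trans_lt (by linarith)

namespace Setup

lemma continuousOn_F (h : Setup c ρ₀ α T g) (hη : Adm ρ₀ α T lam η) (hρ : ρ ∈ widths ρ₀)
    {a : ℂ} (ha : a ∈ strip ρ) {b : ℝ} (hb : b ∈ Ioo (-2 : ℝ) 2) :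
    ContinuousOn (fun s => F g α s (η s) a b) (times ρ₀ α T lam ρ ∩ Ioi 0) := fun _ ht =>
  (continuousWithinAt_F h.iface hρ.2.le (hη.reg ρ hρ)
    (fun _ hs hs0 => ⟨h.smallTime hs0 hs.1.2.le, h.rpow_le hs0 hs.1.2.le⟩)
    (fun _ ha _ hb => hη.continuousWithinAt hρ ht.1 ha hb)
    (fun _ ha _ hb => hη.continuousWithinAt_dy1 hρ ht.1 ha hb) ht.1 ht.2 ha hb).mono
      inter_subset_left

lemma constCF_nonneg (h : Setup c ρ₀ α T g) : 0 ≤ constCF c := by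
  have := h.iface.constF_nonneg
  have := h.iface.constF2_nonneg
  unfold constCF; positivity

/-- `reg_F` from width `ρ + d` to `ρ`, where `d` is half of the available width. -/
lemma reg_F_time (h : Setup c ρ₀ α T g) (hl : 0 ≤ lam) (hη : Adm ρ₀ α T lam η)
    (hρ : ρ ∈ widths ρ₀) (hs : s ∈ times ρ₀ α T lam ρ) (hs0 : 0 < s) :
    Reg ρ (F g α s (η s)) (2 * constCF c * (s * |Real.log s|) / (ρ₀ - lam * phi α s - ρ)) := by
  obtain ⟨d, hd⟩ : ∃ d, d = (ρ₀ - lam * phi α s - ρ) / 2 := ⟨_, rfl⟩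
  obtain ⟨hd0, hd1, hρd, hsd⟩ := widths_half hl hρ hs hd
  have := reg_F h.iface (hη.reg _ hρd s hsd) hρd.2.le (h.smallTime hs0 hs.1.2.le)
    (h.rpow_le hs0 hs.1.2.le) hd0 hd1
  rw [add_sub_cancel_right] at this
  convert this using 1
  rw [show ρ₀ - lam * phi α s - ρ = 2 * d by linarith]
  field_simp

/-- Both `s|log s|` and `phi` increase on `[0, T]`, so the bound at time `t` serves all earlier
times. This suffices for integrability and for the size of `Phi`; the contraction needs the finer
dependence on `s`. -/
lemma reg_F_of_le (h : Setup c ρ₀ α T g) (hl : 0 ≤ lam) (hη : Adm ρ₀ α T lam η)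
    (hρ : ρ ∈ widths ρ₀) (ht : t ∈ times ρ₀ α T lam ρ) (hs0 : 0 < s) (hst : s ≤ t) :
    Reg ρ (F g α s (η s)) (2 * constCF c * (t * |Real.log t|) / (ρ₀ - lam * phi α t - ρ)) := by
  refine (h.reg_F_time hl hη hρ (h.mem_times_of_le hl ht hs0.le hst) hs0).mono ?_
  have h1 := h.phi_mono hs0.le hst ht.1.2.le
  have h2 := h.mul_log_mono hs0 hst ht.1.2.le
  have h3 := h.constCF_nonneg
  have h4 : 0 < ρ₀ - lam * phi α t - ρ := by linarith [ht.2]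
  have h5 : 0 < t := hs0.trans_le hst
  gcongr

lemma aestronglyMeasurable_F (h : Setup c ρ₀ α T g) (hl : 0 ≤ lam) (hη : Adm ρ₀ α T lam η)
    (hρ : ρ ∈ widths ρ₀) (ht : t ∈ times ρ₀ α T lam ρ) {p q : ℝ} (hp : 0 ≤ p) (hq : q ≤ t)
    {a : ℂ} (ha : a ∈ strip ρ) {b : ℝ} (hb : b ∈ Ioo (-2 : ℝ) 2) :
    AEStronglyMeasurable (fun s => F g α s (η s) a b) (volume.restrict (Ioc p q)) :=
  ((h.continuousOn_F hη hρ ha hb).mono fun _ hs =>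
    ⟨h.mem_times_of_le hl ht (hp.trans hs.1.le) (hs.2.trans hq), hp.trans_lt hs.1⟩).aestronglyMeasurable
      measurableSet_Ioc

lemma intervalIntegrable_F (h : Setup c ρ₀ α T g) (hl : 0 ≤ lam) (hη : Adm ρ₀ α T lam η)
    (hρ : ρ ∈ widths ρ₀) (ht : t ∈ times ρ₀ α T lam ρ) {p q : ℝ} (hp : 0 ≤ p) (hpq : p ≤ q)
    (hq : q ≤ t) {a : ℂ} (ha : a ∈ strip ρ) {b : ℝ} (hb : b ∈ Ioo (-2 : ℝ) 2) :
    IntervalIntegrable (fun s => F g α s (η s) a b) volume p q := by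
  rw [intervalIntegrable_iff_integrableOn_Ioc_of_le hpq]
  exact Integrable.mono' (integrableOn_const (by simp)) (h.aestronglyMeasurable_F hl hη hρ ht hp hq ha hb)
    ((ae_restrict_mem measurableSet_Ioc).mono fun s hs =>
      (h.reg_F_of_le hl hη hρ ht (hp.trans_lt hs.1) (hs.2.trans hq)).bd a ha b hb)

lemma reg_integral_F (h : Setup c ρ₀ α T g) (hl : 0 ≤ lam) (hη : Adm ρ₀ α T lam η)
    (hρ : ρ ∈ widths ρ₀) (ht : t ∈ times ρ₀ α T lam ρ) {p q : ℝ} (hp : 0 ≤ p) (hpq : p ≤ q)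
    (hq : q ≤ t) : Reg ρ (fun y₁ y₂ => ∫ s in p..q, F g α s (η s) y₁ y₂)
      ((q - p) * (2 * constCF c * (t * |Real.log t|) / (ρ₀ - lam * phi α t - ρ))) := by
  have := Reg.integral (μ := volume.restrict (Ioc p q)) (u := fun s => F g α s (η s))
    (B := fun _ => 2 * constCF c * (t * |Real.log t|) / (ρ₀ - lam * phi α t - ρ))
    (integrableOn_const (by simp)) ((ae_restrict_mem measurableSet_Ioc).mono fun s hs =>
      h.reg_F_of_le hl hη hρ ht (hp.trans_lt hs.1) (hs.2.trans hq))
    (fun a ha b hb => h.aestronglyMeasurable_F hl hη hρ ht hp hq ha hb)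
  rw [setIntegral_const, measureReal_def, Real.volume_Ioc, ENNReal.toReal_ofReal (by linarith),
    smul_eq_mul] at this
  simpa only [intervalIntegral.integral_of_le hpq] using this

lemma norm_inv_rpow (ht : 0 < t) (p : ℝ) : ‖(1 / ((t ^ p : ℝ) : ℂ))‖ = 1 / t ^ p := by
  rw [norm_div, norm_one, Complex.norm_real, Real.norm_of_nonneg (by positivity)]

/-- The weight is exactly what remains of `t^{-(1+α)} ∫₀ᵗ` applied to the bound `t|log t|`. -/
lemma phi_eq (α : ℝ) (ht : 0 < t) : phi α t = 1 / t ^ (1 + α) * (t * (t * |Real.log t|)) := by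
  have h1 : t ^ (1 - α) * t ^ (1 + α) = t * t := by
    rw [← Real.rpow_add ht, show (1 - α) + (1 + α) = (2 : ℕ) by push_cast; ring,
      Real.rpow_natCast]; ring
  have : t ^ (1 + α) ≠ 0 := by positivity
  rw [phi]
  field_simp
  linear_combination |Real.log t| * h1

/-- The size of `Phi η`. -/
lemma reg_Phi (h : Setup c ρ₀ α T g) (hl : 0 ≤ lam) (hη : Adm ρ₀ α T lam η)
    (hρ : ρ ∈ widths ρ₀) (ht : t ∈ times ρ₀ α T lam ρ) (ht0 : 0 < t) :
    Reg ρ (Phi g α η t) (2 * constCF c * phi α t / (ρ₀ - lam * phi α t - ρ)) := by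
  have := (h.reg_integral_F hl hη hρ ht le_rfl ht0.le le_rfl).const_mul
    (1 / ((t ^ (1 + α) : ℝ) : ℂ))
  rw [norm_inv_rpow ht0] at this
  refine this.mono (le_of_eq ?_)
  generalize ρ₀ - lam * phi α t - ρ = D
  rw [phi_eq α ht0, sub_zero]
  ring

lemma Phi_zero (hα : 0 < α) : Phi g α η 0 = fun _ _ => 0 := by
  have : (1 : ℝ) + α ≠ 0 := by linarith
  funext a b
  simp [Phi, Real.zero_rpow this]

end Setup

end


/-! ### Mapping properties of `Phi` -/

section

variable {c ρ₀ α T lam M ρ s t : ℝ} {g : ℂ → ℂ} {η ζ : ℝ → ℂ → ℝ → ℂ}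

lemma Reg.min {K K' : ℝ} {u : ℂ → ℝ → ℂ} (h : Reg ρ u K) (h' : Reg ρ u K') :
    Reg ρ u (min K K') := by
  rcases min_choice K K' with e | e <;> rwa [e]

namespace Setup

/-- Half of the available width is spent twice: once to evaluate the distance of `η` and `ζ` at the
larger width, once in the derivative loss of `F`. Hence the square in the denominator, and `128 = 32
· 4`. -/
lemma reg_F_sub_time (h : Setup c ρ₀ α T g) (hl : 0 ≤ lam) (hη : Adm ρ₀ α T lam η)
    (hζ : Adm ρ₀ α T lam ζ) (hM : 0 < M) (hc : Close ρ₀ α T lam M η ζ)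
    (hρ : ρ ∈ widths ρ₀) (hs : s ∈ times ρ₀ α T lam ρ) (hs0 : 0 < s) :
    Reg ρ (F g α s (η s) - F g α s (ζ s))
      (128 * c * constCF c * M * (s ^ α * (s * |Real.log s|) * phi α s) /
        (ρ₀ - lam * phi α s - ρ) ^ 2) := by
  obtain ⟨d, hd⟩ : ∃ d, d = (ρ₀ - lam * phi α s - ρ) / 2 := ⟨_, rfl⟩
  obtain ⟨hd0, hd1, hρd, hsd⟩ := widths_half hl hρ hs hd
  have hφ := phi_pos α hs0 (hs.1.2.le.trans h.T_le)
  have hcc := h.iface.one_le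
  have hC := h.constCF_nonneg
  have r1 := hc _ hρd s hsd hs0
  rw [show ρ₀ - lam * phi α s - (ρ + d) = d by linarith] at r1
  have r2 : Reg (ρ + d) (η s - ζ s) 2 :=
    ((hη.reg _ hρd s hsd).sub (hζ.reg _ hρd s hsd)).mono (by norm_num)
  -- The weighted bound may exceed `2` near the boundary of the domain. The minimum with the trivial
  -- bound for two elements of the unit ball keeps the Schwarz argument available.
  have := reg_F_sub h.iface (hη.reg _ hρd s hsd) (hζ.reg _ hρd s hsd) (r1.min r2)
    (lt_min (by positivity) two_pos) (min_le_right _ _) hρd.2.le (h.smallTime hs0 hs.1.2.le)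
    (h.rpow_lt hs0 hs.1.2.le) hd0 hd1
  rw [add_sub_cancel_right] at this
  refine this.mono ?_
  rw [show ρ₀ - lam * phi α s - ρ = 2 * d by linarith]
  calc _ ≤ 32 * c * (s ^ α * (M * phi α s / d)) * constCF c * (s * |Real.log s|) / d := by
        gcongr; exact min_le_left _ _
    _ = _ := by field_simp; ring

/-- `Phi` contracts the weighted distance. -/
lemma close_Phi (h : Setup c ρ₀ α T g) (hl : 0 < lam)
    (hlam : 512 * c * constCF c ≤ lam * ((1 - α) / 2 * T ^ (-α)))
    (hη : Adm ρ₀ α T lam η) (hζ : Adm ρ₀ α T lam ζ) (hM : 0 < M)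
    (hc : Close ρ₀ α T lam M η ζ) : Close ρ₀ α T lam (M / 4) (Phi g α η) (Phi g α ζ) := by
  intro ρ hρ t ht ht0
  have hcc := h.iface.one_le
  have hC := h.constCF_nonneg
  have hα := h.α_lt
  have hT := h.T_pos
  have hα0 := h.α_pos
  have hlog : 0 < |Real.log t| := by
    have := one_lt_abs_log ht0 (ht.1.2.le.trans h.T_le); linarith
  have hφ := phi_pos α ht0 (ht.1.2.le.trans h.T_le)
  obtain ⟨D, hD⟩ : ∃ D, D = ρ₀ - lam * phi α t - ρ := ⟨_, rfl⟩
  obtain ⟨κ, hκ⟩ : ∃ κ, κ = lam * ((1 - α) / 2 * T ^ (-α)) := ⟨_, rfl⟩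
  have hκ0 : 0 < κ := by
    rw [hκ]; exact mul_pos hl (mul_pos (by linarith) (by positivity))
  have hD0 : 0 < D := by linarith [ht.2]
  obtain ⟨A, hA⟩ : ∃ A, A = 128 * c * constCF c * M * (t ^ α * (t * |Real.log t|) * phi α t) :=
    ⟨_, rfl⟩
  have hA0 : 0 ≤ A := by rw [hA]; positivity
  have hreg : ∀ s ∈ Ioc 0 t, Reg ρ (F g α s (η s) - F g α s (ζ s))
      (A * (1 / (κ * |Real.log t| * (t - s) + D) ^ 2)) := fun s hs => by
    refine (h.reg_F_sub_time hl.le hη hζ hM hc hρ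
      (h.mem_times_of_le hl.le ht hs.1.le hs.2) hs.1).mono ?_
    have hsl := mul_le_mul_of_nonneg_left (h.slope hs.1.le hs.2 ht.1.2.le) hl.le
    -- The width available at time `s` exceeds the one at time `t` by a multiple of `t - s`, by the
    -- slope bound of the weight.
    have h1 : κ * |Real.log t| * (t - s) + D ≤ ρ₀ - lam * phi α s - ρ := by
      rw [hκ, hD]; nlinarith [hsl]
    have h2 : 0 ≤ κ * |Real.log t| * (t - s) := mul_nonneg (by positivity) (by linarith [hs.2])
    have h3 := h.mul_log_mono hs.1 hs.2 ht.1.2.le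
    have h4 := h.phi_mono hs.1.le hs.2 ht.1.2.le
    have h5 := phi_nonneg α hs.1.le
    have h6 := hs.1
    have h7 := hs.2
    rw [mul_one_div, hA]
    gcongr
  have hint := integrableOn_inv_sq (t := t) (mul_pos hκ0 hlog) hD0
  have key := (Reg.integral (μ := volume.restrict (Ioc 0 t))
    (u := fun s => F g α s (η s) - F g α s (ζ s)) (hint.const_mul A)
    ((ae_restrict_mem measurableSet_Ioc).mono hreg)
    (fun a ha b hb => (h.aestronglyMeasurable_F hl.le hη hρ ht le_rfl le_rfl ha hb).sub
      (h.aestronglyMeasurable_F hl.le hζ hρ ht le_rfl le_rfl ha hb))).const_mul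
        (1 / ((t ^ (1 + α) : ℝ) : ℂ))
  rw [norm_inv_rpow ht0, integral_const_mul] at key
  refine (key.mono ?_).congr fun a ha b hb => ?_
  · have hI := integral_inv_sq_le (mul_pos hκ0 hlog) hD0 ht0.le
    rw [← hD]
    calc _ ≤ 1 / t ^ (1 + α) * (A * (1 / (κ * |Real.log t| * D))) := by gcongr
      _ = 128 * c * constCF c / κ * (M * phi α t / D) := by
          rw [hA, Real.rpow_add ht0, Real.rpow_one]
          field_simp
      -- The factor `κ` contains `T^{-α}`, so for a fixed speed `lam` a small `T` makes the ratio at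
      -- most `128/512`.
      _ ≤ 1 / 4 * (M * phi α t / D) := by
          refine mul_le_mul_of_nonneg_right ?_ (by positivity)
          rw [div_le_iff₀ hκ0, hκ]; linarith
      _ = _ := by ring
  · simp only [Pi.sub_apply, Phi]
    rw [integral_sub, ← intervalIntegral.integral_of_le ht0.le,
      ← intervalIntegral.integral_of_le ht0.le]
    · ring
    · exact (intervalIntegrable_iff_integrableOn_Ioc_of_le ht0.le).1
        (h.intervalIntegrable_F hl.le hη hρ ht le_rfl ht0.le le_rfl ha hb)
    · exact (intervalIntegrable_iff_integrableOn_Ioc_of_le ht0.le).1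
        (h.intervalIntegrable_F hl.le hζ hρ ht le_rfl ht0.le le_rfl ha hb)

lemma realPer_Phi (h : Setup c ρ₀ α T g) (hl : 0 ≤ lam) (hη : Adm ρ₀ α T lam η)
    (hρ : ρ ∈ widths ρ₀) (ht : t ∈ times ρ₀ α T lam ρ) : RealPer (Phi g α η t) := by
  have hF : ∀ s ∈ Ioc 0 t, RealPer (F g α s (η s)) := fun s hs =>
    have hs' := h.mem_times_of_le hl ht hs.1.le hs.2
    realPer_F h.iface (hη.reg ρ hρ s hs') (hη.realPer ρ hρ s hs') (widths_pos hρ)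
  refine ⟨fun x b hb => ?_, fun x b hb => ?_⟩
  · rw [Phi, intervalIntegral.integral_of_le ht.1.1]
    refine im_mul_eq_zero ?_ (im_setIntegral_eq_zero measurableSet_Ioc
      fun s hs => (hF s hs).real x b hb)
    rw [← Complex.ofReal_one, ← Complex.ofReal_div, Complex.ofReal_im]
  · simp only [Phi, intervalIntegral.integral_of_le ht.1.1]
    rw [setIntegral_congr_fun measurableSet_Ioc fun s hs => (hF s hs).periodic x b hb]

/-- Continuity of the time integral at `t` requires bounds for times slightly beyond `t`; the
defining conditions of the domain are open to the right. -/
lemma exists_gt_mem_times (h : Setup c ρ₀ α T g) (ht : t ∈ times ρ₀ α T lam ρ) (ht0 : 0 < t) :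
    ∃ t' ∈ times ρ₀ α T lam ρ, t < t' := by
  have hc : ContinuousAt (phi α) t :=
    (continuousWithinAt_phi h.α_lt ht0.le).continuousAt (Ici_mem_nhds ht0)
  have h1 : ∀ᶠ x in 𝓝[>] t, x ∈ times ρ₀ α T lam ρ ∧ t < x := by
    filter_upwards [self_mem_nhdsWithin, mem_nhdsWithin_of_mem_nhds (Iio_mem_nhds ht.1.2),
      nhdsWithin_le_nhds ((hc.const_mul lam).eventually_lt_const ht.2)] with x hx hxT hx'
    exact ⟨⟨⟨ht0.le.trans (le_of_lt hx), hxT⟩, hx'⟩, hx⟩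
  obtain ⟨x, hx⟩ := h1.exists
  exact ⟨x, hx.1, hx.2⟩

lemma reg_integral_sub (h : Setup c ρ₀ α T g) (hl : 0 ≤ lam) (hη : Adm ρ₀ α T lam η)
    (hρ : ρ ∈ widths ρ₀) {r : ℝ} (hr : r ∈ times ρ₀ α T lam ρ) (hs : 0 ≤ s) (hsr : s ≤ r)
    (ht : 0 ≤ t) (htr : t ≤ r) :
    Reg ρ (fun a b => (∫ x in (0 : ℝ)..s, F g α x (η x) a b) - ∫ x in (0 : ℝ)..t, F g α x (η x) a b)
      (|s - t| * (2 * constCF c * (r * |Real.log r|) / (ρ₀ - lam * phi α r - ρ))) := by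
  have hi : ∀ a ∈ strip ρ, ∀ b ∈ Ioo (-2 : ℝ) 2, ∀ x, 0 ≤ x → x ≤ r →
      IntervalIntegrable (fun s => F g α s (η s) a b) volume 0 x := fun a ha b hb x hx hxr =>
    h.intervalIntegrable_F hl hη hρ hr le_rfl hx hxr ha hb
  rcases le_total s t with hst | hst
  · have := (h.reg_integral_F hl hη hρ hr hs hst htr).const_mul (-1)
    rw [norm_neg, norm_one, one_mul] at this
    rw [abs_sub_comm, abs_of_nonneg (by linarith : 0 ≤ t - s)]
    refine this.congr fun a ha b hb => ?_
    rw [← intervalIntegral.integral_interval_sub_left (hi a ha b hb t ht htr)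
      (hi a ha b hb s hs hsr)]
    ring
  · have := h.reg_integral_F hl hη hρ hr ht hst hsr
    rw [abs_of_nonneg (by linarith : 0 ≤ s - t)]
    exact this.congr fun a ha b hb => intervalIntegral.integral_interval_sub_left
      (hi a ha b hb s hs hsr) (hi a ha b hb t ht htr)

/-- At `t = 0` the size bound of `Phi` tends to zero with `phi`. At positive times the prefactor is
continuous and the integral is Lipschitz in time in the norm of `B_ρ`. -/
lemma cont_Phi (h : Setup c ρ₀ α T g) (hl : 0 ≤ lam) (hη : Adm ρ₀ α T lam η)
    (hρ : ρ ∈ widths ρ₀) (ht : t ∈ times ρ₀ α T lam ρ) {ε : ℝ} (hε : 0 < ε) :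
    ∀ᶠ s in 𝓝[times ρ₀ α T lam ρ] t, Reg ρ (Phi g α η s - Phi g α η t) ε := by
  rcases ht.1.1.eq_or_lt with rfl | ht0
  · have hc : Tendsto (phi α) (𝓝[times ρ₀ α T lam ρ] 0) (𝓝 (phi α 0)) :=
      (continuousWithinAt_phi h.α_lt le_rfl).mono fun s hs => hs.1.1
    rw [phi_zero] at hc
    have hlim := (hc.const_mul (2 * constCF c)).div
      (((hc.const_mul lam).const_sub ρ₀).sub_const ρ) (by rw [mul_zero, sub_zero]; linarith [hρ.2])
    rw [mul_zero, zero_div] at hlim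
    filter_upwards [self_mem_nhdsWithin, hlim.eventually_lt_const hε] with s hs hs'
    rw [Phi_zero h.α_pos]
    rcases hs.1.1.eq_or_lt with rfl | hs0
    · rw [Phi_zero h.α_pos]
      exact ((Reg.zero ρ).mono hε.le).congr fun a _ b _ => by simp
    · exact ((h.reg_Phi hl hη hρ hs hs0).mono hs'.le).congr fun a _ b _ => by simp
  · obtain ⟨r, hr, htr⟩ := h.exists_gt_mem_times ht ht0
    obtain ⟨B, hB⟩ : ∃ B, B = 2 * constCF c * (r * |Real.log r|) / (ρ₀ - lam * phi α r - ρ) :=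
      ⟨_, rfl⟩
    let k : ℝ → ℂ := fun s => 1 / ((s ^ (1 + α) : ℝ) : ℂ)
    have hk : Tendsto k (𝓝[times ρ₀ α T lam ρ] t) (𝓝 (k t)) := by
      refine ContinuousAt.continuousWithinAt (continuousAt_const.div
        (Complex.continuous_ofReal.continuousAt.comp
          (Real.continuousAt_rpow_const t (1 + α) (Or.inl ht0.ne'))) ?_)
      rw [Complex.ofReal_ne_zero]; positivity
    have hid : Tendsto (fun s : ℝ => s) (𝓝[times ρ₀ α T lam ρ] t) (𝓝 t) := nhdsWithin_le_nhds
    have hlim := (hk.norm.mul ((hid.sub_const t).abs.mul_const B)).add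
      ((hk.const_sub (k t)).norm.mul_const (t * B))
    simp only [sub_self, abs_zero, norm_zero, zero_mul, mul_zero, add_zero] at hlim
    filter_upwards [self_mem_nhdsWithin, hlim.eventually_lt_const hε,
      mem_nhdsWithin_of_mem_nhds (Iio_mem_nhds htr)] with s hs hs' hsr
    have r1 := (h.reg_integral_sub hl hη hρ hr hs.1.1 (le_of_lt hsr) ht.1.1 htr.le).const_mul (k s)
    have r2 := (h.reg_integral_F hl hη hρ hr le_rfl ht.1.1 htr.le).const_mul (k t - k s)
    rw [← hB] at r1 r2
    rw [sub_zero] at r2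
    refine ((r1.sub r2).mono hs'.le).congr fun a _ b _ => ?_
    simp only [Pi.sub_apply, Phi, k]
    ring

lemma adm_Phi (h : Setup c ρ₀ α T g) (hl : 0 ≤ lam) (hη : Adm ρ₀ α T lam η)
    (hreg : ∀ ρ ∈ widths ρ₀, ∀ t ∈ times ρ₀ α T lam ρ, Reg ρ (Phi g α η t) 1) :
    Adm ρ₀ α T lam (Phi g α η) :=
  ⟨fun _ hρ _ ht => h.realPer_Phi hl hη hρ ht, hreg,
    fun _ hρ _ ht _ hε => h.cont_Phi hl hη hρ ht hε⟩

end Setup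

lemma times_anti {lam' : ℝ} (hl : lam ≤ lam') :
    times ρ₀ α T lam' ρ ⊆ times ρ₀ α T lam ρ := fun _ ht =>
  ⟨ht.1, lt_of_le_of_lt (mul_le_mul_of_nonneg_right hl (phi_nonneg α ht.1.1)) ht.2⟩

lemma Adm.mono {lam' : ℝ} (hη : Adm ρ₀ α T lam η) (hl : lam ≤ lam') : Adm ρ₀ α T lam' η :=
  ⟨fun ρ hρ t ht => hη.realPer ρ hρ t (times_anti hl ht),
    fun ρ hρ t ht => hη.reg ρ hρ t (times_anti hl ht),
    fun ρ hρ t ht ε hε => nhdsWithin_mono _ (times_anti hl)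
      (hη.cont ρ hρ t (times_anti hl ht) ε hε)⟩

lemma Close.mono {lam' : ℝ} (hc : Close ρ₀ α T lam M η ζ) (hM : 0 ≤ M) (hl : lam ≤ lam') :
    Close ρ₀ α T lam' M η ζ := fun ρ hρ t ht ht0 => by
  refine (hc ρ hρ t (times_anti hl ht) ht0).mono ?_
  have h1 := phi_nonneg α ht.1.1
  have h2 : 0 < ρ₀ - lam' * phi α t - ρ := by linarith [ht.2]
  gcongr

lemma Adm.zero : Adm ρ₀ α T lam (fun _ _ _ => 0) :=
  ⟨fun _ _ _ _ => ⟨by simp, by simp⟩, fun ρ _ _ _ => (Reg.zero ρ).mono zero_le_one,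
    fun ρ _ _ _ ε hε => Eventually.of_forall fun _ =>
      ((Reg.zero ρ).mono (le_of_lt hε)).congr fun a _ b _ => by simp⟩

end


/-! ### The fixed point iteration -/

section

variable {c ρ₀ α T lam M ρ s t : ℝ} {g : ℂ → ℂ} {η ζ : ℝ → ℂ → ℝ → ℂ}

lemma Reg.add {K K' : ℝ} {u v : ℂ → ℝ → ℂ} (h : Reg ρ u K) (h' : Reg ρ v K') :
    Reg ρ (u + v) (K + K') := by
  have := h.sub (h'.const_mul (-1))
  rw [norm_neg, norm_one, one_mul] at this
  exact this.congr fun a _ b _ => by simp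

/-- Telescoping series of regular functions. -/
lemma Reg.telescope {u : ℕ → ℂ → ℝ → ℂ} {B : ℕ → ℝ} (hB : Summable B)
    (hu : ∀ n, Reg ρ (u (n + 1) - u n) (B n)) (hu0 : u 0 = fun _ _ => 0) (n : ℕ) :
    Reg ρ ((fun a b => ∑' k, (u (k + 1) a b - u k a b)) - u n) (∑' k, B (k + n)) := by
  have hBn := (summable_nat_add_iff n).2 hB
  -- The series is treated as an integral against counting measure, so that `Reg.integral` provides
  -- all regularity of the sum.
  have hBi : Integrable (fun k => B (k + n)) Measure.count := integrable_count_iff.2 hBn.abs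
  have hsum : ∀ a ∈ strip ρ, ∀ b ∈ Ioo (-2 : ℝ) 2, Summable fun k => u (k + 1) a b - u k a b :=
    fun a ha b hb => Summable.of_norm_bounded hB fun k => (hu k).bd a ha b hb
  have := Reg.integral (u := fun k => u (k + n + 1) - u (k + n)) hBi
    (Eventually.of_forall fun k => hu (k + n)) (fun a _ b _ => by fun_prop)
  rw [integral_countable hBi] at this
  simp only [measureReal_def, Measure.count_singleton, ENNReal.toReal_one, one_smul] at this
  refine this.congr fun a ha b hb => ?_
  have hs := (summable_nat_add_iff n).2 (hsum a ha b hb)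
  simp only [Pi.sub_apply]
  rw [integral_countable (integrable_count_iff.2 hs.norm)]
  simp only [measureReal_def, Measure.count_singleton, ENNReal.toReal_one, one_smul]
  rw [← (hsum a ha b hb).sum_add_tsum_nat_add n, Finset.sum_range_sub (fun k => u k a b), hu0]
  simp

/-- The iterates of `Phi`. -/
def iter (g : ℂ → ℂ) (α : ℝ) : ℕ → ℝ → ℂ → ℝ → ℂ
  | 0 => fun _ _ _ => 0
  | n + 1 => Phi g α (iter g α n)

/-- The limit of the iterates. -/
def sol (g : ℂ → ℂ) (α t : ℝ) (y₁ : ℂ) (y₂ : ℝ) : ℂ :=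
  ∑' n, (iter g α (n + 1) t y₁ y₂ - iter g α n t y₁ y₂)

lemma iter_at_zero (hα : 0 < α) (n : ℕ) : iter g α n 0 = fun _ _ => 0 := by
  cases n with
  | zero => rfl
  | succ n => exact Setup.Phi_zero hα

/-- On the smaller domain with speed `lam'`, the width available for the speed `lam` is at least
`(lam' - lam) φ(t)`. The weight `φ(t)` cancels and a bound uniform up to the boundary remains. -/
lemma Close.reg {lam' : ℝ} (hc : Close ρ₀ α T lam M η ζ) (hM : 0 ≤ M) (hl : lam < lam')
    (hρ : ρ ∈ widths ρ₀) (ht : t ∈ times ρ₀ α T lam' ρ) (ht0 : 0 < t) (hT : T ≤ 1 / 4) :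
    Reg ρ (η t - ζ t) (M / (lam' - lam)) := by
  refine (hc ρ hρ t (times_anti hl.le ht) ht0).mono ?_
  have h1 := phi_pos α ht0 (ht.1.2.le.trans hT)
  have h2 : (lam' - lam) * phi α t ≤ ρ₀ - lam * phi α t - ρ := by linarith [ht.2]
  have h3 : 0 < lam' - lam := sub_pos.2 hl
  calc M * phi α t / (ρ₀ - lam * phi α t - ρ) ≤ M * phi α t / ((lam' - lam) * phi α t) := by gcongr
    _ = _ := by field_simp

/-- The domains of the iterates are slightly larger than the final one. -/
def lamSeq (lam : ℝ) (n : ℕ) : ℝ := lam * (1 - (1 / 2) ^ (n + 1))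

lemma lamSeq_succ_sub (lam : ℝ) (n : ℕ) :
    lamSeq lam (n + 1) - lamSeq lam n = lam * (1 / 4) * (1 / 2) ^ n := by
  unfold lamSeq; ring

lemma half_le_lamSeq (hl : 0 ≤ lam) (n : ℕ) : lam / 2 ≤ lamSeq lam n := by
  have : ((1 : ℝ) / 2) ^ (n + 1) ≤ 1 / 2 := by
    simpa using pow_le_pow_of_le_one (by norm_num : (0 : ℝ) ≤ 1 / 2) (by norm_num)
      (Nat.le_add_left 1 n)
  unfold lamSeq
  nlinarith

lemma lamSeq_lt (hl : 0 < lam) (n : ℕ) : lamSeq lam n < lam := by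
  have : (0 : ℝ) < (1 / 2) ^ (n + 1) := by positivity
  unfold lamSeq
  nlinarith

namespace Setup

lemma constCF_pos (h : Setup c ρ₀ α T g) : 0 < constCF c := by
  have h1 := h.iface.constF_nonneg
  have h2 := h.iface.one_le
  have : 0 < constF2 c := by unfold constF2; positivity
  unfold constCF; positivity

/-- The conditions on the speed `lam` at which the domain shrinks. -/
structure Fast (c α T lam : ℝ) : Prop where
  le : 64 * constCF c ≤ lam
  slope : 512 * c * constCF c ≤ lam / 2 * ((1 - α) / 2 * T ^ (-α))

lemma Fast.pos (h : Setup c ρ₀ α T g) (hf : Fast c α T lam) : 0 < lam := by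
  have := h.constCF_pos; linarith [hf.le]

lemma Fast.slope_of_le (h : Setup c ρ₀ α T g) (hf : Fast c α T lam) {l : ℝ} (hl : lam / 2 ≤ l) :
    512 * c * constCF c ≤ l * ((1 - α) / 2 * T ^ (-α)) := by
  have := h.T_pos
  have : 0 ≤ (1 - α) / 2 * T ^ (-α) := mul_nonneg (by linarith [h.α_lt]) (by positivity)
  exact hf.slope.trans (by gcongr)

/-- The speeds increase by steps of order `2^{-n}` while the closeness decays like `4^{-n}`, so the
increments still decay like `2^{-n}`. The prefactor `1/8` comes from `lam ≥ 64 constCF c`. -/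
lemma reg_iter_sub (h : Setup c ρ₀ α T g) (hf : Fast c α T lam) (n : ℕ)
    (hc : Close ρ₀ α T (lamSeq lam n) (2 * constCF c * (1 / 4) ^ n) (iter g α (n + 1)) (iter g α n))
    (hρ : ρ ∈ widths ρ₀) (ht : t ∈ times ρ₀ α T (lamSeq lam (n + 1)) ρ) :
    Reg ρ (iter g α (n + 1) t - iter g α n t) (1 / 8 * (1 / 2) ^ n) := by
  have hl := Fast.pos h hf
  have hC := h.constCF_pos
  rcases ht.1.1.eq_or_lt with rfl | ht0
  · rw [iter_at_zero h.α_pos, iter_at_zero h.α_pos]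
    exact ((Reg.zero ρ).mono (by positivity)).congr fun a _ b _ => by simp
  have hlt : lamSeq lam n < lamSeq lam (n + 1) := by
    have := lamSeq_succ_sub lam n
    have : 0 < lam * (1 / 4) * (1 / 2) ^ n := by positivity
    linarith
  refine (hc.reg (by positivity) hlt hρ ht ht0 h.T_le).mono ?_
  rw [lamSeq_succ_sub, div_le_iff₀ (by positivity)]
  have e : ((1 : ℝ) / 2) ^ n * (1 / 2) ^ n = (1 / 4) ^ n := by rw [← mul_pow]; norm_num
  calc 2 * constCF c * (1 / 4) ^ n ≤ lam / 32 * (1 / 4) ^ n := by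
        gcongr; linarith [hf.le]
    _ = _ := by rw [← e]; ring

lemma sum_half_le (n : ℕ) : ∑ k ∈ Finset.range n, (1 / 8 : ℝ) * (1 / 2) ^ k ≤ 1 := by
  rw [← Finset.mul_sum, geom_sum_eq (by norm_num)]
  have : (0 : ℝ) < (1 / 2) ^ n := by positivity
  norm_num
  linarith

/-- The three statements need each other: closeness bounds the increments, their sum keeps the
iterate in the unit ball, and only there do the estimates of `F` apply and give closeness at the
next stage. The slope condition in `Fast` is stated for `lam / 2` because all speeds of the
iteration exceed it. -/
lemma iter_spec (h : Setup c ρ₀ α T g) (hf : Fast c α T lam) (n : ℕ) :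
    Adm ρ₀ α T (lamSeq lam n) (iter g α n) ∧
    Close ρ₀ α T (lamSeq lam n) (2 * constCF c * (1 / 4) ^ n) (iter g α (n + 1)) (iter g α n) ∧
    ∀ ρ ∈ widths ρ₀, ∀ t ∈ times ρ₀ α T (lamSeq lam n) ρ,
      Reg ρ (iter g α n t) (∑ k ∈ Finset.range n, 1 / 8 * (1 / 2) ^ k) := by
  have hl := Fast.pos h hf
  have hC := h.constCF_pos
  have hln : ∀ n, 0 < lamSeq lam n := fun n => by
    have := half_le_lamSeq hl.le n; linarith
  induction n with
  | zero =>
    refine ⟨Adm.zero, fun ρ hρ t ht ht0 => ?_, fun ρ _ t _ => (Reg.zero ρ).mono (by simp)⟩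
    refine ((h.reg_Phi (hln 0).le Adm.zero hρ ht ht0).mono (le_of_eq (by simp))).congr
      fun a _ b _ => ?_
    simp [iter]
  | succ n ih =>
    obtain ⟨ih1, ih2, ih3⟩ := ih
    have hle : lamSeq lam n ≤ lamSeq lam (n + 1) := by
      have := lamSeq_succ_sub lam n
      have : 0 < lam * (1 / 4) * (1 / 2) ^ n := by positivity
      linarith
    have hreg : ∀ ρ ∈ widths ρ₀, ∀ t ∈ times ρ₀ α T (lamSeq lam (n + 1)) ρ,
        Reg ρ (iter g α (n + 1) t) (∑ k ∈ Finset.range (n + 1), 1 / 8 * (1 / 2) ^ k) := by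
      intro ρ hρ t ht
      rw [Finset.sum_range_succ]
      exact ((ih3 ρ hρ t (times_anti hle ht)).add (h.reg_iter_sub hf n ih2 hρ ht)).congr
        fun a _ b _ => by simp
    have hadm : Adm ρ₀ α T (lamSeq lam (n + 1)) (iter g α (n + 1)) :=
      h.adm_Phi (hln _).le (ih1.mono hle) fun ρ hρ t ht => (hreg ρ hρ t ht).mono (sum_half_le _)
    refine ⟨hadm, ?_, hreg⟩
    have := h.close_Phi (hln _) (Fast.slope_of_le h hf (half_le_lamSeq hl.le _)) hadm (ih1.mono hle)
      (by positivity) (ih2.mono (by positivity) hle)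
    rw [show 2 * constCF c * (1 / 4) ^ n / 4 = 2 * constCF c * (1 / 4) ^ (n + 1) by ring] at this
    exact this

lemma adm_iter (h : Setup c ρ₀ α T g) (hf : Fast c α T lam) (n : ℕ) :
    Adm ρ₀ α T lam (iter g α n) :=
  (h.iter_spec hf n).1.mono (lamSeq_lt (Fast.pos h hf) n).le

lemma reg_sol_sub (h : Setup c ρ₀ α T g) (hf : Fast c α T lam) (hρ : ρ ∈ widths ρ₀)
    (ht : t ∈ times ρ₀ α T lam ρ) (n : ℕ) :
    Reg ρ (sol g α t - iter g α n t) (1 / 4 * (1 / 2) ^ n) := by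
  have hs : Summable fun k : ℕ => (1 / 8 : ℝ) * (1 / 2) ^ k :=
    (summable_geometric_of_lt_one (by norm_num) (by norm_num)).mul_left _
  have := Reg.telescope (u := fun n => iter g α n t) hs (fun n => h.reg_iter_sub hf n
    (h.iter_spec hf n).2.1 hρ (times_anti (lamSeq_lt (Fast.pos h hf) _).le ht)) rfl n
  refine this.mono (le_of_eq ?_)
  simp only [pow_add, ← mul_assoc]
  rw [tsum_mul_right, tsum_mul_left, tsum_geometric_of_lt_one (by norm_num) (by norm_num)]
  ring

lemma reg_sol (h : Setup c ρ₀ α T g) (hf : Fast c α T lam) (hρ : ρ ∈ widths ρ₀)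
    (ht : t ∈ times ρ₀ α T lam ρ) : Reg ρ (sol g α t) (1 / 4) :=
  ((h.reg_sol_sub hf hρ ht 0).mono (by simp)).congr fun a _ b _ => by simp [iter]

lemma close_sol (h : Setup c ρ₀ α T g) (hf : Fast c α T lam) (n : ℕ) :
    Close ρ₀ α T lam (8 / 3 * constCF c * (1 / 4) ^ n) (sol g α) (iter g α n) := by
  intro ρ hρ t ht ht0
  have hC := h.constCF_pos
  have hs : Summable fun k : ℕ => (2 * constCF c * (1 / 4) ^ k) * phi α t /
      (ρ₀ - lam * phi α t - ρ) :=
    (((summable_geometric_of_lt_one (by norm_num) (by norm_num)).mul_left _).mul_right _).div_const _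
  have := Reg.telescope (u := fun n => iter g α n t) hs (fun n => ((h.iter_spec hf n).2.1.mono
    (by positivity) (lamSeq_lt (Fast.pos h hf) n).le) ρ hρ t ht ht0) rfl n
  refine this.mono (le_of_eq ?_)
  rw [tsum_div_const, tsum_mul_right, tsum_mul_left]
  simp only [pow_add]
  rw [tsum_mul_right, tsum_geometric_of_lt_one (by norm_num) (by norm_num)]
  ring

lemma adm_sol (h : Setup c ρ₀ α T g) (hf : Fast c α T lam) : Adm ρ₀ α T lam (sol g α) := by
  refine ⟨fun ρ hρ t ht => ⟨fun x b hb => ?_, fun x b hb => ?_⟩,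
    fun ρ hρ t ht => (h.reg_sol hf hρ ht).mono (by norm_num), fun ρ hρ t ht ε hε => ?_⟩
  · have hr : ∀ n, (iter g α n t x b).im = 0 := fun n =>
      ((h.adm_iter hf n).realPer ρ hρ t ht).real x b hb
    have : sol g α t x b =
        ((∑' n, (iter g α (n + 1) t x b - iter g α n t x b).re : ℝ) : ℂ) := by
      rw [Complex.ofReal_tsum]
      exact tsum_congr fun n => Complex.ext rfl (by simp [hr])
    rw [this, Complex.ofReal_im]
  · exact tsum_congr fun n => by
      rw [((h.adm_iter hf n).realPer ρ hρ t ht).periodic x b hb,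
        ((h.adm_iter hf (n + 1)).realPer ρ hρ t ht).periodic x b hb]
  · obtain ⟨n, hn⟩ := exists_pow_lt_of_lt_one (show 0 < ε by exact hε)
      (show (1 / 2 : ℝ) < 1 by norm_num)
    filter_upwards [(h.adm_iter hf n).cont ρ hρ t ht (ε / 2) (half_pos hε), self_mem_nhdsWithin]
      with s hs hs'
    refine (((hs.add (h.reg_sol_sub hf hρ hs' n)).sub (h.reg_sol_sub hf hρ ht n)).mono ?_).congr
      fun a _ b _ => ?_
    · linarith
    · simp only [Pi.sub_apply, Pi.add_apply]; ring

/-- The limit of the iterates is a fixed point. -/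
lemma sol_eq_Phi (h : Setup c ρ₀ α T g) (hf : Fast c α T lam) (hρ : ρ ∈ widths ρ₀)
    (ht : t ∈ times ρ₀ α T lam ρ) (ht0 : 0 < t) {a : ℂ} (ha : a ∈ strip ρ) {b : ℝ}
    (hb : b ∈ Ioo (-2 : ℝ) 2) : sol g α t a b = Phi g α (sol g α) t a b := by
  have hl := Fast.pos h hf
  have hC := h.constCF_pos
  obtain ⟨A, hA⟩ : ∃ A, A = 8 * constCF c * phi α t / (ρ₀ - lam * phi α t - ρ) := ⟨_, rfl⟩
  -- The limit is compared with `Phi` of itself through the iterate of index `n + 1`, which is `Phi`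
  -- of the n-th one.
  have key : ∀ n : ℕ, ‖sol g α t a b - Phi g α (sol g α) t a b‖ ≤ A * (1 / 4) ^ n := fun n => by
    have h1 := (h.close_sol hf (n + 1)) ρ hρ t ht ht0
    have h2 := (h.close_Phi hl (Fast.slope_of_le h hf (by linarith)) (h.adm_sol hf)
      (h.adm_iter hf n) (by positivity) (h.close_sol hf n)) ρ hρ t ht ht0
    have h3 := (h1.sub h2).bd a ha b hb
    simp only [Pi.sub_apply] at h3
    have e : sol g α t a b - Phi g α (sol g α) t a b = sol g α t a b - iter g α (n + 1) t a b -
      (Phi g α (sol g α) t a b - Phi g α (iter g α n) t a b) := by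
      rw [show iter g α (n + 1) = Phi g α (iter g α n) from rfl]; ring
    rw [e]
    refine h3.trans ?_
    have hφ := phi_nonneg α ht.1.1
    have hD : 0 < ρ₀ - lam * phi α t - ρ := by linarith [ht.2]
    rw [hA, ← add_div, div_mul_eq_mul_div _ (ρ₀ - lam * phi α t - ρ)]
    refine div_le_div_of_nonneg_right ?_ hD.le
    have : 0 ≤ constCF c * phi α t * (1 / 4) ^ n := by positivity
    rw [pow_succ]
    nlinarith
  have hlim : Tendsto (fun n : ℕ => A * (1 / 4) ^ n) atTop (𝓝 0) := by
    simpa using (tendsto_pow_atTop_nhds_zero_of_lt_one (by norm_num : (0 : ℝ) ≤ 1 / 4)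
      (by norm_num)).const_mul A
  exact sub_eq_zero.1 (norm_le_zero_iff.1 (ge_of_tendsto' hlim key))

/-- Fixed points are unique. -/
lemma fixed_unique (h : Setup c ρ₀ α T g) (hf : Fast c α T lam) (hη : Adm ρ₀ α T lam η)
    (hζ : Adm ρ₀ α T lam ζ)
    (eη : ∀ ρ ∈ widths ρ₀, ∀ t ∈ times ρ₀ α T lam ρ, 0 < t → ∀ a ∈ strip ρ, ∀ b ∈ Ioo (-2 : ℝ) 2,
      η t a b = Phi g α η t a b)
    (eζ : ∀ ρ ∈ widths ρ₀, ∀ t ∈ times ρ₀ α T lam ρ, 0 < t → ∀ a ∈ strip ρ, ∀ b ∈ Ioo (-2 : ℝ) 2,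
      ζ t a b = Phi g α ζ t a b)
    (hρ : ρ ∈ widths ρ₀) (ht : t ∈ times ρ₀ α T lam ρ) (ht0 : 0 < t) {a : ℂ} (ha : a ∈ strip ρ)
    {b : ℝ} (hb : b ∈ Ioo (-2 : ℝ) 2) : η t a b = ζ t a b := by
  have hl := Fast.pos h hf
  have hC := h.constCF_pos
  have hcl : ∀ n : ℕ, Close ρ₀ α T lam (4 * constCF c * (1 / 4) ^ n) η ζ := fun n => by
    induction n with
    | zero =>
      -- Both families are values of `Phi`, so each has size at most `2 constCF c` in the weighted
      -- sense. This starts the iteration although membership in the unit ball alone gives no decay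
      -- at `t = 0`.
      intro ρ hρ t ht ht0
      refine (((h.reg_Phi hl.le hη hρ ht ht0).sub (h.reg_Phi hl.le hζ hρ ht ht0)).mono
        (le_of_eq (by ring))).congr fun a ha b hb => ?_
      simp only [Pi.sub_apply]
      rw [eη ρ hρ t ht ht0 a ha b hb, eζ ρ hρ t ht ht0 a ha b hb]
    | succ n ih =>
      intro ρ hρ t ht ht0
      refine ((h.close_Phi hl (Fast.slope_of_le h hf (by linarith)) hη hζ (by positivity) ih
        ρ hρ t ht ht0).mono (le_of_eq (by ring))).congr fun a ha b hb => ?_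
      simp only [Pi.sub_apply]
      rw [eη ρ hρ t ht ht0 a ha b hb, eζ ρ hρ t ht ht0 a ha b hb]
  obtain ⟨A, hA⟩ : ∃ A, A = 4 * constCF c * phi α t / (ρ₀ - lam * phi α t - ρ) := ⟨_, rfl⟩
  have key : ∀ n : ℕ, ‖η t a b - ζ t a b‖ ≤ A * (1 / 4) ^ n := fun n =>
    ((hcl n ρ hρ t ht ht0).bd a ha b hb).trans (le_of_eq (by rw [hA]; ring))
  have hlim : Tendsto (fun n : ℕ => A * (1 / 4) ^ n) atTop (𝓝 0) := by
    simpa using (tendsto_pow_atTop_nhds_zero_of_lt_one (by norm_num : (0 : ℝ) ≤ 1 / 4)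
      (by norm_num)).const_mul A
  exact sub_eq_zero.1 (norm_le_zero_iff.1 (ge_of_tendsto' hlim key))

end Setup

end


/-! ### The norm of `B_ρ` -/

section

variable {c ρ₀ α T lam ρ K t C₀ κ : ℝ} {g : ℂ → ℂ} {u : ℂ → ℝ → ℂ} {ζ : ℝ → ℂ → ℝ → ℂ}

lemma supOmega_le (h : ∀ a ∈ strip ρ, ∀ b ∈ Ioo (-2 : ℝ) 2, ‖u a b‖ ≤ K) :
    supOmega ρ u ≤ ENNReal.ofReal K :=
  iSup₂_le fun y hy => by
    rw [← ofReal_norm]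
    exact ENNReal.ofReal_le_ofReal (h _ hy.1 _ hy.2)

lemma norm_le_of_supOmega_le (hK : 0 ≤ K) (h : supOmega ρ u ≤ ENNReal.ofReal K) {a : ℂ}
    (ha : a ∈ strip ρ) {b : ℝ} (hb : b ∈ Ioo (-2 : ℝ) 2) : ‖u a b‖ ≤ K := by
  have h1 : ‖u a b‖ₑ ≤ supOmega ρ u :=
    le_iSup₂ (f := fun (y : ℂ × ℝ) (_ : y ∈ Omega ρ) => ‖u y.1 y.2‖ₑ) (a, b) ⟨ha, hb⟩
  have h2 := h1.trans h
  rw [← ofReal_norm] at h2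
  exact (ENNReal.ofReal_le_ofReal_iff hK).1 h2

lemma Reg.normB_le (h : Reg ρ u K) (hK : 0 ≤ K) : normB ρ u ≤ ENNReal.ofReal (3 * K) := by
  have : 3 * K = K + K + K := by ring
  rw [this, ENNReal.ofReal_add (by positivity) hK, ENNReal.ofReal_add hK hK]
  exact add_le_add (add_le_add (supOmega_le h.bd) (supOmega_le h.bd1)) (supOmega_le h.bd2)

lemma Reg.of_normB_le {K' : ℝ} (h : Reg ρ u K') (hK : 0 ≤ K)
    (hn : normB ρ u ≤ ENNReal.ofReal K) : Reg ρ u K := by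
  have h2 : supOmega ρ u + supOmega ρ (dy1 u) ≤ ENNReal.ofReal K := le_self_add.trans hn
  exact h.of_bounds
    (fun a ha b hb => norm_le_of_supOmega_le hK (le_self_add.trans h2) ha hb)
    (fun a ha b hb => norm_le_of_supOmega_le hK (le_add_self.trans h2) ha hb)
    (fun a ha b hb => norm_le_of_supOmega_le hK (le_add_self.trans hn) ha hb)

lemma MemB.reg (h : MemB ρ u) (hn : normB ρ u ≤ 1) : Reg ρ u 1 := by
  rw [← ENNReal.ofReal_one] at hn
  have h2 : supOmega ρ u + supOmega ρ (dy1 u) ≤ ENNReal.ofReal 1 := le_self_add.trans hn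
  exact ⟨h.holomorphic, fun a ha b hb => h.differentiable_y2 (a, b) ⟨ha, hb⟩,
    h.uniformContinuous_dy2, h.holomorphic_dy2,
    fun a ha b hb => norm_le_of_supOmega_le zero_le_one (le_self_add.trans h2) ha hb,
    fun a ha b hb => norm_le_of_supOmega_le zero_le_one (le_add_self.trans h2) ha hb,
    fun a ha b hb => norm_le_of_supOmega_le zero_le_one (le_add_self.trans hn) ha hb⟩

lemma Reg.memB (h : Reg ρ u K) (hρ : 0 < ρ) (hr : RealPer u) : MemB ρ u where
  real := hr.real
  periodic := hr.periodic
  continuous := by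
    have hm : Continuous fun p : ℝ × ℝ => ((p.1 : ℂ), p.2) := by fun_prop
    exact h.continuousOn.comp (f := fun p : ℝ × ℝ => ((p.1 : ℂ), p.2)) hm.continuousOn
      fun p hp => ⟨ofReal_mem_strip hρ p.1, hp.2⟩
  holomorphic := h.hol
  differentiable_y2 y hy := h.diffAt2 y.1 hy.1 y.2 hy.2
  uniformContinuous_dy2 := h.uc
  holomorphic_dy2 := h.hol2
  norm_lt_top := (h.normB_le (h.nonneg hρ)).trans_lt ENNReal.ofReal_lt_top

/-- Only the ratio of the two constants matters; it is the speed at which the domain of analyticity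
shrinks. -/
lemma timeSet_eq (hκ : 0 < κ) :
    timeSet ρ₀ α C₀ κ T ρ = times ρ₀ α T (C₀ / κ) ρ := by
  ext t
  simp only [timeSet, times, mem_ofPred_eq, phi]
  rw [div_mul_eq_mul_div, div_lt_iff₀ hκ, mul_comm κ]

lemma integrand_zero_time (hα : 0 < α) (a : ℂ) (b : ℝ) : integrand g α 0 u a b = 0 := by
  have h1 : (1 : ℝ) + α ≠ 0 := by linarith
  have h2 : fFun g α 0 u = fun y₁ _ => g y₁ := by
    funext a b; simp [fFun, Real.zero_rpow h1]
  have h3 : X2 g α 0 u = fun y₁ _ => g y₁ := by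
    funext a b; simp [X2, h2]
  funext z
  rw [integrand, h2, h3]
  simp [diff1, diff2, dy1]

namespace Setup

/-- Every admissible time belongs to the domain of a width close to `ρ₀`. -/
lemma exists_widths (h : Setup c ρ₀ α T g) (hl : 0 ≤ lam) (hT : lam * phi α T < 1)
    (hρ : ρ ∈ Ioo 0 ρ₀) (ht : t ∈ times ρ₀ α T lam ρ) :
    ∃ ρ' ∈ widths ρ₀, ρ ≤ ρ' ∧ t ∈ times ρ₀ α T lam ρ' := by
  have h1 : lam * phi α t < 1 :=
    lt_of_le_of_lt (mul_le_mul_of_nonneg_left (h.phi_mono ht.1.1 ht.1.2.le le_rfl) hl) hT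
  have h2 : 0 ≤ lam * phi α t := mul_nonneg hl (phi_nonneg α ht.1.1)
  have h3 := ht.2
  -- The condition `lam φ(T) < 1` leaves room for a width that is within one of `ρ₀` and still
  -- admissible at time `t`.
  have h4 : max 0 (ρ₀ - 1) < ρ₀ - lam * phi α t :=
    max_lt (by linarith [hρ.1]) (by linarith)
  obtain ⟨r, hr1, hr2⟩ := exists_between h4
  exact ⟨max ρ r, ⟨hr1.trans_le (le_max_right _ _), max_lt hρ.2 (by linarith)⟩, le_max_left _ _,
    ht.1, by rcases max_choice ρ r with e | e <;> rw [e] <;> linarith⟩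

/-- The width condition at `ρ'` is open in time, so near `t` every time that is admissible for `ρ`
is admissible for `ρ'`. This transfers continuity from the larger width to an arbitrary smaller one.
-/
lemma nhdsWithin_times_le (h : Setup c ρ₀ α T g) {ρ' : ℝ} (ht : t ∈ times ρ₀ α T lam ρ') :
    𝓝[times ρ₀ α T lam ρ] t ≤ 𝓝[times ρ₀ α T lam ρ'] t := by
  have hc : ContinuousWithinAt (fun s => lam * phi α s) (times ρ₀ α T lam ρ) t :=
    ((continuousWithinAt_phi h.α_lt ht.1.1).mono fun s hs => hs.1.1).const_mul lam
  refine nhdsWithin_le_of_mem ?_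
  filter_upwards [self_mem_nhdsWithin, hc.eventually_lt_const ht.2] with s hs hs'
  exact ⟨hs.1, hs'⟩

lemma adm_of_isSolution (hκ : 0 < κ)
    (hζ : IsSolution g ρ₀ α C₀ κ T ζ) : Adm ρ₀ α T (C₀ / κ) ζ := by
  have hw : ∀ ρ ∈ widths ρ₀, ρ ∈ Ioo 0 ρ₀ := fun ρ hρ => ⟨widths_pos hρ, hρ.2⟩
  have hreg : ∀ ρ ∈ widths ρ₀, ∀ t ∈ times ρ₀ α T (C₀ / κ) ρ, Reg ρ (ζ t) 1 := fun ρ hρ t ht => by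
    rw [← timeSet_eq hκ] at ht
    exact (hζ.mem ρ (hw ρ hρ) t ht).reg (hζ.norm_lt_one ρ (hw ρ hρ) t ht).le
  refine ⟨fun ρ hρ t ht => ?_, hreg, fun ρ hρ t ht ε hε => ?_⟩
  · rw [← timeSet_eq hκ] at ht
    exact ⟨(hζ.mem ρ (hw ρ hρ) t ht).real, (hζ.mem ρ (hw ρ hρ) t ht).periodic⟩
  · have hc := hζ.continuous ρ (hw ρ hρ) t (by rwa [timeSet_eq hκ])
    rw [timeSet_eq hκ] at hc
    filter_upwards [self_mem_nhdsWithin,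
      hc.eventually_le_const (ENNReal.ofReal_pos.2 hε)] with s hs hs'
    exact ((hreg ρ hρ s hs).sub (hreg ρ hρ t ht)).of_normB_le (le_of_lt hε) hs'

/-- Existence, absolute convergence and uniqueness. -/
theorem isSolution_sol (h : Setup c ρ₀ α T g) (hκ : 0 < κ) (hf : Fast c α T (C₀ / κ))
    (hT : C₀ / κ * phi α T < 1) :
    IsSolution g ρ₀ α C₀ κ T (sol g α) ∧
    (∀ ρ ∈ Ioo 0 ρ₀, ∀ t ∈ timeSet ρ₀ α C₀ κ T ρ, ∀ y ∈ Omega ρ,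
      IntegrableOn (integrand g α t (sol g α t) y.1 y.2) Omega0 ∧
      IntervalIntegrable (fun s => F g α s (sol g α s) y.1 y.2) volume 0 t) ∧
    (∀ ζ : ℝ → ℂ → ℝ → ℂ, IsSolution g ρ₀ α C₀ κ T ζ →
      ∀ ρ ∈ Ioo 0 ρ₀, ∀ t ∈ timeSet ρ₀ α C₀ κ T ρ, ∀ y ∈ Omega ρ,
        ζ t y.1 y.2 = sol g α t y.1 y.2) := by
  have hl := (Fast.pos h hf).le
  have hadm := h.adm_sol hf
  have hsol0 : ∀ a b, sol g α 0 a b = 0 := fun a b => by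
    simp [sol, iter_at_zero h.α_pos]
  refine ⟨⟨fun ρ hρ t ht => ?_, fun ρ hρ t ht => ?_, fun ρ hρ t ht => ?_,
    fun ρ hρ y hy => hsol0 _ _, fun ρ hρ t ht ht0 y hy => ?_⟩, fun ρ hρ t ht y hy => ?_,
    fun ζ hζ ρ hρ t ht y hy => ?_⟩ <;> rw [timeSet_eq hκ] at ht <;>
    obtain ⟨ρ', hρ', hle, ht'⟩ := h.exists_widths hl hT hρ ht
  · exact ((h.reg_sol hf hρ' ht').mono_strip hle).memB hρ.1 (hadm.realPer ρ' hρ' t ht')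
  · rw [timeSet_eq hκ, ENNReal.tendsto_nhds_zero]
    intro ε hε
    rcases eq_or_ne ε ⊤ with rfl | hε'
    · exact Eventually.of_forall fun _ => le_top
    have hδ : 0 < ε.toReal / 3 := div_pos (ENNReal.toReal_pos hε.ne' hε') (by norm_num)
    filter_upwards [h.nhdsWithin_times_le ht' (hadm.cont ρ' hρ' t ht' _ hδ)] with s hs
    refine ((hs.mono_strip hle).normB_le hδ.le).trans (le_of_eq ?_)
    rw [mul_div_cancel₀ _ (by norm_num : (3 : ℝ) ≠ 0), ENNReal.ofReal_toReal hε']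
  -- The three suprema are at most `1/4` each, so the norm is at most `3/4`.
  · refine (((h.reg_sol hf hρ' ht').mono_strip hle).normB_le (by norm_num)).trans_lt ?_
    rw [ENNReal.ofReal_lt_one]; norm_num
  · exact h.sol_eq_Phi hf hρ' ht' ht0 (strip_mono hle hy.1) hy.2
  · refine ⟨?_, h.intervalIntegrable_F hl hadm hρ' ht' le_rfl ht.1.1 le_rfl
      (strip_mono hle hy.1) hy.2⟩
    rcases ht.1.1.eq_or_lt with rfl | ht0
    · rw [integrand_zero_time h.α_pos]; exact integrableOn_zero
    · have hr := hadm.reg ρ' hρ' t ht'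
      have hy1 := strip_mono hle hy.1
      exact (integrableOn_integrandI h.iface hr hρ'.2.le (h.smallTime ht0 ht.1.2.le)
        (h.rpow_le ht0 ht.1.2.le) hy1 hy.2).congr_fun
          (fun z hz => (integrand_eq h.iface hr hρ'.2.le ht0 hy1 hy.2 hz).symm) measurableSet_Omega0
  · rcases ht.1.1.eq_or_lt with rfl | ht0
    · rw [hsol0, hζ.initial ρ hρ y hy]
    · refine h.fixed_unique hf (adm_of_isSolution hκ hζ) hadm (fun r hr s hs hs0 a ha b hb => ?_)
        (fun r hr s hs hs0 a ha b hb => h.sol_eq_Phi hf hr hs hs0 ha hb) hρ' ht' ht0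
        (strip_mono hle hy.1) hy.2
      rw [← timeSet_eq hκ] at hs
      exact hζ.equation r ⟨widths_pos hr, hr.2⟩ s hs hs0 (a, b) ⟨ha, hb⟩

end Setup

end


/-! ### Choice of the constants -/

section

variable {c ρ₀ α T r : ℝ} {g : ℂ → ℂ}

/-- The speed at which the domain of analyticity shrinks. -/
def speed (c : ℝ) : ℝ := 64 * (|constCF c| + 1)

lemma speed_pos (c : ℝ) : 0 < speed c := by unfold speed; positivity

/-- All conditions are limits as `T → 0+` once the speed is fixed. The slope condition of `Fast`
holds because, after multiplication by `T^α`, its left side tends to zero and its right side is a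
positive constant. -/
lemma exists_final_time (c : ℝ) {α : ℝ} (hc : 0 < c) (h0 : 0 < α) (h1 : α < 1) :
    ∃ T : ℝ, 0 < T ∧ T ≤ 1 / 4 ∧ T * constS c ≤ 1 / 16 ∧ T ^ α * 2 < 1 / (16 * c) ∧
      2 / (1 - α) ≤ |Real.log T| ∧ Setup.Fast c α T (speed c) ∧ speed c * phi α T < 1 := by
  have hid : Tendsto (fun T : ℝ => T) (𝓝[>] 0) (𝓝 0) := nhdsWithin_le_nhds
  have hpow : Tendsto (fun T : ℝ => T ^ α) (𝓝[>] 0) (𝓝 0) := by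
    have := (Real.continuousAt_rpow_const 0 α (Or.inr h0.le)).tendsto
    rw [Real.zero_rpow h0.ne'] at this
    exact this.mono_left nhdsWithin_le_nhds
  have hphi : Tendsto (phi α) (𝓝[>] 0) (𝓝 0) := by
    have := (continuousWithinAt_phi h1 le_rfl).mono Ioi_subset_Ici_self
    rwa [ContinuousWithinAt, phi_zero] at this
  have hlog := tendsto_abs_atBot_atTop.comp Real.tendsto_log_nhdsGT_zero
  have e1 := (hid.mul_const (constS c)).eventually_lt_const
    (show 0 * constS c < 1 / 16 by norm_num)
  have e2 := (hpow.mul_const 2).eventually_lt_const (show 0 * 2 < 1 / (16 * c) by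
    rw [zero_mul]; positivity)
  have e3 := (hpow.const_mul (512 * c * constCF c)).eventually_lt_const
    (show 512 * c * constCF c * 0 < speed c / 2 * ((1 - α) / 2) by
      rw [mul_zero]; exact mul_pos (half_pos (speed_pos c)) (by linarith))
  have e4 := (hphi.const_mul (speed c)).eventually_lt_const
    (show speed c * 0 < 1 by norm_num)
  have e0 : ∀ᶠ T : ℝ in 𝓝[>] 0, 0 < T := self_mem_nhdsWithin
  obtain ⟨T, hT0, hT4, f1, f2, f3, f4, f5⟩ := (e0.and
    ((hid.eventually_lt_const (show (0 : ℝ) < 1 / 4 by norm_num)).and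
    (e1.and (e2.and (e3.and (e4.and (hlog.eventually_ge_atTop (2 / (1 - α))))))))).exists
  have hTα : 0 < T ^ α := Real.rpow_pos_of_pos hT0 α
  refine ⟨T, hT0, hT4.le, f1.le, f2, f5, ⟨?_, ?_⟩, f4⟩
  · unfold speed
    have := le_abs_self (constCF c)
    linarith
  · rw [Real.rpow_neg (le_of_lt hT0), ← mul_assoc, ← div_eq_mul_inv, le_div_iff₀ hTα]
    exact f3.le

/-- The final time. -/
def finalTime (c α : ℝ) : ℝ :=
  open Classical in
  -- The value `1` outside the admissible parameters is arbitrary and is never used.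
  if h : 0 < c ∧ 0 < α ∧ α < 1 then (exists_final_time c h.1 h.2.1 h.2.2).choose else 1

lemma finalTime_spec (hc : 0 < c) (h0 : 0 < α) (h1 : α < 1) :
    0 < finalTime c α ∧ finalTime c α ≤ 1 / 4 ∧ finalTime c α * constS c ≤ 1 / 16 ∧
      finalTime c α ^ α * 2 < 1 / (16 * c) ∧ 2 / (1 - α) ≤ |Real.log (finalTime c α)| ∧
      Setup.Fast c α (finalTime c α) (speed c) ∧ speed c * phi α (finalTime c α) < 1 := by
  rw [finalTime, dif_pos ⟨hc, h0, h1⟩]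
  exact (exists_final_time c hc h0 h1).choose_spec

/-! ### Bounds of the initial interface -/

/-- Identity theorem on the connected strip: `g(z + p)` and `g(z)` agree at the points `1/(n+1)`,
which accumulate at `0`. -/
lemma periodic_of_real (hg : DifferentiableOn ℂ g (strip r)) (hr : 0 < r) {p : ℝ}
    (hp : ∀ x : ℝ, g ((x + p : ℝ) : ℂ) = g x) {z : ℂ} (hz : z ∈ strip r) : g (z + p) = g z := by
  have hadd : ∀ z ∈ strip r, z + p ∈ strip r := fun z hz => by
    simpa [strip] using hz
  have h1 : AnalyticOnNhd ℂ (fun z => g (z + p)) (strip r) :=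
    DifferentiableOn.analyticOnNhd (hg.comp (differentiableOn_id.add_const (p : ℂ)) hadd)
      (isOpen_strip r)
  have h2 : AnalyticOnNhd ℂ g (strip r) := hg.analyticOnNhd (isOpen_strip r)
  refine h1.eqOn_of_preconnected_of_frequently_eq h2 (convex_strip r).isPreconnected
    (z₀ := 0) (by simpa using ofReal_mem_strip hr 0) ?_ hz
  have hlim : Tendsto (fun n : ℕ => (((1 / ((n : ℝ) + 1) : ℝ)) : ℂ)) atTop (𝓝[≠] 0) := by
    refine tendsto_nhdsWithin_iff.2 ⟨?_, Eventually.of_forall fun n => ?_⟩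
    · have := (Complex.continuous_ofReal.tendsto 0).comp
        (tendsto_one_div_add_atTop_nhds_zero_nat (𝕜 := ℝ))
      rwa [Complex.ofReal_zero] at this
    · have : (1 / ((n : ℝ) + 1) : ℝ) ≠ 0 := by positivity
      simpa only [mem_compl_iff, mem_singleton_iff, Complex.ofReal_eq_zero] using this
  refine hlim.frequently (Frequently.of_forall fun n => ?_)
  have := hp (1 / ((n : ℝ) + 1))
  rwa [Complex.ofReal_add] at this

/-- Periodicity reduces the narrower strip to a closed rectangle of one period, which is compact
inside the wider strip. -/
lemma exists_bound_of_periodic {p r' : ℝ} (hp0 : 0 < p) (hg : DifferentiableOn ℂ g (strip r))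
    (hr' : r' < r) (hp : ∀ z ∈ strip r, g (z + p) = g z) :
    ∃ B, ∀ z ∈ strip r', ‖g z‖ ≤ B := by
  have hk : IsCompact (Icc 0 p ×ℂ Icc (-r') r') := isCompact_Icc.reProdIm isCompact_Icc
  have hsub : Icc 0 p ×ℂ Icc (-r') r' ⊆ strip r := fun z hz => by
    have := hz.2
    exact (abs_le.2 this).trans_lt hr'
  obtain ⟨B, hB⟩ := hk.exists_bound_of_continuousOn (hg.continuousOn.mono hsub)
  refine ⟨B, fun z hz => ?_⟩
  have hz' : |z.im| < r' := hz
  have hper : Function.Periodic (fun x : ℝ => g (x + z.im * Complex.I)) p := fun x => by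
    have hx : (x + z.im * Complex.I : ℂ) ∈ strip r := by
      have : |z.im| < r := hz'.trans hr'
      simpa [strip] using this
    simp only [Complex.ofReal_add]
    rw [← hp _ hx, add_right_comm]
  obtain ⟨x, hx, e⟩ := hper.exists_mem_Ico₀ hp0 z.re
  simp only [Complex.re_add_im] at e
  rw [e]
  refine hB _ ⟨?_, ?_⟩
  · simpa using ⟨hx.1, hx.2.le⟩
  · simpa using abs_le.1 hz'.le

lemma norm_le_toReal_supStrip {h : ℂ → ℂ} (hfin : supStrip ρ₀ h ≠ ⊤) {z : ℂ} (hz : z ∈ strip ρ₀) :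
    ‖h z‖ ≤ (supStrip ρ₀ h).toReal := by
  have h1 : ‖h z‖ₑ ≤ supStrip ρ₀ h :=
    le_iSup₂ (f := fun (z : ℂ) (_ : z ∈ strip ρ₀) => ‖h z‖ₑ) z hz
  have := ENNReal.toReal_mono hfin h1
  rwa [toReal_enorm] at this

lemma supStrip_ne_top {h : ℂ → ℂ} {B : ℝ} (hB : ∀ z ∈ strip ρ₀, ‖h z‖ ≤ B) :
    supStrip ρ₀ h ≠ ⊤ := by
  have : supStrip ρ₀ h ≤ ENNReal.ofReal B := iSup₂_le fun z hz => by
    rw [← ofReal_norm]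
    exact ENNReal.ofReal_le_ofReal (hB z hz)
  exact (this.trans_lt ENNReal.ofReal_lt_top).ne

/-- Finiteness matters because `const0` uses `toReal`, which sends an infinite supremum to `0`. It
follows from holomorphy on the strip of twice the width. -/
lemma supStrip_iteratedDeriv_ne_top (hρ₀ : 0 < ρ₀) (hg : DifferentiableOn ℂ g (strip (2 * ρ₀)))
    {p : ℝ} (hp0 : 0 < p) (hp : ∀ x : ℝ, g ((x + p : ℝ) : ℂ) = g x) (n : ℕ) :
    supStrip ρ₀ (iteratedDeriv n g) ≠ ⊤ := by
  have key : ∀ n : ℕ, DifferentiableOn ℂ (iteratedDeriv n g) (strip (2 * ρ₀)) ∧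
      ∀ z ∈ strip (2 * ρ₀), iteratedDeriv n g (z + p) = iteratedDeriv n g z := fun n => by
    induction n with
    | zero => simpa using ⟨hg, fun z hz => periodic_of_real hg (by positivity) hp hz⟩
    | succ n ih =>
      rw [iteratedDeriv_succ]
      refine ⟨differentiableOn_deriv_strip ih.1, fun z hz => ?_⟩
      rw [← deriv_comp_add_const]
      refine Filter.EventuallyEq.deriv_eq ?_
      filter_upwards [(isOpen_strip _).mem_nhds hz] with w hw using ih.2 w hw
  obtain ⟨B, hB⟩ := exists_bound_of_periodic (r' := ρ₀) hp0 (key n).1 (by linarith) (key n).2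
  exact supStrip_ne_top hB

/-- The constant `C₀`. -/
def const0 (m : Fin 3 → ℝ≥0∞) : ℝ := 1 + ∑ j, (m j).toReal

lemma one_le_const0 (m : Fin 3 → ℝ≥0∞) : 1 ≤ const0 m := by
  have : 0 ≤ ∑ j, (m j).toReal := Finset.sum_nonneg fun j _ => ENNReal.toReal_nonneg
  unfold const0; linarith

lemma toReal_le_const0 (m : Fin 3 → ℝ≥0∞) (j : Fin 3) : (m j).toReal ≤ const0 m := by
  have := Finset.single_le_sum (f := fun j => (m j).toReal) (fun j _ => ENNReal.toReal_nonneg)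
    (Finset.mem_univ j)
  unfold const0; linarith

lemma interface_of_data {γ₀ : ℝ → ℝ} (hγ : Function.Periodic γ₀ (2 * Real.pi)) (hρ₀ : 0 < ρ₀)
    (hgγ : ∀ x : ℝ, g x = γ₀ x) (hg : DifferentiableOn ℂ g (strip (2 * ρ₀)))
    (him : 4 * supStrip ρ₀ (fun z => ((deriv g z).im : ℂ)) < 1) :
    Interface (const0 fun j => supStrip ρ₀ (iteratedDeriv (j + 1) g)) ρ₀ g := by
  have hper : ∀ x : ℝ, g ((x + 2 * Real.pi : ℝ) : ℂ) = g x := fun x => by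
    rw [hgγ, hgγ, hγ x]
  have hbd : ∀ (j : Fin 3), ∀ w ∈ strip ρ₀, ‖iteratedDeriv (j + 1) g w‖ ≤
      const0 fun j => supStrip ρ₀ (iteratedDeriv (j + 1) g) := fun j w hw =>
    (norm_le_toReal_supStrip (supStrip_iteratedDeriv_ne_top hρ₀ hg Real.two_pi_pos hper _) hw).trans
      (toReal_le_const0 (fun j => supStrip ρ₀ (iteratedDeriv (j + 1) g)) j)
  refine ⟨one_le_const0 _, hρ₀, hg.mono (strip_mono (by linarith)), fun w hw => ?_, fun w hw => ?_,
    fun w hw => ?_, fun w hw => ?_, fun x => by rw [hgγ, Complex.ofReal_im], hper⟩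
  · simpa [iteratedDeriv_succ] using hbd 0 w hw
  · simpa [iteratedDeriv_succ] using hbd 1 w hw
  · simpa [iteratedDeriv_succ] using hbd 2 w hw
  · have hfin : supStrip ρ₀ (fun z => ((deriv g z).im : ℂ)) ≠ ⊤ := fun e => by
      rw [e, ENNReal.mul_top (by norm_num)] at him
      exact absurd him (by simp)
    have h1 := norm_le_toReal_supStrip hfin hw
    rw [Complex.norm_real, Real.norm_eq_abs] at h1
    have h2 := ENNReal.toReal_mono ENNReal.one_ne_top him.le
    rw [ENNReal.toReal_mul, ENNReal.toReal_one, ENNReal.toReal_ofNat] at h2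
    linarith

end

end IPM

end

/-! ### Assembly of the theorem -/

theorem proposition5p13 :
    ∃ (N : ℕ) (C : (Fin N → ENNReal) → ℝ) (a : ℝ → ℝ) (T : ℝ → ℝ → ℝ),
      (∀ m, 0 < C m) ∧ (∀ c, 0 < c → 0 < a c) ∧
      (∀ c α, 0 < c → 0 < α → α < 1 → 0 < T c α ∧ T c α < 1) ∧
      ∀ (α : ℝ), 0 < α → α < 1 →
      ∀ (γ₀ : ℝ → ℝ), Function.Periodic γ₀ (2 * Real.pi) → AnalyticOnNhd ℝ γ₀ Set.univ →
      ∀ (ρ₀ : ℝ), 0 < ρ₀ →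
      ∀ (g : ℂ → ℂ), (∀ x : ℝ, g x = γ₀ x) → DifferentiableOn ℂ g (IPM.strip (2 * ρ₀)) →
        4 * IPM.supStrip ρ₀ (fun z => ((deriv g z).im : ℂ)) < 1 →
      ∀ (C₀ : ℝ), C₀ = C (fun j => IPM.supStrip ρ₀ (iteratedDeriv (j + 1) g)) →
      ∃ η : ℝ → ℂ → ℝ → ℂ,
        IPM.IsSolution g ρ₀ α C₀ (a C₀) (T C₀ α) η ∧
        -- the integrals in the equation converge absolutely
        (∀ ρ ∈ Set.Ioo 0 ρ₀, ∀ t ∈ IPM.timeSet ρ₀ α C₀ (a C₀) (T C₀ α) ρ, ∀ y ∈ IPM.Omega ρ,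
          MeasureTheory.IntegrableOn (IPM.integrand g α t (η t) y.1 y.2) IPM.Omega0 ∧
          IntervalIntegrable (fun s => IPM.F g α s (η s) y.1 y.2) MeasureTheory.volume 0 t) ∧
        -- uniqueness
        (∀ ζ : ℝ → ℂ → ℝ → ℂ, IPM.IsSolution g ρ₀ α C₀ (a C₀) (T C₀ α) ζ →
          ∀ ρ ∈ Set.Ioo 0 ρ₀, ∀ t ∈ IPM.timeSet ρ₀ α C₀ (a C₀) (T C₀ α) ρ, ∀ y ∈ IPM.Omega ρ,
            ζ t y.1 y.2 = η t y.1 y.2) := by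
  -- Three derivatives of `γ₀` suffice. The function `a` is chosen so that `C₀ / a C₀` is the speed
  -- attached to `C₀`, and `C₀` itself serves as the derivative bound `c` of the interface.
  refine ⟨3, IPM.const0, fun c => c / IPM.speed c, IPM.finalTime,
    fun m => by linarith [IPM.one_le_const0 m], fun c hc => div_pos hc (IPM.speed_pos c),
    fun c α hc h0 h1 => ?_, fun α h0 h1 γ₀ hγ _ ρ₀ hρ₀ g hgγ hg him C₀ hC₀ => ?_⟩
  · obtain ⟨hT0, hT4, -⟩ := IPM.finalTime_spec hc h0 h1
    exact ⟨hT0, by linarith⟩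
  · have hI := IPM.interface_of_data hγ hρ₀ hgγ hg him
    rw [← hC₀] at hI
    have hc : 0 < C₀ := by linarith [hI.one_le]
    obtain ⟨hT0, hT4, hT1, hT2, hT3, hf, hT5⟩ := IPM.finalTime_spec hc h0 h1
    have e : C₀ / (C₀ / IPM.speed C₀) = IPM.speed C₀ := div_div_cancel₀ hc.ne'
    exact ⟨IPM.sol g α, IPM.Setup.isSolution_sol ⟨hI, h0, h1, hT0, hT4, hT1, hT2, hT3⟩
      (div_pos hc (IPM.speed_pos C₀)) (by rwa [e]) (by rwa [e])⟩
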